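/- **Setting.** Let $\tau>1$, $\theta_0>0$, $a_0>0$. Let $X,Y$ be real Hilbert spaces, $F:D(F)\subset X\to Y$ Fréchet differentiable, $x^\dagger\in D(F)$, $y=F(x^\dagger)$, $x_0\in X$, and let $\rho>0$ be such that the open ball satisfies $B_\rho(x^\dagger)\subset D(F)$. Let $(\alpha_k)_{k\ge 0}$ be positive numbers with $\alpha_0=a_0$, $$0\le \frac1{\alpha_{k+1}}-\frac1{\alpha_k}\le\theta_0,\qquad \alpha_k\to 0 .$$ Let $g_\alpha(\lambda)=\frac1\lambda(1-e^{-\lambda/\alpha})$, $g_\alpha(0)=\frac1\alpha$ (asymptotic regularization), with residual function $r_\alpha(\lambda)=1-\lambda g_\alpha(\lambda)=e^{-\lambda/\alpha}$, and put $c_3=\frac1{\sqrt{2e}}$, $c_4=\sqrt{2/e}$. Assume $$\|F'(x)\|\le\min\{c_3\alpha_0^{1/2},\beta_0^{1/2}\}\qquad (x\in B_\rho(x^\dagger)),$$ where $0<\beta_0\le\frac12$ is such that $r_{\alpha_0}(\lambda)\ge\frac34$ on $[0,\beta_0]$. For $\delta>0$ and data $y^\delta$ with $\|y^\delta-y\|\le\delta$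 let $x_0^\delta=x_0$, $$x_{k+1}^\delta=x_0-g_{\alpha_k}\big(F'(x_k^\delta)^*F'(x_k^\delta)\big)F'(x_k^\delta)^*\big(F(x_k^\delta)-y^\delta-F'(x_k^\delta)(x_k^\delta-x_0)\big),$$ and let $k_\delta$ be the first integer with $\|F(x^\delta_{k_\delta})-y^\delta\|\le\tau\delta$. Functions of nonnegative self-adjoint operators are understood through the continuous functional calculus ($(-\log\lambda)^{-\mu}:=0$ at $\lambda=0$). Consider the conditions, for all $x,z\in B_\rho(x^\dagger)$ and $w\in X$: * (Lip) $\|F'(x)-F'(z)\|\le L\|x-z\|$; * (A5) $F'(x)=F'(z)R(x,z)$ with bounded linear $R(x,z):X\to X$, $\|I-R(x,z)\|\le K_0\|x-z\|$, where $K_0>0$; * (A6) $\|[F'(x)-F'(z)]w\|\le K_1\|x-z\|\,\|F'(z)w\|+K_2\|F'(z)(x-z)\|\,\|w\|$, where $K_1,K_2>0$; and the source conditions * (H$_\nu$) $x_0-x^\dagger=(F'(x^\dagger)^*F'(x^\dagger))^\nu\omega$ for some $\omega\in X$; * (Log$_\mu$) $x_0-x^\dagger=\big(-\log(F'(x^\dagger)^*F'(x^\dagger))\big)^{-\mu}\omega$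 for some $\omega\in X$. **(i)** There are $\eta_0>0$ depending only on $\tau,\theta_0,\alpha_0$, and, for each $\nu\ge\frac12$, a constant $C_\nu>0$ depending only on $\tau,\theta_0,\alpha_0,\nu$, such that the following holds. Let $F$ satisfy (Lip), $\rho>4\|x_0-x^\dagger\|$, and let (H$_\nu$) hold with some $\nu\ge\frac12$. Then there is a unique $u\in\mathcal N(F'(x^\dagger)^*)^\perp$ with $x_0-x^\dagger=F'(x^\dagger)^*u$. If $L\|u\|\le\eta_0$, then for all $\delta>0$ so small that $\|u\|\delta\le\eta_0\rho^2$ and all such $y^\delta$, the index $k_\delta$ exists, $x_k^\delta\in B_\rho(x^\dagger)$ for $0\le k\le k_\delta$, and $$\|x_{k_\delta}^\delta-x^\dagger\|\le C_\nu\|\omega\|^{1/(1+2\nu)}\delta^{2\nu/(1+2\nu)}.$$ **(ii)** Fix $\gamma_1>c_3(1+\theta_0\alpha_0)^{1/2}/(\tau-1)$. There is $\eta_1>0$ depending only on $\tau,\theta_0,\alpha_0$ (and the fixed $\gamma_1$) such that the following holds if $F$ satisfies (A5) and (A6), $\rho>2(1+c_4\gamma_1)\|x_0-x^\dagger\|$,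 $x_0-x^\dagger\in\mathcal N(F'(x^\dagger))^\perp$ and $(K_0+K_1+K_2)\|x_0-x^\dagger\|\le\eta_1$. For all $\delta>0$ and all such $y^\delta$ the index $k_\delta$ exists and $x_k^\delta\in B_\rho(x^\dagger)$ for $0\le k\le k_\delta$. Moreover: * $x_{k_\delta}^\delta\to x^\dagger$ as $\delta\to0$, uniformly in the data $y^\delta$ with $\|y^\delta-y\|\le\delta$; * if (H$_\nu$) holds with some $\nu>0$, then $\|x_{k_\delta}^\delta-x^\dagger\|\le C_\nu\|\omega\|^{1/(1+2\nu)}\delta^{2\nu/(1+2\nu)}$ for all $\delta>0$; * if (Log$_\mu$) holds with some $\mu>0$, then $\|x_{k_\delta}^\delta-x^\dagger\|\le C_\mu\|\omega\|\big(1+\big|\ln\frac{\delta}{\|\omega\|}\big|\big)^{-\mu}$ for all $0<\delta\le\|\omega\|$. Here $C_\nu$ (resp. $C_\mu$) depends only on $\tau,\theta_0,\alpha_0$ (and the fixed $\gamma_1$) and on $\nu$ (resp. $\mu$). -/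

import Mathlib

open Set Filter Topology

universe u v

/-- `S` is the value `f(T)` of the continuous functional calculus at a bounded nonnegative
self-adjoint operator `T` of a real Hilbert space (so that the spectrum of `T` is contained in
`[0, ‖T‖]`): `S` is the operator-norm limit of `p(T)` as polynomials `p` tend to `f` uniformly
on `[0, ‖T‖]`. -/
def IsFunctionOf {X : Type*} [NormedAddCommGroup X] [InnerProductSpace ℝ X]
    (f : ℝ → ℝ) (T S : X →L[ℝ] X) : Prop :=
  ∀ ε : ℝ, 0 < ε → ∃ p : Polynomial ℝ,
    (∀ t ∈ Icc (0 : ℝ) ‖T‖, |p.eval t - f t| ≤ ε) ∧ ‖Polynomial.aeval T p - S‖ ≤ ε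

open Classical in
/-- The operator `f(T)`, for `T` bounded, nonnegative and self-adjoint and `f` continuous on
`[0, ‖T‖]` (the operator `S` with `IsFunctionOf f T S` then exists and is unique). -/
noncomputable def functionOf {X : Type*} [NormedAddCommGroup X] [InnerProductSpace ℝ X]
    (f : ℝ → ℝ) (T : X →L[ℝ] X) : X →L[ℝ] X :=
  if h : ∃ S : X →L[ℝ] X, IsFunctionOf f T S then h.choose else 0

/-- `A* A`. -/
noncomputable def normalOp {X Y : Type*}
    [NormedAddCommGroup X] [InnerProductSpace ℝ X] [CompleteSpace X]
    [NormedAddCommGroup Y] [InnerProductSpace ℝ Y] [CompleteSpace Y]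
    (A : X →L[ℝ] Y) : X →L[ℝ] X :=
  (ContinuousLinearMap.adjoint A).comp A

/-- The filter function `g_α(t) = (1 - exp (-t/α)) / t` of asymptotic regularization, with its
continuous extension `g_α(0) = 1/α`. -/
noncomputable def asymptoticFilter (α t : ℝ) : ℝ :=
  if t = 0 then 1 / α else (1 - Real.exp (-t / α)) / t

/-- The residual function `r_α(t) = 1 - t g_α(t)`. -/
noncomputable def residualFunction (g : ℝ → ℝ → ℝ) (α t : ℝ) : ℝ := 1 - t * g α t

/-- The Newton type iterates: `x_0` is the initial guess and
`x_{k+1} = x_0 - g_{α_k}(F'(x_k)* F'(x_k)) F'(x_k)* (F(x_k) - z - F'(x_k)(x_k - x_0))`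
for the data `z`. -/
noncomputable def newtonIterate {X Y : Type*}
    [NormedAddCommGroup X] [InnerProductSpace ℝ X] [CompleteSpace X]
    [NormedAddCommGroup Y] [InnerProductSpace ℝ Y] [CompleteSpace Y]
    (g : ℝ → ℝ → ℝ) (α : ℕ → ℝ) (F : X → Y) (x₀ : X) (z : Y) : ℕ → X
  | 0 => x₀
  | k + 1 =>
    x₀ - functionOf (g (α k)) (normalOp (fderiv ℝ F (newtonIterate g α F x₀ z k)))
      (ContinuousLinearMap.adjoint (fderiv ℝ F (newtonIterate g α F x₀ z k))
        (F (newtonIterate g α F x₀ z k) - z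
          - fderiv ℝ F (newtonIterate g α F x₀ z k) (newtonIterate g α F x₀ z k - x₀)))

/-- `k` is the first index with `‖F(x_k) - z‖ ≤ τ δ` (discrepancy principle). -/
def IsDiscrepancyIndex {X Y : Type*} [NormedAddCommGroup Y]
    (F : X → Y) (x : ℕ → X) (z : Y) (τ δ : ℝ) (k : ℕ) : Prop :=
  ‖F (x k) - z‖ ≤ τ * δ ∧ ∀ j < k, τ * δ < ‖F (x j) - z‖

/-- The iteration with the data `z` runs without leaving the ball `B_ρ(xd)` until the discrepancy
principle stops it, and the iterate at which it stops has distance at most `b` to `xd`. -/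
def StopsWithError {X Y : Type*}
    [NormedAddCommGroup X] [InnerProductSpace ℝ X] [CompleteSpace X]
    [NormedAddCommGroup Y] [InnerProductSpace ℝ Y] [CompleteSpace Y]
    (g : ℝ → ℝ → ℝ) (α : ℕ → ℝ) (F : X → Y) (x₀ xd : X) (ρ τ δ : ℝ) (z : Y) (b : ℝ) : Prop :=
  ∃ k : ℕ, IsDiscrepancyIndex F (newtonIterate g α F x₀ z) z τ δ k ∧
    (∀ j ≤ k, newtonIterate g α F x₀ z j ∈ Metric.ball xd ρ) ∧
    ‖newtonIterate g α F x₀ z k - xd‖ ≤ b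

/-- The conditions on the regularization parameters `α_k`: positive, with
`0 ≤ 1/α_{k+1} - 1/α_k ≤ θ₀`, and tending to `0`. -/
structure IsParameterSequence (θ₀ : ℝ) (α : ℕ → ℝ) : Prop where
  pos : ∀ k, 0 < α k
  step : ∀ k, 0 ≤ 1 / α (k + 1) - 1 / α k ∧ 1 / α (k + 1) - 1 / α k ≤ θ₀
  lim : Tendsto α atTop (𝓝 0)

/-- The constant `c₃ = 1/√(2e)`, for which `r_α(t) √t ≤ c₃ √α`. -/
noncomputable def asymptoticC3 : ℝ := 1 / Real.sqrt (2 * Real.exp 1)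

/-- The constant `c₄ = √(2/e)`, for which `g_α(t) √t ≤ c₄ / √α`. -/
noncomputable def asymptoticC4 : ℝ := Real.sqrt (2 / Real.exp 1)

/-- The standing conditions on the operator `F : D → Y` (values of `F` outside `D` are irrelevant)
around the solution `xd`: `B_ρ(xd) ⊆ D`, `F` is Fréchet differentiable, and
`‖F'(x)‖ ≤ min (c₃ √α₀) (√β₀)` on `B_ρ(xd)`, where `0 < β₀ ≤ 1/2` is such that `r_{α₀} ≥ 3/4`
on `[0, β₀]`. -/
structure StandingConditions {X Y : Type*}
    [NormedAddCommGroup X] [InnerProductSpace ℝ X]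
    [NormedAddCommGroup Y] [InnerProductSpace ℝ Y]
    (D : Set X) (F : X → Y) (xd : X) (ρ β₀ α₀ : ℝ) : Prop where
  radius_pos : 0 < ρ
  ball_subset : Metric.ball xd ρ ⊆ D
  differentiable : DifferentiableOn ℝ F D
  beta_pos : 0 < β₀
  beta_le : β₀ ≤ 1 / 2
  residual_ge : ∀ t ∈ Icc (0 : ℝ) β₀, 3 / 4 ≤ residualFunction asymptoticFilter α₀ t
  deriv_le : ∀ x ∈ Metric.ball xd ρ,
    ‖fderiv ℝ F x‖ ≤ min (asymptoticC3 * Real.sqrt α₀) (Real.sqrt β₀)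

/-- `F'` is Lipschitz continuous with constant `L` on `B_ρ(xd)`. -/
def LipschitzDeriv {X Y : Type*}
    [NormedAddCommGroup X] [InnerProductSpace ℝ X]
    [NormedAddCommGroup Y] [InnerProductSpace ℝ Y]
    (F : X → Y) (xd : X) (ρ L : ℝ) : Prop :=
  ∀ x ∈ Metric.ball xd ρ, ∀ z ∈ Metric.ball xd ρ,
    ‖fderiv ℝ F x - fderiv ℝ F z‖ ≤ L * ‖x - z‖

/-- `F'(x) = F'(z) R(x, z)` with bounded linear `R(x, z)`, `‖I - R(x, z)‖ ≤ K₀ ‖x - z‖`, for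
all `x, z ∈ B_ρ(xd)`. -/
def RangeInvariance {X Y : Type*}
    [NormedAddCommGroup X] [InnerProductSpace ℝ X]
    [NormedAddCommGroup Y] [InnerProductSpace ℝ Y]
    (F : X → Y) (xd : X) (ρ K₀ : ℝ) : Prop :=
  ∀ x ∈ Metric.ball xd ρ, ∀ z ∈ Metric.ball xd ρ, ∃ R : X →L[ℝ] X,
    fderiv ℝ F x = (fderiv ℝ F z).comp R ∧ ‖ContinuousLinearMap.id ℝ X - R‖ ≤ K₀ * ‖x - z‖

/-- `‖[F'(x) - F'(z)] w‖ ≤ K₁ ‖x - z‖ ‖F'(z) w‖ + K₂ ‖F'(z)(x - z)‖ ‖w‖` for all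
`x, z ∈ B_ρ(xd)` and all `w`. -/
def DerivDifferenceBound {X Y : Type*}
    [NormedAddCommGroup X] [InnerProductSpace ℝ X]
    [NormedAddCommGroup Y] [InnerProductSpace ℝ Y]
    (F : X → Y) (xd : X) (ρ K₁ K₂ : ℝ) : Prop :=
  ∀ x ∈ Metric.ball xd ρ, ∀ z ∈ Metric.ball xd ρ, ∀ w : X,
    ‖(fderiv ℝ F x - fderiv ℝ F z) w‖
      ≤ K₁ * ‖x - z‖ * ‖fderiv ℝ F z w‖ + K₂ * ‖fderiv ℝ F z (x - z)‖ * ‖w‖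

/-- The Hölder source condition `e = (A* A)^ν ω`. -/
def HolderSource {X Y : Type*}
    [NormedAddCommGroup X] [InnerProductSpace ℝ X] [CompleteSpace X]
    [NormedAddCommGroup Y] [InnerProductSpace ℝ Y] [CompleteSpace Y]
    (A : X →L[ℝ] Y) (e : X) (ν : ℝ) (ω : X) : Prop :=
  e = functionOf (fun t : ℝ => t ^ ν) (normalOp A) ω

/-- The logarithmic source condition `e = (-log (A* A))^(-μ) ω`, where `‖A* A‖ < 1`; the function
`(-log t)^(-μ)` is extended by its limit `0` to `t = 0`. -/
def LogSource {X Y : Type*}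
    [NormedAddCommGroup X] [InnerProductSpace ℝ X] [CompleteSpace X]
    [NormedAddCommGroup Y] [InnerProductSpace ℝ Y] [CompleteSpace Y]
    (A : X →L[ℝ] Y) (e : X) (μ : ℝ) (ω : X) : Prop :=
  e = functionOf (fun t : ℝ => if t = 0 then 0 else (-Real.log t) ^ (-μ)) (normalOp A) ω

/-! Write e_k = x_k - x†, s_k = 1/α_k, T = F'(x†) and S_k = F'(x_k). The residual function is an
exponential, so r_{α_k}(A) = exp(-s_k A). A Newton step therefore reads e_{k+1} = exp(-s_k S_k* S_k)
e_0 minus a filtered term that carries the Taylor remainder and the data noise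
(`newtonIterate_succ_sub`). If the remainder, and the exchange of S_k* S_k for T* T, each cost at
most ε‖e_k‖ with a small ε, then e_{k+1} equals exp(-s_k T* T) e_0 up to O(ε)‖e_k‖ + δ√s_k. The
nonlinear iteration thus behaves like linear regularization.

The exchange is a Duhamel argument. The plain formula only gives a logarithmically divergent
integral, so the time interval is halved and a different intertwining operator is inserted on each
half (`norm_expOp_sub_expOp_le` under (A5), `norm_expOp_adjoint_sub_le` on the range of T* under
(Lip)).

The discrepancy principle enters through `oracle_inequality`: the final error is at most a constant
times ‖exp(-s_l T* T) e_0‖ + δ√s_l for every l. For l beyond the stopping index the small final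
residual controls the missing approximation error. For earlier l the large residual just before
stopping shows that the noise term is dominated by the approximation error. Convergence and both
rates then follow by choosing l (`exists_noise_level`, `holder_rate`, `log_rate`).

It remains to keep the iterates in the ball until the residual is small. Let m be the first index at
which the noise dominates: δ√s_m ≥ γ‖e_0‖ in (ii), δ s_m ≥ γ‖u‖ in (i). An induction up to m
propagates bounds on e_k (`structural_step`, `lipschitz_step`), and at m the residual is at most τδ.
In (i) the Taylor remainder L‖e‖² is not relative to T e. It is controlled by writing e as S* u'
plus a small term (`norm_sq_step_le`), which bounds ‖e‖² by ‖u‖‖T e‖ up to small terms.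

Everything rests on a functional calculus built from polynomials, whose one substantial fact is the
spectral bound `norm_aeval_le`. -/

/-! ### Polynomials in a nonnegative operator: invertibility and the spectral norm bound. -/

section PolynomialCalculus

variable {X : Type*} [NormedAddCommGroup X] [InnerProductSpace ℝ X]

/-- Polynomials in a symmetric operator are symmetric. -/
theorem inner_aeval_comm {T : X →L[ℝ] X} (hT : T.IsPositive) (p : Polynomial ℝ) (x y : X) :
    inner ℝ (Polynomial.aeval T p x) y = inner ℝ x (Polynomial.aeval T p y) := by
  induction p using Polynomial.induction_on' generalizing x y with
  | add p q hp hq => simp [inner_add_left, inner_add_right, hp, hq]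
  | monomial n a =>
    rw [← Polynomial.C_mul_X_pow_eq_monomial]
    simp only [map_mul, Polynomial.aeval_C, map_pow, Polynomial.aeval_X, ← Algebra.smul_def,
      smul_apply, real_inner_smul_left, real_inner_smul_right]
    congr 1
    induction n generalizing x y with
    | zero => simp
    | succ n ih =>
      calc inner ℝ ((T ^ (n + 1)) x) y = inner ℝ ((T ^ n) (T x)) y := by rw [pow_succ]; rfl
        _ = inner ℝ x (T ((T ^ n) y)) := by rw [ih, hT.inner_left_eq_inner_right]
        _ = inner ℝ x ((T ^ (n + 1)) y) := by rw [pow_succ']; rfl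

variable [CompleteSpace X]

theorem isUnit_of_coercive {U : X →L[ℝ] X} {c : ℝ} (hc : 0 < c)
    (h : ∀ x, c * ‖x‖ ^ 2 ≤ |inner ℝ (U x) x|) : IsUnit U := by
  refine ContinuousLinearMap.isUnit_of_forall_le_norm_inner_map U (c := ⟨c, hc.le⟩) hc fun x => ?_
  rw [mul_comm]
  exact h x

/-- A polynomial without roots in `[0, ‖T‖]` takes an invertible value at `T`. -/
theorem isUnit_aeval_of_ne_zero {T : X →L[ℝ] X} (hT : T.IsPositive) (q : Polynomial ℝ)
    (hq : ∀ t ∈ Icc (0 : ℝ) ‖T‖, q.eval t ≠ 0) : IsUnit (Polynomial.aeval T q) := by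
  induction q using UniqueFactorizationMonoid.induction_on_prime with
  | h₁ => exact absurd (by simp) (hq 0 ⟨le_rfl, norm_nonneg _⟩)
  | h₂ x hx => exact hx.map _
  | h₃ a p ha hp ih =>
    rw [map_mul]
    refine IsUnit.mul ?_ (ih fun t ht h0 => hq t ht (by simp [h0]))
    have hp' : ∀ t ∈ Icc (0 : ℝ) ‖T‖, p.eval t ≠ 0 := fun t ht h0 => hq t ht (by simp [h0])
    have hirr := hp.irreducible
    have hbound : ∀ x : X, inner ℝ (T x) x ≤ ‖T‖ * ‖x‖ ^ 2 := fun x =>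
      (real_inner_le_norm _ _).trans (by
        have := T.le_opNorm x
        nlinarith [norm_nonneg x])
    by_cases hroot : ∃ t, p.eval t = 0
    · obtain ⟨t, ht⟩ := hroot
      obtain ⟨r, hr⟩ := Polynomial.dvd_iff_isRoot.mpr ht
      have hru : IsUnit r := by
        rcases hirr.isUnit_or_isUnit hr with h | h
        · exact absurd h (Polynomial.not_isUnit_X_sub_C t)
        · exact h
      rw [hr, map_mul]
      refine IsUnit.mul ?_ (hru.map _)
      have htn : t ∉ Icc (0 : ℝ) ‖T‖ := fun h => hp' t h ht
      have hval : ∀ x : X, inner ℝ (Polynomial.aeval T (Polynomial.X - Polynomial.C t) x) x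
          = inner ℝ (T x) x - t * ‖x‖ ^ 2 := fun x => by
        simp [inner_sub_left, Algebra.algebraMap_eq_smul_one, real_inner_smul_left]
      -- Outside [0, ‖T‖] the form of T - t is definite, and the distance of t to the interval is a
      -- coercivity constant.
      rcases lt_or_ge t 0 with h0 | h0
      · refine isUnit_of_coercive (c := -t) (by linarith) fun x => ?_
        rw [hval]
        refine le_trans ?_ (le_abs_self _)
        have := hT.inner_nonneg_left x
        linarith
      · have h1 : ‖T‖ < t := by
          by_contra h
          exact htn ⟨h0, not_lt.mp h⟩
        refine isUnit_of_coercive (c := t - ‖T‖) (by linarith) fun x => ?_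
        rw [hval]
        refine le_trans ?_ (neg_le_abs _)
        have := hbound x
        linarith
    · push Not at hroot
      have hdeg : p.natDegree ≤ 2 := Polynomial.natDegree_le_of_degree_le hirr.degree_le_two
      obtain ⟨a₀, b₀, c₀, hpe⟩ : ∃ a b c : ℝ, p = Polynomial.C a * Polynomial.X ^ 2
          + Polynomial.C b * Polynomial.X + Polynomial.C c :=
        ⟨_, _, _, Polynomial.eq_quadratic_of_degree_le_two hirr.degree_le_two⟩
      have hev : ∀ t, p.eval t = a₀ * t ^ 2 + b₀ * t + c₀ := fun t => by rw [hpe]; simp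
      have hval : ∀ x : X, inner ℝ (Polynomial.aeval T p x) x
          = a₀ * ‖T x‖ ^ 2 + b₀ * inner ℝ (T x) x + c₀ * ‖x‖ ^ 2 := fun x => by
        rw [hpe]
        simp only [map_add, map_mul, Polynomial.aeval_C, Polynomial.aeval_X,
          add_apply, smul_apply,
          inner_add_left, real_inner_smul_left, Algebra.algebraMap_eq_smul_one,
          one_apply_eq_self, real_inner_self_eq_norm_sq, pow_two,
          ContinuousLinearMap.mul_def, ContinuousLinearMap.comp_apply]
        rw [hT.inner_left_eq_inner_right, real_inner_self_eq_norm_sq]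
        ring
      have ha0 : a₀ ≠ 0 ∨ b₀ = 0 := by
        by_contra! h
        refine hroot (-c₀ / b₀) ?_
        rw [hev, h.1]
        field_simp [h.2]
        ring
      rcases ha0 with ha0 | hb0
      · have hdisc : b₀ ^ 2 < 4 * a₀ * c₀ := by
          by_contra! h
          have hs : discrim a₀ b₀ c₀ = √(discrim a₀ b₀ c₀) * √(discrim a₀ b₀ c₀) :=
            (Real.mul_self_sqrt (by unfold discrim; linarith)).symm
          obtain ⟨t, ht⟩ := exists_quadratic_eq_zero ha0 ⟨_, hs⟩
          exact hroot t (by rw [hev, ← ht]; ring)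
        refine isUnit_of_coercive (c := (4 * a₀ * c₀ - b₀ ^ 2) / (4 * |a₀|))
          (div_pos (by linarith) (by positivity)) fun x => ?_
        -- Completing the square: 4a⟨p(T)x, x⟩ = ‖2aTx + bx‖² + (4ac - b²)‖x‖², so a negative
        -- discriminant gives coercivity.
        have hsq : 0 ≤ ‖(2 * a₀) • T x + b₀ • x‖ ^ 2 := by positivity
        rw [← real_inner_self_eq_norm_sq] at hsq
        simp only [inner_add_left, inner_add_right, real_inner_smul_left, real_inner_smul_right,
          real_inner_comm (T x) x] at hsq
        simp only [real_inner_self_eq_norm_sq] at hsq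
        have hkey : (4 * a₀ * c₀ - b₀ ^ 2) * ‖x‖ ^ 2
            ≤ 4 * a₀ * inner ℝ (Polynomial.aeval T p x) x := by
          rw [hval]
          nlinarith
        rw [div_mul_eq_mul_div, div_le_iff₀ (by positivity)]
        calc _ ≤ 4 * a₀ * inner ℝ (Polynomial.aeval T p x) x := hkey
          _ ≤ |4 * a₀ * inner ℝ (Polynomial.aeval T p x) x| := le_abs_self _
          _ = _ := by rw [abs_mul, abs_mul]; norm_num; ring
      · by_cases ha0 : a₀ = 0
        · have hc0 : c₀ ≠ 0 := fun h => hroot 0 (by rw [hev]; simp [h])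
          rw [hpe, ha0, hb0]
          simp only [map_zero, zero_mul, zero_add, Polynomial.aeval_C]
          exact (isUnit_iff_ne_zero.mpr hc0).map _
        · have hdisc : 0 < a₀ * c₀ := by
            by_contra! h
            have hs : discrim a₀ b₀ c₀ = √(discrim a₀ b₀ c₀) * √(discrim a₀ b₀ c₀) :=
              (Real.mul_self_sqrt (by unfold discrim; rw [hb0]; nlinarith)).symm
            obtain ⟨t, ht⟩ := exists_quadratic_eq_zero ha0 ⟨_, hs⟩
            exact hroot t (by rw [hev, ← ht]; ring)
          refine isUnit_of_coercive (c := |c₀|) (by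
            refine abs_pos.mpr fun h => ?_
            simp [h] at hdisc) fun x => ?_
          rw [hval, hb0, zero_mul, add_zero]
          rcases pos_and_pos_or_neg_and_neg_of_mul_pos hdisc with ⟨h1, h2⟩ | ⟨h1, h2⟩
          · refine le_trans ?_ (le_abs_self _)
            rw [abs_of_pos h2]
            nlinarith [sq_nonneg ‖T x‖]
          · refine le_trans ?_ (neg_le_abs _)
            rw [abs_of_neg h2]
            nlinarith [sq_nonneg ‖T x‖]

/-- If ‖S‖ exceeded the supremum of |p| on the interval, then ‖S‖² - p² would have no zero there and
‖S‖² - S² would be invertible, hence bounded below. For symmetric S this keeps ‖Sx‖/‖x‖ uniformly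
away from ‖S‖, contradicting the definition of the operator norm. -/
theorem norm_aeval_le {T : X →L[ℝ] X} (hT : T.IsPositive) (p : Polynomial ℝ) {M : ℝ}
    (hp : ∀ t ∈ Icc (0 : ℝ) ‖T‖, |p.eval t| ≤ M) : ‖Polynomial.aeval T p‖ ≤ M := by
  by_contra! hlt
  set S := Polynomial.aeval T p with hS
  have hM : 0 ≤ M := (abs_nonneg _).trans (hp 0 ⟨le_rfl, norm_nonneg _⟩)
  have hs : 0 < ‖S‖ := hM.trans_lt hlt
  have hunit : IsUnit (Polynomial.aeval T (Polynomial.C (‖S‖ ^ 2) - p * p)) := by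
    refine isUnit_aeval_of_ne_zero hT _ fun t ht h => ?_
    have h1 := hp t ht
    simp only [Polynomial.eval_sub, Polynomial.eval_C, Polynomial.eval_mul] at h
    have h2 : |p.eval t| ^ 2 = ‖S‖ ^ 2 := by rw [sq_abs]; linarith
    nlinarith [abs_nonneg (p.eval t)]
  obtain ⟨V, hV⟩ := hunit
  have hVx : ∀ x, (V : X →L[ℝ] X) x = ‖S‖ ^ 2 • x - S (S x) := fun x => by
    rw [hV]
    simp [← hS, Algebra.algebraMap_eq_smul_one, pow_two, mul_smul]
  have hlow : ∀ x, ‖x‖ ≤ (‖(↑V⁻¹ : X →L[ℝ] X)‖ + 1) * ‖(V : X →L[ℝ] X) x‖ := fun x => by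
    have h1 : (↑V⁻¹ : X →L[ℝ] X) ((V : X →L[ℝ] X) x) = x := by
      rw [← ContinuousLinearMap.comp_apply, ← ContinuousLinearMap.mul_def, Units.inv_mul]
      rfl
    have h2 := (↑V⁻¹ : X →L[ℝ] X).le_opNorm ((V : X →L[ℝ] X) x)
    rw [h1] at h2
    nlinarith [norm_nonneg ((V : X →L[ℝ] X) x)]
  set N := ‖(↑V⁻¹ : X →L[ℝ] X)‖ + 1 with hN
  have hNpos : 0 < N := by positivity
  -- Expand ‖‖S‖²x - S²x‖², use ⟨S²x, x⟩ = ‖Sx‖² and ‖S²x‖ ≤ ‖S‖‖Sx‖.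
  have hup : ∀ x, ‖(V : X →L[ℝ] X) x‖ ^ 2 ≤ ‖S‖ ^ 2 * (‖S‖ ^ 2 * ‖x‖ ^ 2 - ‖S x‖ ^ 2) := fun x => by
    rw [hVx, norm_sub_sq_real, norm_smul, real_inner_smul_left, ← inner_aeval_comm hT, ← hS,
      real_inner_self_eq_norm_sq, Real.norm_of_nonneg (by positivity)]
    have h1 := S.le_opNorm (S x)
    have h2 : ‖S (S x)‖ ^ 2 ≤ (‖S‖ * ‖S x‖) ^ 2 := by gcongr
    nlinarith
  have hSx : ∀ x, ‖S x‖ ≤ √(‖S‖ ^ 2 - 1 / (N ^ 2 * ‖S‖ ^ 2)) * ‖x‖ := fun x => by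
    suffices h : ‖S x‖ ^ 2 ≤ (‖S‖ ^ 2 - 1 / (N ^ 2 * ‖S‖ ^ 2)) * ‖x‖ ^ 2 by
      have := Real.sqrt_le_sqrt h
      rwa [Real.sqrt_mul' _ (sq_nonneg ‖x‖), Real.sqrt_sq (norm_nonneg _),
        Real.sqrt_sq (norm_nonneg _)] at this
    have h1 : ‖x‖ ^ 2 ≤ N ^ 2 * ‖(V : X →L[ℝ] X) x‖ ^ 2 := by
      rw [← mul_pow]
      exact pow_le_pow_left₀ (norm_nonneg _) (hlow x) 2
    have h2 : ‖x‖ ^ 2 ≤ N ^ 2 * (‖S‖ ^ 2 * (‖S‖ ^ 2 * ‖x‖ ^ 2 - ‖S x‖ ^ 2)) :=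
      h1.trans (by gcongr; exact hup x)
    have h3 : ‖x‖ ^ 2 / (N ^ 2 * ‖S‖ ^ 2) ≤ ‖S‖ ^ 2 * ‖x‖ ^ 2 - ‖S x‖ ^ 2 := by
      rw [div_le_iff₀ (by positivity)]
      linarith
    rw [sub_mul, one_div_mul_eq_div]
    linarith
  have h4 : ‖S‖ ≤ √(‖S‖ ^ 2 - 1 / (N ^ 2 * ‖S‖ ^ 2)) :=
    S.opNorm_le_bound (Real.sqrt_nonneg _) hSx
  have h5 : √(‖S‖ ^ 2 - 1 / (N ^ 2 * ‖S‖ ^ 2)) < ‖S‖ := by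
    rw [Real.sqrt_lt' hs]
    have : 0 < 1 / (N ^ 2 * ‖S‖ ^ 2) := by positivity
    linarith
  linarith

end PolynomialCalculus

/-! ### Continuous functions of a nonnegative operator: algebra, existence, uniqueness and order. -/

section FunctionOf

variable {X : Type*} [NormedAddCommGroup X] [InnerProductSpace ℝ X]

theorem IsFunctionOf.congr {f g : ℝ → ℝ} {T S : X →L[ℝ] X} (h : IsFunctionOf f T S)
    (hfg : ∀ t ∈ Icc (0 : ℝ) ‖T‖, f t = g t) : IsFunctionOf g T S := fun ε hε => by
  obtain ⟨p, hp, hpS⟩ := h ε hε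
  exact ⟨p, fun t ht => by rw [← hfg t ht]; exact hp t ht, hpS⟩

theorem isFunctionOf_aeval (T : X →L[ℝ] X) (p : Polynomial ℝ) :
    IsFunctionOf (fun t => p.eval t) T (Polynomial.aeval T p) := fun ε hε =>
  ⟨p, fun t _ => by simpa using hε.le, by simpa using hε.le⟩

theorem IsFunctionOf.add {f g : ℝ → ℝ} {T S S' : X →L[ℝ] X} (hf : IsFunctionOf f T S)
    (hg : IsFunctionOf g T S') : IsFunctionOf (fun t => f t + g t) T (S + S') := fun ε hε => by
  obtain ⟨p, hp, hpS⟩ := hf (ε / 2) (by positivity)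
  obtain ⟨q, hq, hqS⟩ := hg (ε / 2) (by positivity)
  refine ⟨p + q, fun t ht => ?_, ?_⟩
  · rw [Polynomial.eval_add, add_sub_add_comm]
    exact (abs_add_le _ _).trans (by linarith [hp t ht, hq t ht])
  · rw [map_add, add_sub_add_comm]
    exact (norm_add_le _ _).trans (by linarith)

theorem IsFunctionOf.neg {f : ℝ → ℝ} {T S : X →L[ℝ] X} (hf : IsFunctionOf f T S) :
    IsFunctionOf (fun t => -f t) T (-S) := fun ε hε => by
  obtain ⟨p, hp, hpS⟩ := hf ε hε
  refine ⟨-p, fun t ht => ?_, ?_⟩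
  · rw [Polynomial.eval_neg, neg_sub_neg, abs_sub_comm]
    exact hp t ht
  · rw [map_neg, neg_sub_neg, norm_sub_rev]
    exact hpS

theorem IsFunctionOf.exists_bound {f : ℝ → ℝ} {T S : X →L[ℝ] X} (hf : IsFunctionOf f T S) :
    ∃ M : ℝ, 0 ≤ M ∧ ‖S‖ ≤ M ∧ ∀ t ∈ Icc (0 : ℝ) ‖T‖, |f t| ≤ M := by
  obtain ⟨p, hp, -⟩ := hf 1 one_pos
  obtain ⟨B, hB⟩ := isCompact_Icc.exists_bound_of_continuousOn (p.continuous.continuousOn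
    (s := Icc (0 : ℝ) ‖T‖))
  have hB0 : 0 ≤ B := (norm_nonneg _).trans (hB 0 ⟨le_rfl, norm_nonneg _⟩)
  refine ⟨B + 1 + ‖S‖, by positivity, by linarith, fun t ht => ?_⟩
  have h1 := hp t ht
  have h2 := hB t ht
  rw [Real.norm_eq_abs] at h2
  have h3 := abs_sub_abs_le_abs_sub (f t) (p.eval t)
  rw [abs_sub_comm] at h3
  linarith [norm_nonneg S]

theorem IsFunctionOf.mul {f g : ℝ → ℝ} {T S S' : X →L[ℝ] X} (hf : IsFunctionOf f T S)
    (hg : IsFunctionOf g T S') : IsFunctionOf (fun t => f t * g t) T (S * S') := fun ε hε => by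
  obtain ⟨M, hM, hMS, hMf⟩ := hf.exists_bound
  obtain ⟨M', hM', hMS', hMg⟩ := hg.exists_bound
  -- The cap 1 keeps the approximating factor q below M' + 1; the two errors then add up to e(M' +
  -- 1) + Me.
  set e := min 1 (ε / (M + M' + 1)) with he
  have he0 : 0 < e := by positivity
  have he1 : e ≤ 1 := min_le_left _ _
  have he2 : e * (M + M' + 1) ≤ ε := by
    rw [← le_div_iff₀ (by positivity)]
    exact min_le_right _ _
  obtain ⟨p, hp, hpS⟩ := hf e he0
  obtain ⟨q, hq, hqS⟩ := hg e he0
  refine ⟨p * q, fun t ht => ?_, ?_⟩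
  · have h : (p * q).eval t - f t * g t
        = (p.eval t - f t) * q.eval t + f t * (q.eval t - g t) := by
      rw [Polynomial.eval_mul]; ring
    have h1 := hp t ht
    have h2 := hq t ht
    have h3 : |q.eval t| ≤ M' + 1 := by
      have := abs_sub_abs_le_abs_sub (q.eval t) (g t)
      linarith [hMg t ht]
    rw [h]
    calc _ ≤ |p.eval t - f t| * |q.eval t| + |f t| * |q.eval t - g t| := by
          rw [← abs_mul, ← abs_mul]; exact abs_add_le _ _
      _ ≤ e * (M' + 1) + M * e := by gcongr; exact hMf t ht
      _ ≤ ε := by linarith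
  · have h : Polynomial.aeval T (p * q) - S * S' = (Polynomial.aeval T p - S) * Polynomial.aeval T q
        + S * (Polynomial.aeval T q - S') := by
      rw [map_mul]; noncomm_ring
    have h3 : ‖Polynomial.aeval T q‖ ≤ M' + 1 := by
      have := norm_sub_norm_le (Polynomial.aeval T q) S'
      linarith
    rw [h]
    calc _ ≤ ‖Polynomial.aeval T p - S‖ * ‖Polynomial.aeval T q‖
          + ‖S‖ * ‖Polynomial.aeval T q - S'‖ :=
        (norm_add_le _ _).trans (add_le_add (norm_mul_le _ _) (norm_mul_le _ _))
      _ ≤ e * (M' + 1) + M * e := by gcongr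
      _ ≤ ε := by linarith

theorem IsFunctionOf.inner_comm {f : ℝ → ℝ} {T S : X →L[ℝ] X} (hT : T.IsPositive)
    (hf : IsFunctionOf f T S) (x y : X) : inner ℝ (S x) y = inner ℝ x (S y) := by
  have hle : ∀ ε : ℝ, 0 < ε → |inner ℝ (S x) y - inner ℝ x (S y)| ≤ ε := fun ε hε => by
    obtain ⟨p, -, hp⟩ := hf (ε / (2 * (‖x‖ * ‖y‖ + 1))) (by positivity)
    set P := Polynomial.aeval T p with hP
    have h1 : inner ℝ (S x) y - inner ℝ x (S y)
        = inner ℝ x ((P - S) y) - inner ℝ ((P - S) x) y := by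
      simp [inner_sub_left, inner_sub_right, hP, inner_aeval_comm hT]
    have h2 : |inner ℝ x ((P - S) y)| ≤ ‖P - S‖ * (‖x‖ * ‖y‖) :=
      (abs_real_inner_le_norm _ _).trans (by
        have := (P - S).le_opNorm y
        nlinarith [norm_nonneg x])
    have h3 : |inner ℝ ((P - S) x) y| ≤ ‖P - S‖ * (‖x‖ * ‖y‖) :=
      (abs_real_inner_le_norm _ _).trans (by
        have := (P - S).le_opNorm x
        nlinarith [norm_nonneg y])
    rw [h1]
    have h4 : ‖P - S‖ * (2 * (‖x‖ * ‖y‖ + 1)) ≤ ε := by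
      rwa [← le_div_iff₀ (by positivity)]
    calc _ ≤ |inner ℝ x ((P - S) y)| + |inner ℝ ((P - S) x) y| := abs_sub _ _
      _ ≤ ε := by nlinarith [norm_nonneg (P - S)]
  have h0 : |inner ℝ (S x) y - inner ℝ x (S y)| ≤ 0 := le_of_forall_pos_le_add fun ε hε => by
    simpa using hle ε hε
  exact sub_eq_zero.mp (abs_nonpos_iff.mp h0)

variable [CompleteSpace X]

theorem IsFunctionOf.norm_le {f : ℝ → ℝ} {T S : X →L[ℝ] X} (hT : T.IsPositive)
    (hf : IsFunctionOf f T S) {M : ℝ} (hM : ∀ t ∈ Icc (0 : ℝ) ‖T‖, |f t| ≤ M) : ‖S‖ ≤ M := by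
  refine le_of_forall_pos_le_add fun ε hε => ?_
  obtain ⟨p, hp, hpS⟩ := hf (ε / 2) (by positivity)
  have h1 : ‖Polynomial.aeval T p‖ ≤ M + ε / 2 := norm_aeval_le hT p fun t ht => by
    have := abs_sub_abs_le_abs_sub (p.eval t) (f t)
    linarith [hp t ht, hM t ht]
  have h2 := norm_sub_norm_le S (Polynomial.aeval T p)
  rw [norm_sub_rev] at h2
  linarith

theorem IsFunctionOf.unique {f : ℝ → ℝ} {T S S' : X →L[ℝ] X} (hT : T.IsPositive)
    (h : IsFunctionOf f T S) (h' : IsFunctionOf f T S') : S = S' := by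
  have h0 : ‖S + -S'‖ ≤ 0 := (h.add h'.neg).norm_le hT fun t _ => by simp
  rw [← sub_eq_add_neg] at h0
  exact sub_eq_zero.mp (norm_le_zero_iff.mp h0)

/-- Weierstrass approximation supplies the polynomials, and the spectral bound makes their values at
T a Cauchy sequence. -/
theorem exists_isFunctionOf {f : ℝ → ℝ} {T : X →L[ℝ] X} (hT : T.IsPositive)
    (hf : ContinuousOn f (Icc 0 ‖T‖)) : ∃ S, IsFunctionOf f T S := by
  have hex : ∀ n : ℕ, ∃ p : Polynomial ℝ, ∀ t ∈ Icc (0 : ℝ) ‖T‖,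
      |p.eval t - f t| < 1 / ((n : ℝ) + 1) := fun n =>
    exists_polynomial_near_of_continuousOn 0 ‖T‖ f hf _ (by positivity)
  choose p hp using hex
  have hlim : Tendsto (fun n : ℕ => 1 / ((n : ℝ) + 1)) atTop (𝓝 0) :=
    tendsto_one_div_add_atTop_nhds_zero_nat
  have hcauchy : CauchySeq fun n => Polynomial.aeval T (p n) := by
    refine cauchySeq_of_le_tendsto_0 (fun n : ℕ => 2 * (1 / ((n : ℝ) + 1))) ?_
      (by simpa using hlim.const_mul 2)
    intro n m N hn hm
    rw [dist_eq_norm, ← map_sub]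
    refine norm_aeval_le hT _ fun t ht => ?_
    have h1 := hp n t ht
    have h2 := hp m t ht
    have hn' : 1 / ((n : ℝ) + 1) ≤ 1 / ((N : ℝ) + 1) := by gcongr
    have hm' : 1 / ((m : ℝ) + 1) ≤ 1 / ((N : ℝ) + 1) := by gcongr
    rw [abs_lt] at h1 h2
    rw [Polynomial.eval_sub, abs_le]
    constructor <;> linarith
  obtain ⟨S, hS⟩ := cauchySeq_tendsto_of_complete hcauchy
  refine ⟨S, fun ε hε => ?_⟩
  obtain ⟨n, hn1, hn2⟩ := ((hlim.eventually (gt_mem_nhds hε)).and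
    (hS.eventually (Metric.ball_mem_nhds S hε))).exists
  refine ⟨p n, fun t ht => ((hp n t ht).trans hn1).le, ?_⟩
  rw [← dist_eq_norm]
  exact le_of_lt hn2

theorem isFunctionOf_functionOf {f : ℝ → ℝ} {T : X →L[ℝ] X} (hT : T.IsPositive)
    (hf : ContinuousOn f (Icc 0 ‖T‖)) : IsFunctionOf f T (functionOf f T) := by
  have h := exists_isFunctionOf hT hf
  rw [functionOf, dif_pos h]
  exact h.choose_spec

theorem IsFunctionOf.eq {f : ℝ → ℝ} {T S : X →L[ℝ] X} (hT : T.IsPositive)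
    (h : IsFunctionOf f T S) : functionOf f T = S := by
  have hex : ∃ S, IsFunctionOf f T S := ⟨S, h⟩
  rw [functionOf, dif_pos hex]
  exact hex.choose_spec.unique hT h

theorem functionOf_congr {f g : ℝ → ℝ} {T : X →L[ℝ] X} (hT : T.IsPositive)
    (hf : ContinuousOn f (Icc 0 ‖T‖)) (hfg : ∀ t ∈ Icc (0 : ℝ) ‖T‖, f t = g t) :
    functionOf f T = functionOf g T :=
  (((isFunctionOf_functionOf hT hf).congr hfg).eq hT).symm

theorem functionOf_mul {f g : ℝ → ℝ} {T : X →L[ℝ] X} (hT : T.IsPositive)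
    (hf : ContinuousOn f (Icc 0 ‖T‖)) (hg : ContinuousOn g (Icc 0 ‖T‖)) :
    functionOf (fun t => f t * g t) T = functionOf f T * functionOf g T :=
  ((isFunctionOf_functionOf hT hf).mul (isFunctionOf_functionOf hT hg)).eq hT

theorem functionOf_add {f g : ℝ → ℝ} {T : X →L[ℝ] X} (hT : T.IsPositive)
    (hf : ContinuousOn f (Icc 0 ‖T‖)) (hg : ContinuousOn g (Icc 0 ‖T‖)) :
    functionOf (fun t => f t + g t) T = functionOf f T + functionOf g T :=
  ((isFunctionOf_functionOf hT hf).add (isFunctionOf_functionOf hT hg)).eq hT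

theorem functionOf_sub {f g : ℝ → ℝ} {T : X →L[ℝ] X} (hT : T.IsPositive)
    (hf : ContinuousOn f (Icc 0 ‖T‖)) (hg : ContinuousOn g (Icc 0 ‖T‖)) :
    functionOf (fun t => f t - g t) T = functionOf f T - functionOf g T := by
  have := ((isFunctionOf_functionOf hT hf).add (isFunctionOf_functionOf hT hg).neg).eq hT
  simpa only [← sub_eq_add_neg] using this

theorem functionOf_const {T : X →L[ℝ] X} (hT : T.IsPositive) (c : ℝ) :
    functionOf (fun _ => c) T = c • (1 : X →L[ℝ] X) := by
  have := (isFunctionOf_aeval T (Polynomial.C c)).eq hT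
  simpa [Algebra.algebraMap_eq_smul_one] using this

theorem functionOf_id {T : X →L[ℝ] X} (hT : T.IsPositive) : functionOf (fun t => t) T = T := by
  have := (isFunctionOf_aeval T Polynomial.X).eq hT
  simpa using this

theorem functionOf_id_mul {f : ℝ → ℝ} {T : X →L[ℝ] X} (hT : T.IsPositive)
    (hf : ContinuousOn f (Icc 0 ‖T‖)) :
    functionOf (fun t => t * f t) T = T * functionOf f T := by
  have h := functionOf_mul hT (f := fun t => t) continuousOn_id hf
  rwa [functionOf_id hT] at h

theorem functionOf_mul_id {f : ℝ → ℝ} {T : X →L[ℝ] X} (hT : T.IsPositive)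
    (hf : ContinuousOn f (Icc 0 ‖T‖)) :
    functionOf (fun t => f t * t) T = functionOf f T * T := by
  have h := functionOf_mul hT (g := fun t => t) hf continuousOn_id
  rwa [functionOf_id hT] at h

theorem functionOf_const_mul_id {T : X →L[ℝ] X} (hT : T.IsPositive) (c : ℝ) :
    functionOf (fun t => c * t) T = c • T := by
  rw [functionOf_mul_id hT (f := fun _ => c) continuousOn_const, functionOf_const hT,
    smul_mul_assoc, one_mul]

theorem norm_functionOf_le {f : ℝ → ℝ} {T : X →L[ℝ] X} (hT : T.IsPositive)
    (hf : ContinuousOn f (Icc 0 ‖T‖)) {M : ℝ} (hM : ∀ t ∈ Icc (0 : ℝ) ‖T‖, |f t| ≤ M) :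
    ‖functionOf f T‖ ≤ M :=
  (isFunctionOf_functionOf hT hf).norm_le hT hM

theorem inner_functionOf_comm {f : ℝ → ℝ} {T : X →L[ℝ] X} (hT : T.IsPositive)
    (hf : ContinuousOn f (Icc 0 ‖T‖)) (x y : X) :
    inner ℝ (functionOf f T x) y = inner ℝ x (functionOf f T y) :=
  (isFunctionOf_functionOf hT hf).inner_comm hT x y

/-- Factor f as √f · √f; the quadratic form becomes a squared norm. -/
theorem inner_functionOf_nonneg {f : ℝ → ℝ} {T : X →L[ℝ] X} (hT : T.IsPositive)
    (hf : ContinuousOn f (Icc 0 ‖T‖)) (h0 : ∀ t ∈ Icc (0 : ℝ) ‖T‖, 0 ≤ f t) (x : X) :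
    0 ≤ inner ℝ (functionOf f T x) x := by
  have hs : ContinuousOn (fun t => √(f t)) (Icc 0 ‖T‖) := hf.sqrt
  have h : functionOf f T = functionOf (fun t => √(f t)) T * functionOf (fun t => √(f t)) T := by
    rw [← functionOf_mul hT hs hs]
    exact functionOf_congr hT hf fun t ht => (Real.mul_self_sqrt (h0 t ht)).symm
  rw [h, ContinuousLinearMap.mul_def, ContinuousLinearMap.comp_apply, inner_functionOf_comm hT hs]
  exact real_inner_self_nonneg

/-- Monotonicity of the functional calculus, in the sense of quadratic forms. -/
theorem inner_functionOf_mono {f g : ℝ → ℝ} {T : X →L[ℝ] X} (hT : T.IsPositive)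
    (hf : ContinuousOn f (Icc 0 ‖T‖)) (hg : ContinuousOn g (Icc 0 ‖T‖))
    (h : ∀ t ∈ Icc (0 : ℝ) ‖T‖, f t ≤ g t) (x : X) :
    inner ℝ (functionOf f T x) x ≤ inner ℝ (functionOf g T x) x := by
  have := inner_functionOf_nonneg hT (hg.sub hf) (fun t ht => sub_nonneg.mpr (h t ht)) x
  have h2 : functionOf (g - f) T = functionOf g T - functionOf f T := functionOf_sub hT hg hf
  rw [h2, sub_apply, inner_sub_left] at this
  linarith

theorem norm_functionOf_apply_sq {f : ℝ → ℝ} {T : X →L[ℝ] X} (hT : T.IsPositive)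
    (hf : ContinuousOn f (Icc 0 ‖T‖)) (x : X) :
    ‖functionOf f T x‖ ^ 2 = inner ℝ (functionOf (fun t => f t * f t) T x) x := by
  rw [functionOf_mul hT hf hf, ContinuousLinearMap.mul_def, ContinuousLinearMap.comp_apply,
    inner_functionOf_comm hT hf, real_inner_self_eq_norm_sq]

end FunctionOf

/-! ### Scalar estimates for the exponential and the filter function. -/

section ScalarBounds

theorem asymptoticC3_pos : 0 < asymptoticC3 := by unfold asymptoticC3; positivity

theorem asymptoticC3_sq : asymptoticC3 ^ 2 = 1 / (2 * Real.exp 1) := by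
  rw [asymptoticC3, div_pow, Real.sq_sqrt (by positivity), one_pow]

theorem asymptoticC4_eq : asymptoticC4 = 2 * asymptoticC3 := by
  have h0 : 0 ≤ asymptoticC4 := Real.sqrt_nonneg _
  refine (sq_eq_sq₀ h0 (by have := asymptoticC3_pos; positivity)).mp ?_
  rw [mul_pow, asymptoticC3_sq, show asymptoticC4 = √(2 / Real.exp 1) from rfl,
    Real.sq_sqrt (by positivity)]
  field_simp

theorem asymptoticC4_pos : 0 < asymptoticC4 := by
  rw [asymptoticC4_eq]; linarith [asymptoticC3_pos]

theorem asymptoticC4_le_one : asymptoticC4 ≤ 1 := by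
  rw [show asymptoticC4 = √(2 / Real.exp 1) from rfl, Real.sqrt_le_left zero_le_one,
    one_pow]
  rw [div_le_one (by positivity)]
  have := Real.add_one_le_exp 1
  linarith

theorem asymptoticC3_le_half : asymptoticC3 ≤ 1 / 2 := by
  have h1 := asymptoticC4_le_one
  rw [asymptoticC4_eq] at h1
  linarith

/-- The square u·exp(-2u) is maximal at u = 1/2; the inequality used is 2u ≤ exp(2u - 1). -/
theorem sqrt_mul_exp_neg_le (u : ℝ) : √u * Real.exp (-u) ≤ asymptoticC3 := by
  rcases lt_or_ge u 0 with hu | hu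
  · rw [Real.sqrt_eq_zero_of_nonpos hu.le, zero_mul]
    exact asymptoticC3_pos.le
  refine le_of_sq_le_sq ?_ asymptoticC3_pos.le
  rw [asymptoticC3_sq, mul_pow, Real.sq_sqrt hu, le_div_iff₀ (by positivity)]
  have h1 := Real.add_one_le_exp (2 * u - 1)
  have h2 : Real.exp (-u) ^ 2 * Real.exp 1 * Real.exp (2 * u - 1) = 1 := by
    rw [pow_two, ← Real.exp_add, ← Real.exp_add, ← Real.exp_add]
    convert Real.exp_zero using 2
    ring
  have h3 : 0 < Real.exp (-u) ^ 2 * Real.exp 1 := by positivity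
  nlinarith

theorem sqrt_mul_exp_neg_mul_le {s t : ℝ} (hs : 0 < s) :
    √t * Real.exp (-(s * t)) ≤ asymptoticC3 / √s := by
  rw [le_div_iff₀ (Real.sqrt_pos.mpr hs)]
  calc _ = √(s * t) * Real.exp (-(s * t)) := by rw [Real.sqrt_mul hs.le]; ring
    _ ≤ _ := sqrt_mul_exp_neg_le _

theorem mul_exp_neg_mul_le {s t : ℝ} (hs : 0 < s) : t * Real.exp (-(s * t)) ≤ 1 / s := by
  rw [le_div_iff₀ hs, Real.exp_neg, mul_assoc, mul_comm, mul_assoc,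
    inv_mul_le_iff₀ (Real.exp_pos _), mul_one]
  linarith [Real.add_one_le_exp (s * t)]

/-- With u = v² the difference of the two sides vanishes at v = 0 and has derivative c₄ -
2v·exp(-v²), which is nonnegative because c₄ = 2c₃. -/
theorem one_sub_exp_neg_le_sqrt {u : ℝ} (hu : 0 ≤ u) :
    1 - Real.exp (-u) ≤ asymptoticC4 * √u := by
  have hmono : Monotone fun v : ℝ => asymptoticC4 * v - 1 + Real.exp (-v ^ 2) := by
    have hd : ∀ v : ℝ, HasDerivAt (fun v : ℝ => asymptoticC4 * v - 1 + Real.exp (-v ^ 2))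
        (asymptoticC4 - 2 * (v * Real.exp (-v ^ 2))) v := fun v => by
      have h1 : HasDerivAt (fun v : ℝ => -v ^ 2) (-(2 * v)) v := by
        have := (hasDerivAt_pow 2 v).fun_neg
        simpa using this
      have h2 := (((hasDerivAt_id v).const_mul asymptoticC4).sub_const 1).add h1.exp
      have h3 : asymptoticC4 * 1 + Real.exp (-v ^ 2) * -(2 * v)
          = asymptoticC4 - 2 * (v * Real.exp (-v ^ 2)) := by ring
      rw [h3] at h2
      exact h2
    refine monotone_of_deriv_nonneg (fun v => (hd v).differentiableAt) fun v => ?_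
    rw [(hd v).deriv, asymptoticC4_eq]
    have h3 : v * Real.exp (-v ^ 2) ≤ asymptoticC3 := by
      have := sqrt_mul_exp_neg_le (v ^ 2)
      rw [Real.sqrt_sq_eq_abs] at this
      exact (mul_le_mul_of_nonneg_right (le_abs_self v) (Real.exp_pos _).le).trans this
    linarith
  have := hmono (Real.sqrt_nonneg u)
  simp only [Real.sq_sqrt hu] at this
  norm_num at this
  linarith

theorem one_sub_exp_neg_mem {u : ℝ} (hu : 0 ≤ u) : 1 - Real.exp (-u) ∈ Icc (0 : ℝ) 1 := by
  have h1 : Real.exp (-u) ≤ 1 := Real.exp_le_one_iff.mpr (by linarith)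
  exact ⟨by linarith, by linarith [Real.exp_pos (-u)]⟩

/-- The filter is the difference quotient at 0 of a differentiable function, extended by the
derivative. -/
theorem continuous_asymptoticFilter (α : ℝ) : Continuous (asymptoticFilter α) := by
  have hf : Differentiable ℝ fun t : ℝ => 1 - Real.exp (-t / α) := by fun_prop
  have hder : HasDerivAt (fun t : ℝ => 1 - Real.exp (-t / α)) (1 / α) 0 := by
    have h1 : HasDerivAt (fun t : ℝ => -t / α) (-1 / α) 0 :=
      ((hasDerivAt_id (0 : ℝ)).neg).div_const α
    have h2 := h1.exp.const_sub 1
    have h3 : -(Real.exp (-0 / α) * (-1 / α)) = 1 / α := by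
      rw [neg_zero, zero_div, Real.exp_zero]
      ring
    rwa [h3] at h2
  have heq : asymptoticFilter α = dslope (fun t : ℝ => 1 - Real.exp (-t / α)) 0 := by
    funext t
    by_cases ht : t = 0
    · rw [ht, dslope_same, hder.deriv, asymptoticFilter, if_pos rfl]
    · rw [dslope_of_ne _ ht, slope_def_field, asymptoticFilter, if_neg ht]
      simp
  rw [heq, continuous_iff_continuousAt]
  intro t
  by_cases ht : t = 0
  · rw [ht, continuousAt_dslope_same]
    exact hf 0
  · rw [continuousAt_dslope_of_ne ht]
    exact (hf t).continuousAt

theorem mul_asymptoticFilter (α t : ℝ) :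
    t * asymptoticFilter α t = 1 - Real.exp (-(1 / α * t)) := by
  rw [asymptoticFilter]
  have : -t / α = -(1 / α * t) := by ring
  split_ifs with h
  · simp [h]
  · rw [mul_div_cancel₀ _ h, this]

theorem sqrt_mul_asymptoticFilter_le {α t : ℝ} (hα : 0 < α) (ht : 0 ≤ t) :
    √t * |asymptoticFilter α t| ≤ asymptoticC4 * √(1 / α) := by
  rcases ht.eq_or_lt with rfl | ht
  · simpa using mul_nonneg asymptoticC4_pos.le (inv_nonneg.mpr (Real.sqrt_nonneg α))
  have hst : 0 ≤ 1 / α * t := by positivity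
  have h1 : |asymptoticFilter α t| = (1 - Real.exp (-(1 / α * t))) / t := by
    rw [← mul_asymptoticFilter, mul_div_cancel_left₀ _ ht.ne', abs_of_nonneg]
    have := (one_sub_exp_neg_mem hst).1
    rw [← mul_asymptoticFilter] at this
    exact nonneg_of_mul_nonneg_right this ht
  have h2 := one_sub_exp_neg_le_sqrt hst
  rw [Real.sqrt_mul (by positivity)] at h2
  rw [h1, mul_div_assoc', div_le_iff₀ ht]
  calc _ ≤ √t * (asymptoticC4 * (√(1 / α) * √t)) := by gcongr
    _ = asymptoticC4 * √(1 / α) * (√t * √t) := by ring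
    _ = _ := by rw [Real.mul_self_sqrt ht.le]

theorem abs_asymptoticFilter_le {α t : ℝ} (hα : 0 < α) (ht : 0 ≤ t) :
    |asymptoticFilter α t| ≤ 1 / α := by
  rcases ht.eq_or_lt with rfl | ht
  · rw [asymptoticFilter, if_pos rfl, abs_of_pos (by positivity)]
  have hst : 0 ≤ 1 / α * t := by positivity
  refine le_of_mul_le_mul_left ?_ ht
  rw [← abs_of_pos ht, ← abs_mul, abs_of_pos ht, mul_asymptoticFilter,
    abs_of_nonneg (one_sub_exp_neg_mem hst).1]
  linarith [Real.add_one_le_exp (-(1 / α * t))]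

end ScalarBounds

/-! ### The semigroup exp(-sA), which is the residual operator for s = 1/α. -/

section Semigroup

variable {X : Type*} [NormedAddCommGroup X] [InnerProductSpace ℝ X]

/-- The operator `exp (-s A)`. -/
noncomputable def expOp (A : X →L[ℝ] X) (s : ℝ) : X →L[ℝ] X :=
  functionOf (fun t => Real.exp (-(s * t))) A

variable [CompleteSpace X] {A : X →L[ℝ] X}

theorem continuousOn_exp_neg_mul (s : ℝ) (S : Set ℝ) :
    ContinuousOn (fun t => Real.exp (-(s * t))) S := by fun_prop

theorem expOp_add (hA : A.IsPositive) (s t : ℝ) : expOp A (s + t) = expOp A s * expOp A t := by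
  rw [expOp, expOp, expOp, ← functionOf_mul hA (continuousOn_exp_neg_mul _ _)
    (continuousOn_exp_neg_mul _ _)]
  congr 1
  funext r
  rw [← Real.exp_add]
  ring_nf

theorem expOp_zero (hA : A.IsPositive) : expOp A 0 = 1 := by
  have := functionOf_const hA 1
  simpa [expOp] using this

theorem expOp_add_apply (hA : A.IsPositive) (s t : ℝ) (x : X) :
    expOp A (s + t) x = expOp A s (expOp A t x) := by
  rw [expOp_add hA]; rfl

theorem norm_expOp_le (hA : A.IsPositive) {s : ℝ} (hs : 0 ≤ s) : ‖expOp A s‖ ≤ 1 :=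
  norm_functionOf_le hA (continuousOn_exp_neg_mul _ _) fun t ht => by
    rw [abs_of_pos (Real.exp_pos _), Real.exp_le_one_iff]
    have := mul_nonneg hs ht.1
    linarith

theorem norm_expOp_apply_le (hA : A.IsPositive) {s : ℝ} (hs : 0 ≤ s) (x : X) :
    ‖expOp A s x‖ ≤ ‖x‖ := by
  simpa using (expOp A s).le_of_opNorm_le (norm_expOp_le hA hs) x

theorem norm_expOp_antitone (hA : A.IsPositive) {s t : ℝ} (hst : s ≤ t) (x : X) :
    ‖expOp A t x‖ ≤ ‖expOp A s x‖ := by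
  have : t = (t - s) + s := by ring
  rw [this, expOp_add_apply hA]
  exact norm_expOp_apply_le hA (by linarith) _

/-- A is bounded, so the semigroup extends to a group and can be run backwards at the price of an
exponential. This makes residuals at consecutive parameters comparable. -/
theorem norm_expOp_le_exp_mul (hA : A.IsPositive) {s t : ℝ} (hst : s ≤ t) {b : ℝ} (hb : ‖A‖ ≤ b)
    (x : X) : ‖expOp A s x‖ ≤ Real.exp ((t - s) * b) * ‖expOp A t x‖ := by
  have h : s = (s - t) + t := by ring
  rw [h, expOp_add_apply hA]
  refine (expOp A (s - t)).le_of_opNorm_le ?_ _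
  refine norm_functionOf_le hA (continuousOn_exp_neg_mul _ _) fun r hr => ?_
  rw [abs_of_pos (Real.exp_pos _), Real.exp_le_exp]
  have := mul_le_mul_of_nonneg_left (hr.2.trans hb) (sub_nonneg.mpr hst)
  linarith

theorem comp_expOp_eq (hA : A.IsPositive) (s : ℝ) :
    A * expOp A s = functionOf (fun t => t * Real.exp (-(s * t))) A := by
  rw [functionOf_id_mul hA (continuousOn_exp_neg_mul _ _), expOp]

theorem expOp_comm (hA : A.IsPositive) (s : ℝ) : A * expOp A s = expOp A s * A := by
  rw [comp_expOp_eq hA, expOp, ← functionOf_mul_id hA (continuousOn_exp_neg_mul _ _)]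
  congr 1
  funext t
  exact mul_comm _ _

theorem expOp_comm_apply (hA : A.IsPositive) (s : ℝ) (x : X) :
    A (expOp A s x) = expOp A s (A x) :=
  DFunLike.congr_fun (expOp_comm hA s) x

theorem norm_comp_expOp_le (hA : A.IsPositive) {s : ℝ} (hs : 0 < s) :
    ‖A * expOp A s‖ ≤ 1 / s := by
  rw [comp_expOp_eq hA]
  refine norm_functionOf_le hA (by fun_prop) fun t ht => ?_
  rw [abs_of_nonneg (mul_nonneg ht.1 (Real.exp_pos _).le)]
  exact mul_exp_neg_mul_le hs

/-- The second-order remainder of the scalar exponential is O(h²) uniformly on the spectrum, and the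
calculus turns this into an operator-norm bound. -/
theorem hasDerivAt_expOp_zero (hA : A.IsPositive) : HasDerivAt (expOp A) (-A) 0 := by
  rw [hasDerivAt_iff_isLittleO_nhds_zero]
  have hbig : (fun h : ℝ => expOp A (0 + h) - expOp A 0 - h • (-A)) =O[𝓝 0] fun h : ℝ => h ^ 2 := by
    refine Asymptotics.IsBigO.of_bound (‖A‖ ^ 2) ?_
    have hev : ∀ᶠ h : ℝ in 𝓝 0, |h| < 1 / (‖A‖ + 1) := by
      have := Metric.ball_mem_nhds (0 : ℝ) (ε := 1 / (‖A‖ + 1)) (by positivity)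
      filter_upwards [this] with h hh
      simpa using hh
    filter_upwards [hev] with h hh
    rw [lt_div_iff₀ (by positivity)] at hh
    have hcont : ContinuousOn (fun t : ℝ => Real.exp (-(h * t)) - 1) (Icc 0 ‖A‖) := by fun_prop
    have hcont' : ContinuousOn (fun t : ℝ => h * t) (Icc 0 ‖A‖) := by fun_prop
    have heq : expOp A (0 + h) - expOp A 0 - h • (-A)
        = functionOf (fun t => (Real.exp (-(h * t)) - 1) + h * t) A := by
      rw [functionOf_add hA hcont hcont', functionOf_const_mul_id hA,
        functionOf_sub hA (continuousOn_exp_neg_mul _ _) continuousOn_const, functionOf_const hA,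
        zero_add, expOp_zero hA, expOp]
      simp
    rw [heq]
    refine norm_functionOf_le hA (hcont.add hcont') fun t ht => ?_
    have h1 : |-(h * t)| ≤ 1 := by
      rw [abs_neg, abs_mul, abs_of_nonneg ht.1]
      nlinarith [abs_nonneg h, ht.2]
    have h2 := Real.abs_exp_sub_one_sub_id_le h1
    rw [sub_neg_eq_add] at h2
    refine h2.trans ?_
    rw [neg_sq, mul_pow, Real.norm_of_nonneg (sq_nonneg h), mul_comm]
    gcongr
    exacts [ht.1, ht.2]
  exact hbig.trans_isLittleO (Asymptotics.isLittleO_pow_id one_lt_two)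

theorem hasDerivAt_expOp (hA : A.IsPositive) (s : ℝ) :
    HasDerivAt (expOp A) (-(A * expOp A s)) s := by
  have h1 : HasDerivAt (fun r => expOp A (r - s)) (-A) s := by
    refine HasDerivAt.comp_sub_const s s ?_
    rw [sub_self]
    exact hasDerivAt_expOp_zero hA
  have h2 := h1.mul_const (expOp A s)
  have h3 : (fun r => expOp A (r - s) * expOp A s) = expOp A := by
    funext r
    rw [← expOp_add hA]
    simp
  rw [h3, neg_mul] at h2
  exact h2

theorem continuous_expOp (hA : A.IsPositive) : Continuous (expOp A) :=
  continuous_iff_continuousAt.mpr fun s => (hasDerivAt_expOp hA s).continuousAt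

end Semigroup

/-! ### Functions of T*T: intertwining with TT*, smoothing and qualification bounds. -/

section NormalOperator

variable {X Y : Type*} [NormedAddCommGroup X] [InnerProductSpace ℝ X] [CompleteSpace X]
  [NormedAddCommGroup Y] [InnerProductSpace ℝ Y] [CompleteSpace Y] (T : X →L[ℝ] Y)

open ContinuousLinearMap (adjoint)

theorem isPositive_normalOp : (normalOp T).IsPositive :=
  ContinuousLinearMap.isPositive_adjoint_comp_self T

theorem normalOp_apply (x : X) : normalOp T x = adjoint T (T x) := rfl

theorem normalOp_adjoint_apply (y : Y) : normalOp (adjoint T) y = T (adjoint T y) := by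
  rw [normalOp_apply, ContinuousLinearMap.adjoint_adjoint]

theorem norm_normalOp : ‖normalOp T‖ = ‖T‖ * ‖T‖ := ContinuousLinearMap.norm_adjoint_comp_self T

theorem norm_adjoint_eq : ‖adjoint T‖ = ‖T‖ := LinearIsometryEquiv.norm_map _ _

theorem norm_normalOp_adjoint : ‖normalOp (adjoint T)‖ = ‖normalOp T‖ := by
  rw [norm_normalOp, norm_normalOp, norm_adjoint_eq]

theorem apply_aeval_normalOp (p : Polynomial ℝ) (x : X) :
    T (Polynomial.aeval (normalOp T) p x) = Polynomial.aeval (normalOp (adjoint T)) p (T x) := by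
  induction p using Polynomial.induction_on' with
  | add p q hp hq => simp [hp, hq]
  | monomial n a =>
    rw [← Polynomial.C_mul_X_pow_eq_monomial]
    simp only [map_mul, Polynomial.aeval_C, map_pow, Polynomial.aeval_X, ← Algebra.smul_def,
      smul_apply, map_smul]
    congr 1
    induction n generalizing x with
    | zero => simp
    | succ n ih =>
      rw [pow_succ, pow_succ, ContinuousLinearMap.mul_def, ContinuousLinearMap.comp_apply, ih,
        ContinuousLinearMap.mul_def, ContinuousLinearMap.comp_apply, normalOp_adjoint_apply,
        normalOp_apply]

/-- The intertwining relation `T f(T* T) = f(T T*) T`. -/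
theorem apply_functionOf_normalOp {f : ℝ → ℝ} (hf : ContinuousOn f (Icc 0 ‖normalOp T‖)) (x : X) :
    T (functionOf f (normalOp T) x) = functionOf f (normalOp (adjoint T)) (T x) := by
  have hA := isFunctionOf_functionOf (isPositive_normalOp T) hf
  have hex : ∀ ε : ℝ, 0 < ε →
      ‖T (functionOf f (normalOp T) x) - functionOf f (normalOp (adjoint T)) (T x)‖ ≤ ε := by
    intro ε hε
    obtain ⟨p, hp, hpA⟩ := hA (ε / (2 * (‖T‖ * ‖x‖ + 1))) (by positivity)
    have hpB : ‖Polynomial.aeval (normalOp (adjoint T)) p - functionOf f (normalOp (adjoint T))‖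
        ≤ ε / (2 * (‖T‖ * ‖x‖ + 1)) := by
      have hB := isPositive_normalOp (adjoint T)
      have hf' : ContinuousOn f (Icc 0 ‖normalOp (adjoint T)‖) := by
        rwa [norm_normalOp_adjoint]
      rw [← (isFunctionOf_aeval (normalOp (adjoint T)) p).eq hB,
        ← functionOf_sub hB p.continuous.continuousOn hf']
      refine norm_functionOf_le hB (p.continuous.continuousOn.sub hf') ?_
      rwa [norm_normalOp_adjoint]
    set P := Polynomial.aeval (normalOp T) p with hP
    set Q := Polynomial.aeval (normalOp (adjoint T)) p with hQ
    have h1 : T (functionOf f (normalOp T) x) - functionOf f (normalOp (adjoint T)) (T x)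
        = (Q - functionOf f (normalOp (adjoint T))) (T x)
          - T ((P - functionOf f (normalOp T)) x) := by
      simp [hP, hQ, apply_aeval_normalOp]
    have h2 : ‖(Q - functionOf f (normalOp (adjoint T))) (T x)‖
        ≤ ε / (2 * (‖T‖ * ‖x‖ + 1)) * (‖T‖ * ‖x‖) :=
      (ContinuousLinearMap.le_of_opNorm_le _ hpB _).trans (by gcongr; exact T.le_opNorm x)
    have h3 : ‖T ((P - functionOf f (normalOp T)) x)‖
        ≤ ‖T‖ * (ε / (2 * (‖T‖ * ‖x‖ + 1)) * ‖x‖) :=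
      (T.le_opNorm _).trans (by gcongr; exact ContinuousLinearMap.le_of_opNorm_le _ hpA _)
    rw [h1]
    refine (norm_sub_le _ _).trans ((add_le_add h2 h3).trans ?_)
    have h4 : ε / (2 * (‖T‖ * ‖x‖ + 1)) * (2 * (‖T‖ * ‖x‖ + 1)) = ε :=
      div_mul_cancel₀ _ (by positivity)
    have h5 : 0 < ε / (2 * (‖T‖ * ‖x‖ + 1)) := by positivity
    nlinarith
  have h0 := le_of_forall_pos_le_add (a := ‖_‖) (b := 0) fun ε hε => by simpa using hex ε hε
  exact sub_eq_zero.mp (norm_le_zero_iff.mp h0)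

theorem functionOf_normalOp_adjoint_apply {f : ℝ → ℝ} (hf : ContinuousOn f (Icc 0 ‖normalOp T‖))
    (y : Y) : functionOf f (normalOp T) (adjoint T y)
      = adjoint T (functionOf f (normalOp (adjoint T)) y) := by
  have h := apply_functionOf_normalOp (adjoint T) (f := f) (by rwa [norm_normalOp_adjoint]) y
  rw [ContinuousLinearMap.adjoint_adjoint] at h
  exact h.symm

/-- The factor t is the operator T*T hidden in the squared norm; a scalar bound on √t |f(t)| thereby
bounds T f(T*T). -/
theorem norm_apply_functionOf_sq {f : ℝ → ℝ} (hf : ContinuousOn f (Icc 0 ‖normalOp T‖)) (x : X) :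
    ‖T (functionOf f (normalOp T) x)‖ ^ 2
      = inner ℝ (functionOf (fun t => t * (f t * f t)) (normalOp T) x) x := by
  have hA := isPositive_normalOp T
  have h1 : functionOf (fun t => t * (f t * f t)) (normalOp T)
      = functionOf f (normalOp T) * (normalOp T * functionOf f (normalOp T)) := by
    rw [← functionOf_id_mul hA hf,
      ← functionOf_mul hA (g := fun t => t * f t) hf (continuousOn_id.mul hf)]
    congr 1
    funext t
    ring
  rw [h1, ContinuousLinearMap.mul_def, ContinuousLinearMap.comp_apply, inner_functionOf_comm hA hf,
    ContinuousLinearMap.mul_def, ContinuousLinearMap.comp_apply, normalOp_apply,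
    ContinuousLinearMap.adjoint_inner_left, real_inner_self_eq_norm_sq]

theorem norm_apply_functionOf_le {f : ℝ → ℝ} (hf : ContinuousOn f (Icc 0 ‖normalOp T‖)) {M : ℝ}
    (hM : ∀ t ∈ Icc 0 ‖normalOp T‖, √t * |f t| ≤ M) (x : X) :
    ‖T (functionOf f (normalOp T) x)‖ ≤ M * ‖x‖ := by
  have hA := isPositive_normalOp T
  have hM0 : 0 ≤ M := le_trans (by positivity) (hM 0 ⟨le_rfl, norm_nonneg _⟩)
  refine le_of_sq_le_sq ?_ (by positivity)
  rw [norm_apply_functionOf_sq T hf]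
  have := inner_functionOf_mono hA (f := fun t => t * (f t * f t)) (g := fun _ => M ^ 2)
    (continuousOn_id.mul (hf.mul hf)) continuousOn_const (fun t ht => by
      have h1 := pow_le_pow_left₀ (by positivity) (hM t ht) 2
      rw [mul_pow, Real.sq_sqrt ht.1, sq_abs] at h1
      linarith) x
  rw [functionOf_const hA] at this
  simpa [real_inner_smul_left, mul_pow] using this

theorem norm_functionOf_adjoint_le {f : ℝ → ℝ} (hf : ContinuousOn f (Icc 0 ‖normalOp T‖)) {M : ℝ}
    (hM : ∀ t ∈ Icc 0 ‖normalOp T‖, √t * |f t| ≤ M) (y : Y) :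
    ‖functionOf f (normalOp T) (adjoint T y)‖ ≤ M * ‖y‖ := by
  rw [functionOf_normalOp_adjoint_apply T hf]
  refine norm_apply_functionOf_le (adjoint T) (by rwa [norm_normalOp_adjoint]) ?_ y
  rwa [norm_normalOp_adjoint]

/-- Compare the quadratic forms of f² and m²t; the form of t is ‖Tx‖². -/
theorem norm_functionOf_le_norm_apply {f : ℝ → ℝ} (hf : ContinuousOn f (Icc 0 ‖normalOp T‖))
    {m : ℝ} (hm : 0 ≤ m) (hfm : ∀ t ∈ Icc 0 ‖normalOp T‖, |f t| ≤ m * √t) (x : X) :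
    ‖functionOf f (normalOp T) x‖ ≤ m * ‖T x‖ := by
  have hA := isPositive_normalOp T
  refine le_of_sq_le_sq ?_ (by positivity)
  rw [norm_functionOf_apply_sq hA hf]
  have := inner_functionOf_mono hA (f := fun t => f t * f t) (g := fun t => m ^ 2 * t)
    (hf.mul hf) (by fun_prop) (fun t ht => by
      have h1 := pow_le_pow_left₀ (by positivity) (hfm t ht) 2
      rw [mul_pow, Real.sq_sqrt ht.1, sq_abs] at h1
      linarith) x
  rw [functionOf_const_mul_id hA] at this
  simpa [real_inner_smul_left, mul_pow, normalOp_apply, ContinuousLinearMap.adjoint_inner_left,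
    real_inner_self_eq_norm_sq] using this

theorem expOp_adjoint_apply (s : ℝ) (y : Y) :
    expOp (normalOp T) s (adjoint T y) = adjoint T (expOp (normalOp (adjoint T)) s y) :=
  functionOf_normalOp_adjoint_apply T (continuousOn_exp_neg_mul _ _) y

theorem norm_apply_expOp_le {s : ℝ} (hs : 0 < s) (x : X) :
    ‖T (expOp (normalOp T) s x)‖ ≤ asymptoticC3 / √s * ‖x‖ :=
  norm_apply_functionOf_le T (continuousOn_exp_neg_mul _ _) (fun t _ => by
    rw [abs_of_pos (Real.exp_pos _)]
    exact sqrt_mul_exp_neg_mul_le hs) x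

theorem norm_expOp_adjoint_le {s : ℝ} (hs : 0 < s) (y : Y) :
    ‖expOp (normalOp T) s (adjoint T y)‖ ≤ asymptoticC3 / √s * ‖y‖ :=
  norm_functionOf_adjoint_le T (continuousOn_exp_neg_mul _ _) (fun t _ => by
    rw [abs_of_pos (Real.exp_pos _)]
    exact sqrt_mul_exp_neg_mul_le hs) y

theorem norm_apply_expOp_adjoint_le {s : ℝ} (hs : 0 < s) (y : Y) :
    ‖T (expOp (normalOp T) s (adjoint T y))‖ ≤ 1 / s * ‖y‖ := by
  rw [expOp_adjoint_apply, ← normalOp_adjoint_apply]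
  exact (normalOp (adjoint T) * expOp (normalOp (adjoint T)) s).le_of_opNorm_le
    (norm_comp_expOp_le (isPositive_normalOp _) hs) y

/-- This converts smallness of Tx into smallness of the part of x removed by the semigroup, which is
how a small residual yields an error bound. -/
theorem norm_sub_expOp_le {s : ℝ} (hs : 0 ≤ s) (x : X) :
    ‖x - expOp (normalOp T) s x‖ ≤ √s * ‖T x‖ := by
  have hA := isPositive_normalOp T
  have h1 : x - expOp (normalOp T) s x
      = functionOf (fun t => 1 - Real.exp (-(s * t))) (normalOp T) x := by
    rw [functionOf_sub hA continuousOn_const (continuousOn_exp_neg_mul _ _), functionOf_const hA]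
    simp [expOp]
  rw [h1]
  refine norm_functionOf_le_norm_apply T (by fun_prop) (Real.sqrt_nonneg s) (fun t ht => ?_) x
  have hst := mul_nonneg hs ht.1
  rw [abs_of_nonneg (one_sub_exp_neg_mem hst).1, ← Real.sqrt_mul hs]
  refine (one_sub_exp_neg_le_sqrt hst).trans ?_
  have := asymptoticC4_le_one
  nlinarith [Real.sqrt_nonneg (s * t)]

theorem norm_sub_expOp_le_norm {s : ℝ} (hs : 0 ≤ s) (x : X) :
    ‖x - expOp (normalOp T) s x‖ ≤ ‖x‖ := by
  have hA := isPositive_normalOp T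
  have h1 : x - expOp (normalOp T) s x
      = functionOf (fun t => 1 - Real.exp (-(s * t))) (normalOp T) x := by
    rw [functionOf_sub hA continuousOn_const (continuousOn_exp_neg_mul _ _), functionOf_const hA]
    simp [expOp]
  rw [h1]
  have := (functionOf (fun t => 1 - Real.exp (-(s * t))) (normalOp T)).le_of_opNorm_le
    (norm_functionOf_le hA (M := 1) (by fun_prop) fun t ht => by
      have hst := one_sub_exp_neg_mem (mul_nonneg hs ht.1)
      rw [abs_of_nonneg hst.1]
      exact hst.2) x
  simpa using this

theorem norm_filter_adjoint_le {α : ℝ} (hα : 0 < α) (y : Y) :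
    ‖functionOf (asymptoticFilter α) (normalOp T) (adjoint T y)‖
      ≤ asymptoticC4 * √(1 / α) * ‖y‖ :=
  norm_functionOf_adjoint_le T (continuous_asymptoticFilter α).continuousOn
    (fun _ ht => sqrt_mul_asymptoticFilter_le hα ht.1) y

theorem filter_adjoint_apply (α : ℝ) (y : Y) :
    functionOf (asymptoticFilter α) (normalOp T) (adjoint T y)
      = adjoint T (functionOf (asymptoticFilter α) (normalOp (adjoint T)) y) :=
  functionOf_normalOp_adjoint_apply T (continuous_asymptoticFilter α).continuousOn y

theorem norm_filter_apply_le {A : X →L[ℝ] X} (hA : A.IsPositive) {α : ℝ} (hα : 0 < α) (x : X) :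
    ‖functionOf (asymptoticFilter α) A x‖ ≤ 1 / α * ‖x‖ :=
  ContinuousLinearMap.le_of_opNorm_le _
    (norm_functionOf_le hA (continuous_asymptoticFilter α).continuousOn
      fun _ ht => abs_asymptoticFilter_le hα ht.1) x

theorem filter_comp_self {A : X →L[ℝ] X} (hA : A.IsPositive) (α : ℝ) :
    A * functionOf (asymptoticFilter α) A = 1 - expOp A (1 / α) := by
  have hc := (continuous_asymptoticFilter α).continuousOn (s := Icc 0 ‖A‖)
  rw [← functionOf_id_mul hA hc]
  have h1 : functionOf (fun _ : ℝ => (1 : ℝ)) A = 1 := by simpa using functionOf_const hA 1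
  rw [expOp, ← h1, ← functionOf_sub hA continuousOn_const (continuousOn_exp_neg_mul _ _)]
  congr 1
  funext t
  exact mul_asymptoticFilter α t

theorem filter_self_comp {A : X →L[ℝ] X} (hA : A.IsPositive) (α : ℝ) :
    functionOf (asymptoticFilter α) A * A = 1 - expOp A (1 / α) := by
  rw [← filter_comp_self hA]
  have hc := (continuous_asymptoticFilter α).continuousOn (s := Icc 0 ‖A‖)
  rw [← functionOf_id_mul hA hc, ← functionOf_mul_id hA hc]
  congr 1
  funext t
  exact mul_comm _ _

theorem apply_filter_adjoint (α : ℝ) (y : Y) :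
    T (functionOf (asymptoticFilter α) (normalOp T) (adjoint T y))
      = y - expOp (normalOp (adjoint T)) (1 / α) y := by
  rw [filter_adjoint_apply, ← normalOp_adjoint_apply]
  exact DFunLike.congr_fun (filter_comp_self (isPositive_normalOp (adjoint T)) α) y

end NormalOperator

/-- A mean value inequality on `[a, b]` for functions that are differentiable inside. -/
theorem norm_sub_le_of_norm_deriv_le_Ioo {E : Type*} [NormedAddCommGroup E] [NormedSpace ℝ E]
    {h h' : ℝ → E} {B B' : ℝ → ℝ} {a b : ℝ} (hab : a ≤ b) (hc : ContinuousOn h (Icc a b))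
    (hd : ∀ x ∈ Ioo a b, HasDerivAt h (h' x) x) (hBc : ContinuousOn B (Icc a b))
    (hBd : ∀ x ∈ Ioo a b, HasDerivAt B (B' x) x) (hle : ∀ x ∈ Ioo a b, ‖h' x‖ ≤ B' x) :
    ‖h b - h a‖ ≤ B b - B a := by
  rcases hab.eq_or_lt with rfl | hab
  · simp
  have hstep : ∀ c ∈ Ioo a b, ‖h b - h c‖ ≤ B b - B c := fun c hc' => by
    have hsub : Icc c b ⊆ Icc a b := Icc_subset_Icc_left hc'.1.le
    have hsub' : ∀ x ∈ Ico c b, x ∈ Ioo a b := fun x hx => ⟨hc'.1.trans_le hx.1, hx.2⟩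
    exact image_norm_le_of_norm_deriv_right_le_deriv_boundary' (f := fun x => h x - h c)
      (B := fun x => B x - B c) ((hc.mono hsub).sub continuousOn_const)
      (fun x hx => ((hd x (hsub' x hx)).sub_const _).hasDerivWithinAt) (by simp)
      ((hBc.mono hsub).sub continuousOn_const)
      (fun x hx => ((hBd x (hsub' x hx)).sub_const _).hasDerivWithinAt)
      (fun x hx => hle x (hsub' x hx)) ⟨hc'.2.le, le_rfl⟩
  -- Only the limit c → a remains. No derivative at a is needed, so bounds singular like 1/√(t - a)
  -- are admissible.
  have hne : (𝓝[Ioo a b] a).NeBot := left_nhdsWithin_Ioo_neBot hab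
  have hta : Tendsto h (𝓝[Ioo a b] a) (𝓝 (h a)) :=
    (hc a ⟨le_rfl, hab.le⟩).mono Ioo_subset_Icc_self
  have htB : Tendsto B (𝓝[Ioo a b] a) (𝓝 (B a)) :=
    (hBc a ⟨le_rfl, hab.le⟩).mono Ioo_subset_Icc_self
  exact le_of_tendsto_of_tendsto (tendsto_const_nhds.sub hta).norm (tendsto_const_nhds.sub htB)
    (eventually_nhdsWithin_of_forall hstep)

/-! ### Comparison of two semigroups by a split Duhamel formula. -/

section Comparison

variable {X Y : Type*} [NormedAddCommGroup X] [InnerProductSpace ℝ X] [CompleteSpace X]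
  [NormedAddCommGroup Y] [InnerProductSpace ℝ Y] [CompleteSpace Y]

open ContinuousLinearMap (adjoint)

theorem hasDerivAt_expOp_sub {A : X →L[ℝ] X} (hA : A.IsPositive) (s t : ℝ) :
    HasDerivAt (fun t => expOp A (s - t)) (A * expOp A (s - t)) t := by
  have h := (hasDerivAt_expOp hA (s - t)).scomp t ((hasDerivAt_id t).const_sub s)
  simpa [Function.comp_def] using h

omit [CompleteSpace X] in
theorem norm_mul_mul_le {P Q R : X →L[ℝ] X} {a b c : ℝ} (hP : ‖P‖ ≤ a) (hQ : ‖Q‖ ≤ b)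
    (hR : ‖R‖ ≤ c) : ‖P * Q * R‖ ≤ a * b * c := by
  have ha := (norm_nonneg P).trans hP
  have hb := (norm_nonneg Q).trans hQ
  calc ‖P * Q * R‖ ≤ ‖P‖ * ‖Q‖ * ‖R‖ :=
        (norm_mul_le _ _).trans (mul_le_mul_of_nonneg_right (norm_mul_le _ _) (norm_nonneg _))
    _ ≤ a * b * c := by gcongr

/-- Stability of the semigroup under relative perturbations `A - B = A P + Q B`. -/
theorem norm_expOp_sub_expOp_le {A B P Q : X →L[ℝ] X} (hA : A.IsPositive) (hB : B.IsPositive)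
    (hPQ : A - B = A * P + Q * B) {q : ℝ} (hP : ‖P‖ ≤ q) (hQ : ‖Q‖ ≤ q) {s : ℝ} (hs : 0 < s) :
    ‖expOp A s - expOp B s‖ ≤ 8 * q := by
  have hq : 0 ≤ q := (norm_nonneg _).trans hP
  have hcA : Continuous fun t => expOp A (s - t) :=
    (continuous_expOp hA).comp (continuous_const.sub continuous_id)
  have hcB := continuous_expOp hB
  have hlin : ∀ t, HasDerivAt (fun t => 4 * q / s * t) (4 * q / s) t := fun t => by
    simpa using (hasDerivAt_id t).const_mul (4 * q / s)
  have hPQ2 : ‖P + Q‖ ≤ 2 * q := (norm_add_le _ _).trans (by linarith)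
  -- On the first half the middle factor 1 + Q is chosen so that A(1 + Q) - (1 + Q)B = A(P + Q). The
  -- factor A then meets exp(-(s-t)A) with s - t ≥ s/2 and costs only 2/s.
  have h1 : ‖expOp A (s - s / 2) * (1 + Q) * expOp B (s / 2)
      - expOp A (s - 0) * (1 + Q) * expOp B 0‖ ≤ 4 * q / s * (s / 2) - 4 * q / s * 0 := by
    refine norm_sub_le_of_norm_deriv_le_Ioo (h := fun t => expOp A (s - t) * (1 + Q) * expOp B t)
      (B := fun t => 4 * q / s * t) (B' := fun _ => 4 * q / s)
      (h' := fun t => A * expOp A (s - t) * (P + Q) * expOp B t) (by linarith)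
      ((hcA.mul continuous_const).mul hcB).continuousOn ?_ (by fun_prop) (fun t _ => hlin t) ?_
    · intro t _
      have := ((hasDerivAt_expOp_sub hA s t).mul_const (1 + Q)).mul (hasDerivAt_expOp hB t)
      convert! this using 1
      rw [expOp_comm hA]
      have h2 : A * (1 + Q) - (1 + Q) * B = A * (P + Q) := by
        calc _ = (A - B) + A * Q - Q * B := by noncomm_ring
          _ = _ := by rw [hPQ]; noncomm_ring
      calc expOp A (s - t) * A * (P + Q) * expOp B t
          = expOp A (s - t) * (A * (1 + Q) - (1 + Q) * B) * expOp B t := by rw [h2]; noncomm_ring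
        _ = _ := by noncomm_ring
    · intro t ht
      have h3 : ‖A * expOp A (s - t)‖ ≤ 2 / s := by
        refine (norm_comp_expOp_le hA (by linarith [ht.2])).trans ?_
        rw [div_le_div_iff₀ (by linarith [ht.2]) hs]
        linarith [ht.2]
      refine (norm_mul_mul_le h3 hPQ2 (norm_expOp_le hB ht.1.le)).trans (le_of_eq ?_)
      ring
  -- On the second half, 1 - P gives A(1 - P) - (1 - P)B = (P + Q)B, and B is smoothed by exp(-tB)
  -- with t ≥ s/2.
  have h2 : ‖expOp A (s - s) * (1 - P) * expOp B s
      - expOp A (s - s / 2) * (1 - P) * expOp B (s / 2)‖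
        ≤ 4 * q / s * s - 4 * q / s * (s / 2) := by
    refine norm_sub_le_of_norm_deriv_le_Ioo (h := fun t => expOp A (s - t) * (1 - P) * expOp B t)
      (B := fun t => 4 * q / s * t) (B' := fun _ => 4 * q / s)
      (h' := fun t => expOp A (s - t) * (P + Q) * (B * expOp B t)) (by linarith)
      ((hcA.mul continuous_const).mul hcB).continuousOn ?_ (by fun_prop) (fun t _ => hlin t) ?_
    · intro t _
      have := ((hasDerivAt_expOp_sub hA s t).mul_const (1 - P)).mul (hasDerivAt_expOp hB t)
      convert! this using 1
      rw [expOp_comm hA]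
      have h2 : A * (1 - P) - (1 - P) * B = (P + Q) * B := by
        calc _ = (A - B) - A * P + P * B := by noncomm_ring
          _ = _ := by rw [hPQ]; noncomm_ring
      calc expOp A (s - t) * (P + Q) * (B * expOp B t)
          = expOp A (s - t) * ((P + Q) * B) * expOp B t := by noncomm_ring
        _ = expOp A (s - t) * (A * (1 - P) - (1 - P) * B) * expOp B t := by rw [h2]
        _ = _ := by noncomm_ring
    · intro t ht
      have ht0 : 0 < t := by linarith [ht.1]
      have h3 : ‖B * expOp B t‖ ≤ 2 / s := by
        refine (norm_comp_expOp_le hB ht0).trans ?_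
        rw [div_le_div_iff₀ ht0 hs]
        linarith [ht.1]
      refine (norm_mul_mul_le (norm_expOp_le hA (by linarith [ht.2])) hPQ2 h3).trans (le_of_eq ?_)
      ring
  rw [sub_zero, expOp_zero hB, mul_one] at h1
  rw [sub_self, expOp_zero hA, one_mul] at h2
  have h3 : ‖expOp A (s - s / 2) * (P + Q) * expOp B (s / 2)‖ ≤ 1 * (2 * q) * 1 :=
    norm_mul_mul_le (norm_expOp_le hA (by linarith)) hPQ2 (norm_expOp_le hB (by linarith))
  have h4 : ‖expOp A s * Q * 1‖ ≤ 1 * q * 1 :=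
    norm_mul_mul_le (norm_expOp_le hA hs.le) hQ (by simpa [expOp_zero hA] using norm_expOp_le hA le_rfl)
  have h5 : ‖1 * P * expOp B s‖ ≤ 1 * q * 1 :=
    norm_mul_mul_le (by simpa [expOp_zero hA] using norm_expOp_le hA le_rfl) hP
      (norm_expOp_le hB hs.le)
  have hs2 : 4 * q / s * (s / 2) = 2 * q := by field_simp; ring
  have hs1 : 4 * q / s * s = 4 * q := by field_simp
  rw [hs2, mul_zero, sub_zero] at h1
  rw [hs2, hs1] at h2
  set a1 := expOp A (s - s / 2) * (1 + Q) * expOp B (s / 2) - expOp A s * (1 + Q) with ha1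
  set a2 := (1 - P) * expOp B s - expOp A (s - s / 2) * (1 - P) * expOp B (s / 2) with ha2
  set a3 := expOp A (s - s / 2) * (P + Q) * expOp B (s / 2) with ha3
  set a4 := expOp A s * Q * 1 with ha4
  set a5 := 1 * P * expOp B s with ha5
  -- Two Duhamel pieces and the jump at s/2, each at most 2q, plus two end corrections of at most q:
  -- together 8q.
  have hsum : expOp A s - expOp B s = -a1 - a2 + a3 - a4 - a5 := by
    rw [ha1, ha2, ha3, ha4, ha5]
    noncomm_ring
  rw [hsum]
  have n1 := norm_sub_le (-a1 - a2 + a3 - a4) a5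
  have n2 := norm_sub_le (-a1 - a2 + a3) a4
  have n3 := norm_add_le (-a1 - a2) a3
  have n4 := norm_sub_le (-a1) a2
  rw [norm_neg] at n4
  linarith

theorem hasDerivAt_mul_add_sqrt (a b : ℝ) {t : ℝ} (ht : 0 < t) :
    HasDerivAt (fun t => a * t + 2 * b * √t) (a + b / √t) t := by
  have h := ((hasDerivAt_id t).const_mul a).add ((Real.hasDerivAt_sqrt ht.ne').const_mul (2 * b))
  convert! h using 1
  field_simp

theorem hasDerivAt_mul_sub_sqrt (a b s : ℝ) {t : ℝ} (ht : t < s) :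
    HasDerivAt (fun t => a * t - 2 * b * √(s - t)) (a + b / √(s - t)) t := by
  have h1 : HasDerivAt (fun t => √(s - t)) (-1 / (2 * √(s - t))) t :=
    ((hasDerivAt_id t).const_sub s).sqrt (by simp only [id]; linarith)
  have h := ((hasDerivAt_id t).const_mul a).sub (h1.const_mul (2 * b))
  convert! h using 1
  field_simp
  ring

theorem norm_sub_adjoint (S T : X →L[ℝ] Y) (y : Y) :
    ‖adjoint S y - adjoint T y‖ ≤ ‖S - T‖ * ‖y‖ := by
  rw [← norm_adjoint_eq (S - T), map_sub]
  exact (adjoint S - adjoint T).le_opNorm y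

theorem norm_comp_self_expOp_apply_le {A : X →L[ℝ] X} (hA : A.IsPositive) {s : ℝ} (hs : 0 < s)
    (x : X) : ‖expOp A s (A x)‖ ≤ 1 / s * ‖x‖ := by
  rw [← expOp_comm_apply hA]
  exact (A * expOp A s).le_of_opNorm_le (norm_comp_expOp_le hA hs) x

theorem inv_sqrt_le_of_half_le {s t : ℝ} (hs : 0 < s) (h : s / 2 ≤ t) :
    asymptoticC3 / √t ≤ √(2 / s) := by
  have ht : 0 < t := by linarith
  rw [div_le_iff₀ (Real.sqrt_pos.mpr ht), ← Real.sqrt_mul (by positivity)]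
  have h1 : (1 : ℝ) ≤ 2 / s * t := by
    rw [div_mul_eq_mul_div, le_div_iff₀ hs]; linarith
  have := Real.one_le_sqrt.mpr h1
  linarith [asymptoticC3_le_half]

/-- Stability of the semigroup of the normal operator on the range of the adjoint. -/
theorem norm_expOp_adjoint_sub_le (S T : X →L[ℝ] Y) (u : Y) {s : ℝ} (hs : 0 < s) :
    ‖expOp (normalOp S) s (adjoint T u) - expOp (normalOp T) s (adjoint T u)‖
      ≤ 8 * (‖S - T‖ * ‖u‖) := by
  set w := ‖S - T‖ * ‖u‖ with hw
  have hw0 : 0 ≤ w := by positivity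
  have hA := isPositive_normalOp S
  have hB := isPositive_normalOp T
  have hB' := isPositive_normalOp (adjoint T)
  have hcA : Continuous fun t => expOp (normalOp S) (s - t) :=
    (continuous_expOp hA).comp (continuous_const.sub continuous_id)
  have hcB := continuous_expOp hB
  have hcB' := continuous_expOp hB'
  have hss : √(2 / s) * √(s / 2) = 1 := by
    rw [← Real.sqrt_mul (by positivity), div_mul_div_comm, mul_comm s 2,
      div_self (by positivity), Real.sqrt_one]
  have hWu : ∀ z : Y, ‖z‖ ≤ ‖u‖ → ‖adjoint S z - adjoint T z‖ ≤ w := fun z hz =>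
    (norm_sub_adjoint S T z).trans (mul_le_mul_of_nonneg_left hz (norm_nonneg _))
  have hB'u : ∀ t, 0 ≤ t → ‖expOp (normalOp (adjoint T)) t u‖ ≤ ‖u‖ := fun t ht =>
    norm_expOp_apply_le hB' ht u
  have hcross : ∀ t, 0 < t → t < s → ‖expOp (normalOp S) (s - t)
      (adjoint S ((S - T) (expOp (normalOp T) t (adjoint T u))))‖
        ≤ asymptoticC3 / √(s - t) * (asymptoticC3 / √t) * w := fun t ht hts => by
    have h1 := norm_expOp_adjoint_le S (s := s - t) (by linarith)
      ((S - T) (expOp (normalOp T) t (adjoint T u)))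
    have h2 := (S - T).le_opNorm (expOp (normalOp T) t (adjoint T u))
    have h3 := norm_expOp_adjoint_le T ht u
    have hc := asymptoticC3_pos
    calc _ ≤ _ := h1
      _ ≤ asymptoticC3 / √(s - t) * (‖S - T‖ * (asymptoticC3 / √t * ‖u‖)) := by
        gcongr
        exact h2.trans (by gcongr)
      _ = _ := by rw [hw]; ring
  -- First half: T* is replaced by S*, so that the term with S* - T* is preceded by S*S, smoothed at
  -- times at least s/2. The other term costs a multiple of 1/√((s-t)t), whose singularity at t = 0
  -- is integrable; hence the √t in the comparison function.
  have h1 : ‖expOp (normalOp S) (s - s / 2) (adjoint S (expOp (normalOp (adjoint T)) (s / 2) u))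
      - expOp (normalOp S) (s - 0) (adjoint S (expOp (normalOp (adjoint T)) 0 u))‖
        ≤ (2 / s * w * (s / 2) + 2 * (√(2 / s) * w) * √(s / 2))
          - (2 / s * w * 0 + 2 * (√(2 / s) * w) * √0) := by
    refine norm_sub_le_of_norm_deriv_le_Ioo
      (h := fun t => expOp (normalOp S) (s - t) (adjoint S (expOp (normalOp (adjoint T)) t u)))
      (h' := fun t => expOp (normalOp S) (s - t)
        (normalOp S ((adjoint S - adjoint T) (expOp (normalOp (adjoint T)) t u))
          + adjoint S ((S - T) (expOp (normalOp T) t (adjoint T u)))))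
      (B := fun t => 2 / s * w * t + 2 * (√(2 / s) * w) * √t)
      (B' := fun t => 2 / s * w + √(2 / s) * w / √t) (by linarith)
      (hcA.clm_apply ((adjoint S).continuous.comp
        (hcB'.clm_apply continuous_const))).continuousOn ?_ (by fun_prop)
      (fun t ht => hasDerivAt_mul_add_sqrt _ _ ht.1) ?_
    · intro t _
      have hv : HasDerivAt (fun t => adjoint S (expOp (normalOp (adjoint T)) t u))
          (adjoint S (-(normalOp (adjoint T) (expOp (normalOp (adjoint T)) t u)))) t := by
        have := (hasDerivAt_expOp hB' t).clm_apply (hasDerivAt_const t u)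
        have h2 := ((adjoint S).hasFDerivAt.comp_hasDerivAt t this)
        simpa [Function.comp_def] using h2
      have := (hasDerivAt_expOp_sub hA s t).clm_apply hv
      convert! this using 1
      have h3 : (normalOp S * expOp (normalOp S) (s - t))
          (adjoint S (expOp (normalOp (adjoint T)) t u))
          = expOp (normalOp S) (s - t)
            (normalOp S (adjoint S (expOp (normalOp (adjoint T)) t u))) :=
        expOp_comm_apply hA _ _
      rw [h3, ← map_add, expOp_adjoint_apply]
      congr 1
      simp only [normalOp_apply, map_neg, sub_apply, map_sub, ContinuousLinearMap.adjoint_adjoint]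
      abel
    · intro t ht
      have hst : 0 < s - t := by linarith [ht.2]
      rw [map_add]
      refine (norm_add_le _ _).trans (add_le_add ?_ ?_)
      · refine (norm_comp_self_expOp_apply_le hA hst _).trans ?_
        have h4 : 1 / (s - t) ≤ 2 / s := by
          rw [div_le_div_iff₀ hst hs]; linarith [ht.2]
        exact mul_le_mul h4 (hWu _ (hB'u t ht.1.le)) (norm_nonneg _) (by positivity)
      · refine (hcross t ht.1 (by linarith)).trans ?_
        have h4 : asymptoticC3 / √(s - t) ≤ √(2 / s) :=
          inv_sqrt_le_of_half_le hs (by linarith [ht.2])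
        have h5 : asymptoticC3 / √t ≤ 1 / √t := by
          gcongr
          linarith [asymptoticC3_le_half]
        calc _ ≤ √(2 / s) * (1 / √t) * w := by
              have := asymptoticC3_pos
              gcongr
          _ = _ := by ring
  -- Second half: T* stays in place, TT* is smoothed at times at least s/2, and the integrable
  -- singularity sits at t = s.
  have h2 : ‖expOp (normalOp S) (s - s) (expOp (normalOp T) s (adjoint T u))
      - expOp (normalOp S) (s - s / 2) (expOp (normalOp T) (s / 2) (adjoint T u))‖
        ≤ (2 / s * w * s - 2 * (√(2 / s) * w) * √(s - s))
          - (2 / s * w * (s / 2) - 2 * (√(2 / s) * w) * √(s - s / 2)) := by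
    refine norm_sub_le_of_norm_deriv_le_Ioo
      (h := fun t => expOp (normalOp S) (s - t) (expOp (normalOp T) t (adjoint T u)))
      (h' := fun t => expOp (normalOp S) (s - t)
        ((adjoint S - adjoint T) (T (expOp (normalOp T) t (adjoint T u)))
          + adjoint S ((S - T) (expOp (normalOp T) t (adjoint T u)))))
      (B := fun t => 2 / s * w * t - 2 * (√(2 / s) * w) * √(s - t))
      (B' := fun t => 2 / s * w + √(2 / s) * w / √(s - t)) (by linarith)
      (hcA.clm_apply (hcB.clm_apply continuous_const)).continuousOn ?_ (by fun_prop)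
      (fun t ht => hasDerivAt_mul_sub_sqrt _ _ _ ht.2) ?_
    · intro t _
      have hv : HasDerivAt (fun t => expOp (normalOp T) t (adjoint T u))
          (-(normalOp T (expOp (normalOp T) t (adjoint T u)))) t := by
        have := (hasDerivAt_expOp hB t).clm_apply (hasDerivAt_const t (adjoint T u))
        simpa using this
      have := (hasDerivAt_expOp_sub hA s t).clm_apply hv
      convert! this using 1
      have h3 : (normalOp S * expOp (normalOp S) (s - t)) (expOp (normalOp T) t (adjoint T u))
          = expOp (normalOp S) (s - t) (normalOp S (expOp (normalOp T) t (adjoint T u))) :=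
        expOp_comm_apply hA _ _
      rw [h3, ← map_add]
      congr 1
      simp only [normalOp_apply, sub_apply, map_sub]
      abel
    · intro t ht
      have ht0 : 0 < t := by linarith [ht.1]
      have hst : 0 ≤ s - t := by linarith [ht.2]
      rw [map_add]
      refine (norm_add_le _ _).trans (add_le_add ?_ ?_)
      · refine (norm_expOp_apply_le hA hst _).trans ((norm_sub_adjoint S T _).trans ?_)
        have h4 : 1 / t ≤ 2 / s := by
          rw [div_le_div_iff₀ ht0 hs]; linarith [ht.1]
        calc _ ≤ ‖S - T‖ * (2 / s * ‖u‖) := by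
              gcongr
              exact (norm_apply_expOp_adjoint_le T ht0 u).trans (by gcongr)
          _ = _ := by rw [hw]; ring
      · refine (hcross t ht0 ht.2).trans ?_
        have h4 : asymptoticC3 / √t ≤ √(2 / s) := inv_sqrt_le_of_half_le hs ht.1.le
        have h5 : asymptoticC3 / √(s - t) ≤ 1 / √(s - t) := by
          gcongr
          linarith [asymptoticC3_le_half]
        calc _ ≤ 1 / √(s - t) * √(2 / s) * w := by
              have := asymptoticC3_pos
              gcongr
          _ = _ := by ring
  have hhalf : s - s / 2 = s / 2 := by ring
  have e1 : 2 / s * w * (s / 2) = w := by field_simp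
  have e2 : 2 / s * w * s = 2 * w := by field_simp
  have e3 : 2 * (√(2 / s) * w) * √(s / 2) = 2 * w := by
    rw [mul_assoc, mul_right_comm, hss, one_mul]
  rw [e1, hhalf, e3, sub_zero, Real.sqrt_zero, expOp_zero hB'] at h1
  rw [e1, e2, hhalf, e3, sub_self, Real.sqrt_zero, expOp_zero hA] at h2
  simp only [one_apply_eq_self, mul_zero, add_zero, sub_zero] at h1 h2
  have h3 : ‖expOp (normalOp S) (s / 2) (adjoint S (expOp (normalOp (adjoint T)) (s / 2) u)
      - adjoint T (expOp (normalOp (adjoint T)) (s / 2) u))‖ ≤ w :=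
    (norm_expOp_apply_le hA (by linarith) _).trans (hWu _ (hB'u _ (by linarith)))
  have h4 : ‖expOp (normalOp S) s (adjoint S u - adjoint T u)‖ ≤ w :=
    (norm_expOp_apply_le hA hs.le _).trans (hWu u le_rfl)
  rw [map_sub] at h3 h4
  rw [← expOp_adjoint_apply] at h3
  set b1 := expOp (normalOp S) (s / 2) (adjoint S (expOp (normalOp (adjoint T)) (s / 2) u))
  set b2 := expOp (normalOp S) s (adjoint S u)
  set b3 := expOp (normalOp S) s (adjoint T u)
  set b4 := expOp (normalOp T) s (adjoint T u)
  set b5 := expOp (normalOp S) (s / 2) (expOp (normalOp T) (s / 2) (adjoint T u))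
  have hsum : b3 - b4 = -(b2 - b3) - (b1 - b2) + (b1 - b5) - (b4 - b5) := by abel
  rw [hsum]
  have n1 := norm_sub_le (-(b2 - b3) - (b1 - b2) + (b1 - b5)) (b4 - b5)
  have n2 := norm_add_le (-(b2 - b3) - (b1 - b2)) (b1 - b5)
  have n3 := norm_sub_le (-(b2 - b3)) (b1 - b2)
  rw [norm_neg] at n3
  linarith

end Comparison

/-! ### From perturbed linear recursions and the discrepancy principle to an oracle inequality. -/

section OracleInequality

variable {X Y : Type*} [NormedAddCommGroup X] [InnerProductSpace ℝ X] [CompleteSpace X]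
  [NormedAddCommGroup Y] [InnerProductSpace ℝ Y] [CompleteSpace Y]

/-- The constant `exp ((θ₀ + s₀) / 2)` that bounds quotients of consecutive residual functions. -/
noncomputable def residualRatio (θ₀ s₀ : ℝ) : ℝ := Real.exp ((θ₀ + s₀) / 2)

theorem one_le_residualRatio {θ₀ s₀ : ℝ} (hθ : 0 ≤ θ₀) (hs : 0 ≤ s₀) : 1 ≤ residualRatio θ₀ s₀ :=
  Real.one_le_exp (by linarith)

variable {T : X →L[ℝ] Y} {s : ℕ → ℝ} {e : ℕ → X} {θ₀ δ ε : ℝ} {n : ℕ}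

/-- By induction, ε‖e_k‖ is absorbed into the approximation and noise terms at s_k. Moving these
terms on to s_{k+1} costs one factor `residualRatio`, which the smallness of ε compensates, so the
constants do not grow with k. -/
theorem iterate_norm_le (hT : ‖normalOp T‖ ≤ 1 / 2) (hs0 : 0 < s 0) (hmono : Monotone s)
    (hθ : 0 ≤ θ₀) (hstep : ∀ k, s (k + 1) - s k ≤ θ₀) (hδ : 0 ≤ δ) (hε : 0 ≤ ε)
    (hsmall : 4 * residualRatio θ₀ (s 0) * ε ≤ 1)
    (H1 : ∀ k < n, ‖e (k + 1) - expOp (normalOp T) (s k) (e 0)‖ ≤ ε * ‖e k‖ + δ * √(s k)) :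
    ∀ k < n, ‖e k‖ ≤ 2 * residualRatio θ₀ (s 0)
        * (‖expOp (normalOp T) (s k) (e 0)‖ + δ * √(s k)) ∧
      ‖e (k + 1)‖ ≤ 2 * (‖expOp (normalOp T) (s k) (e 0)‖ + δ * √(s k)) := by
  have hA := isPositive_normalOp T
  set κ := residualRatio θ₀ (s 0) with hκ
  have hκ1 : 1 ≤ κ := one_le_residualRatio hθ hs0.le
  have hfirst : ∀ k < n, ‖e k‖ ≤ 2 * κ * (‖expOp (normalOp T) (s k) (e 0)‖ + δ * √(s k)) →
      ‖e (k + 1)‖ ≤ 2 * (‖expOp (normalOp T) (s k) (e 0)‖ + δ * √(s k)) := by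
    intro k hk hek
    have h1 := norm_add_le (e (k + 1) - expOp (normalOp T) (s k) (e 0))
      (expOp (normalOp T) (s k) (e 0))
    rw [sub_add_cancel] at h1
    have h2 := H1 k hk
    have h3 := mul_le_mul_of_nonneg_left hek hε
    have h4 : 0 ≤ ‖expOp (normalOp T) (s k) (e 0)‖ + δ * √(s k) := by positivity
    nlinarith
  -- The start compares time 0 with time s 0; this is why `residualRatio` also contains s₀.
  have hzero : ‖e 0‖ ≤ 2 * κ * (‖expOp (normalOp T) (s 0) (e 0)‖ + δ * √(s 0)) := by
    have h1 := norm_expOp_le_exp_mul hA hs0.le hT (e 0)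
    rw [expOp_zero hA, one_apply_eq_self] at h1
    have h2 : Real.exp ((s 0 - 0) * (1 / 2)) ≤ κ := Real.exp_le_exp.mpr (by linarith)
    have h3 : 0 ≤ δ * √(s 0) := by positivity
    have h4 := norm_nonneg (expOp (normalOp T) (s 0) (e 0))
    nlinarith
  have hmain : ∀ k, k < n →
      ‖e k‖ ≤ 2 * κ * (‖expOp (normalOp T) (s k) (e 0)‖ + δ * √(s k)) := by
    intro k
    induction k with
    | zero => exact fun _ => hzero
    | succ k ih =>
      intro hk
      have hk' : k < n := by omega
      refine (hfirst k hk' (ih hk')).trans ?_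
      have h1 := norm_expOp_le_exp_mul hA (hmono (Nat.le_succ k)) hT (e 0)
      have h2 : Real.exp ((s (k + 1) - s k) * (1 / 2)) ≤ κ :=
        Real.exp_le_exp.mpr (by linarith [hstep k])
      have h3 : √(s k) ≤ √(s (k + 1)) := Real.sqrt_le_sqrt (hmono (Nat.le_succ k))
      have h4 := norm_nonneg (expOp (normalOp T) (s (k + 1)) (e 0))
      have h5 : δ * √(s k) ≤ κ * (δ * √(s (k + 1))) :=
        (mul_le_mul_of_nonneg_left h3 hδ).trans (le_mul_of_one_le_left (by positivity) hκ1)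
      have h6 := mul_le_mul_of_nonneg_right h2 h4
      simp only [Nat.succ_eq_add_one] at h1
      linarith
  exact fun k hk => ⟨hmain k hk, hfirst k hk (hmain k hk)⟩

/-- The error cannot drop abruptly in one step, apart from noise. The Lipschitz case uses this to
turn the mixed product ‖e_k‖‖e_{k+1}‖ into ‖e_{k+1}‖² plus noise. -/
theorem iterate_norm_le_next (hT : ‖normalOp T‖ ≤ 1 / 2) (hs0 : 0 < s 0) (hmono : Monotone s)
    (hθ : 0 ≤ θ₀) (hstep : ∀ k, s (k + 1) - s k ≤ θ₀) (hδ : 0 ≤ δ) (hε : 0 ≤ ε)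
    (hsmall : 4 * residualRatio θ₀ (s 0) * ε ≤ 1)
    (H1 : ∀ k < n, ‖e (k + 1) - expOp (normalOp T) (s k) (e 0)‖ ≤ ε * ‖e k‖ + δ * √(s k)) :
    ∀ k < n, ‖e k‖ ≤ 8 * residualRatio θ₀ (s 0) * (‖e (k + 1)‖ + δ * √(s k)) := by
  intro k hk
  obtain ⟨h1, -⟩ := iterate_norm_le hT hs0 hmono hθ hstep hδ hε hsmall H1 k hk
  have h2 := H1 k hk
  have hκ1 := one_le_residualRatio hθ hs0.le
  set κ := residualRatio θ₀ (s 0)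
  have h3 := norm_sub_norm_le (expOp (normalOp T) (s k) (e 0)) (e (k + 1))
  rw [norm_sub_rev] at h3
  have h4 := mul_le_mul_of_nonneg_left h1 hε
  have h5 : 0 ≤ ‖expOp (normalOp T) (s k) (e 0)‖ + δ * √(s k) := by positivity
  have h6 : ‖expOp (normalOp T) (s k) (e 0)‖ + δ * √(s k)
      ≤ 4 * (‖e (k + 1)‖ + δ * √(s k)) := by
    nlinarith [norm_nonneg (e (k + 1))]
  calc _ ≤ _ := h1
    _ ≤ 2 * κ * (4 * (‖e (k + 1)‖ + δ * √(s k))) := by gcongr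
    _ = _ := by ring

/-- The constant of the oracle inequality. -/
noncomputable def oracleConst (θ₀ s₀ C₂ C₃ : ℝ) : ℝ :=
  4 * C₃ + 13 + 2 * ((1 + θ₀ / s₀) * (2 * C₂ + 3))

set_option maxHeartbeats 800000 in
/-- The oracle inequality: under the discrepancy principle the final error is, up to a constant,
not larger than the sum of approximation error and noise error for any choice of the index. -/
theorem oracle_inequality (hT : ‖normalOp T‖ ≤ 1 / 2) (hs0 : 0 < s 0) (hmono : Monotone s)
    (hθ : 0 ≤ θ₀) (hstep : ∀ k, s (k + 1) - s k ≤ θ₀) (hδ : 0 ≤ δ) (hε : 0 ≤ ε)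
    (hsmall : 8 * residualRatio θ₀ (s 0) * ε ≤ 1)
    (H1 : ∀ k < n, ‖e (k + 1) - expOp (normalOp T) (s k) (e 0)‖ ≤ ε * ‖e k‖ + δ * √(s k))
    {C₂ C₃ : ℝ} (hC₂ : 0 ≤ C₂) (hC₃ : 0 ≤ C₃)
    (H2 : ∀ k, k + 1 < n → δ * √(s k) ≤ C₂ * ‖expOp (normalOp T) (s k / 2) (e 0)‖
      + ε * (‖e k‖ + ‖e (k + 1)‖))
    (H3 : ‖T (e n)‖ ≤ C₃ * δ) (l : ℕ) :
    ‖e n‖ ≤ oracleConst θ₀ (s 0) C₂ C₃ * (‖expOp (normalOp T) (s l) (e 0)‖ + δ * √(s l)) := by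
  have hA := isPositive_normalOp T
  have hκ1 := one_le_residualRatio hθ hs0.le
  have hspos : ∀ k, 0 < s k := fun k => hs0.trans_le (hmono (Nat.zero_le k))
  have hbounds := iterate_norm_le hT hs0 hmono hθ hstep hδ hε (by
    have : 0 ≤ residualRatio θ₀ (s 0) * ε := mul_nonneg (by linarith) hε
    linarith) H1
  set κ := residualRatio θ₀ (s 0)
  set E := expOp (normalOp T)
  set r := θ₀ / s 0 with hr
  have hr0 : 0 ≤ r := by positivity
  have hl0 : 0 ≤ ‖E (s l) (e 0)‖ := norm_nonneg _
  have hl1 : 0 ≤ δ * √(s l) := by positivity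
  have hCC : 0 ≤ r * (2 * C₂ + 3) := by positivity
  unfold oracleConst
  -- Stopping at index 0: split e_0 by the semigroup at s_l, and bound the removed part by √s_l ‖T
  -- e_0‖.
  rcases n with _ | k
  · have h1 := norm_sub_expOp_le T (hspos l).le (e 0)
    have h2 := norm_add_le (e 0 - E (s l) (e 0)) (E (s l) (e 0))
    rw [sub_add_cancel] at h2
    have h3 : √(s l) * ‖T (e 0)‖ ≤ C₃ * (δ * √(s l)) := by
      have := mul_le_mul_of_nonneg_left H3 (Real.sqrt_nonneg (s l))
      linarith
    nlinarith [mul_nonneg hC₃ hl0, mul_nonneg hCC hl0, mul_nonneg hCC hl1, mul_nonneg hC₂ hl0,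
      mul_nonneg hC₂ hl1]
  obtain ⟨hek, hek1⟩ := hbounds k (Nat.lt_succ_self k)
  have hd := H1 k (Nat.lt_succ_self k)
  have hk0 : 0 ≤ ‖E (s k) (e 0)‖ := norm_nonneg _
  have hk1 : 0 ≤ δ * √(s k) := by positivity
  rcases le_or_gt k l with hkl | hkl
  -- Here s_l is at least the last parameter s_k used. The noise grows with the index, and what the
  -- semigroup still removes between s_k and s_l is controlled by the small quantity T e_{k+1}.
  · have hskl := hmono hkl
    set v := E (s k) (e 0) with hv
    have h1 : ‖v‖ ≤ ‖E (s l) (e 0)‖ + ‖v - E (s l - s k) v‖ := by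
      have h2 : E (s l) (e 0) = E (s l - s k) v := by
        rw [hv, ← expOp_add_apply hA, sub_add_cancel]
      rw [h2]
      have := norm_add_le (v - E (s l - s k) v) (E (s l - s k) v)
      rw [sub_add_cancel] at this
      linarith
    have h2 : ‖v - E (s l - s k) v‖ ≤ √(s l) * ‖T (e (k + 1))‖ + ‖e (k + 1) - v‖ := by
      have h3 : v - E (s l - s k) v = (e (k + 1) - E (s l - s k) (e (k + 1)))
          - ((e (k + 1) - v) - E (s l - s k) (e (k + 1) - v)) := by
        rw [map_sub]; abel
      rw [h3]
      refine (norm_sub_le _ _).trans (add_le_add ?_ ?_)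
      · refine (norm_sub_expOp_le T (by linarith) _).trans ?_
        gcongr
        linarith [hspos k]
      · exact norm_sub_expOp_le_norm T (by linarith) _
    have h3 : √(s l) * ‖T (e (k + 1))‖ ≤ C₃ * (δ * √(s l)) := by
      have := mul_le_mul_of_nonneg_left H3 (Real.sqrt_nonneg (s l))
      linarith
    have h4 : δ * √(s k) ≤ δ * √(s l) := by gcongr
    have h5 : ε * ‖e k‖ ≤ 1 / 4 * (‖v‖ + δ * √(s k)) := by
      have := mul_le_mul_of_nonneg_left hek hε
      have h6 : 0 ≤ ‖v‖ + δ * √(s k) := by positivity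
      nlinarith
    nlinarith [mul_nonneg hC₃ hl0, mul_nonneg hC₃ hl1, mul_nonneg hCC hl0, mul_nonneg hCC hl1,
      mul_nonneg hC₂ hl0, mul_nonneg hC₂ hl1]
  -- Here l precedes the last step. The approximation error decreases with the index. The iteration
  -- had not stopped at j + 1, so H2 bounds the noise at s_j by the approximation error at s_j / 2.
  · obtain ⟨j, rfl⟩ : ∃ j, k = j + 1 := ⟨k - 1, by omega⟩
    have hj : j < j + 1 + 1 := by omega
    obtain ⟨hej, hej1⟩ := hbounds j hj
    have hH2 := H2 j (by omega)
    have hanti : ‖E (s (j + 1)) (e 0)‖ ≤ ‖E (s l) (e 0)‖ :=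
      norm_expOp_antitone hA (hmono (by omega)) _
    have hhalf : ‖E (s j) (e 0)‖ ≤ ‖E (s j / 2) (e 0)‖ :=
      norm_expOp_antitone hA (by linarith [hspos j]) _
    have hx0 : 0 ≤ ‖E (s j / 2) (e 0)‖ := norm_nonneg _
    have hj1 : 0 ≤ δ * √(s j) := by positivity
    have h1 : δ * √(s j) ≤ (2 * C₂ + 1) * ‖E (s j / 2) (e 0)‖ := by
      have h2 : ‖e j‖ + ‖e (j + 1)‖ ≤ 4 * κ * (‖E (s j) (e 0)‖ + δ * √(s j)) := by
        have h3 : 0 ≤ ‖E (s j) (e 0)‖ + δ * √(s j) := by positivity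
        nlinarith
      have h4 := mul_le_mul_of_nonneg_left h2 hε
      have h5 : ε * (4 * κ * (‖E (s j) (e 0)‖ + δ * √(s j)))
          ≤ 1 / 2 * (‖E (s j) (e 0)‖ + δ * √(s j)) := by
        have h3 : 0 ≤ ‖E (s j) (e 0)‖ + δ * √(s j) := by positivity
        nlinarith
      linarith
    have h2 : δ * √(s (j + 1)) ≤ (1 + r) * (δ * √(s j)) := by
      have h3 : s (j + 1) ≤ (1 + r) ^ 2 * s j := by
        have h4 : θ₀ ≤ r * s j := by
          rw [hr, div_mul_eq_mul_div, le_div_iff₀ hs0]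
          gcongr
          exact hmono (Nat.zero_le j)
        nlinarith [hstep j, mul_nonneg hr0 (hspos j).le, mul_nonneg (mul_nonneg hr0 hr0) (hspos j).le]
      have h4 := Real.sqrt_le_sqrt h3
      rw [Real.sqrt_mul (by positivity), Real.sqrt_sq (by positivity)] at h4
      have := mul_le_mul_of_nonneg_left h4 hδ
      linarith
    -- Either s_l ≤ s_j / 2 and monotonicity of the residual applies, or s_j and s_l are comparable
    -- and the noise term at s_l suffices.
    have h3 : δ * √(s j) ≤ (2 * C₂ + 1) * ‖E (s l) (e 0)‖ + 2 * (δ * √(s l)) := by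
      rcases le_or_gt (s l) (s j / 2) with h4 | h4
      · have h5 : ‖E (s j / 2) (e 0)‖ ≤ ‖E (s l) (e 0)‖ := norm_expOp_antitone hA h4 _
        have h6 : (2 * C₂ + 1) * ‖E (s j / 2) (e 0)‖ ≤ (2 * C₂ + 1) * ‖E (s l) (e 0)‖ := by gcongr
        linarith
      · have h5 : s j ≤ 2 ^ 2 * s l := by linarith [hspos l]
        have h6 := Real.sqrt_le_sqrt h5
        rw [Real.sqrt_mul (by positivity), Real.sqrt_sq (by positivity)] at h6
        have h7 := mul_le_mul_of_nonneg_left h6 hδ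
        have h8 : 0 ≤ (2 * C₂ + 1) * ‖E (s l) (e 0)‖ := by positivity
        linarith
    have h4 : δ * √(s (j + 1))
        ≤ (1 + r) * (2 * C₂ + 3) * (‖E (s l) (e 0)‖ + δ * √(s l)) := by
      refine h2.trans ?_
      rw [mul_assoc]
      refine mul_le_mul_of_nonneg_left ?_ (by positivity)
      nlinarith [mul_nonneg hC₂ hl1]
    set z := ‖E (s l) (e 0)‖ + δ * √(s l) with hz
    have h5 : 2 * ‖E (s l) (e 0)‖ ≤ (4 * C₃ + 13) * z := by
      have : 0 ≤ C₃ * z := by positivity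
      linarith
    calc _ ≤ _ := hek1
      _ ≤ 2 * (‖E (s l) (e 0)‖ + (1 + r) * (2 * C₂ + 3) * z) := by gcongr
      _ ≤ _ := by linarith

end OracleInequality

/-! ### Convergence and rates from the oracle inequality by choice of the index. -/

section Rates

variable {X Y : Type*} [NormedAddCommGroup X] [InnerProductSpace ℝ X] [CompleteSpace X]
  [NormedAddCommGroup Y] [InnerProductSpace ℝ Y] [CompleteSpace Y]

/-- Take the first index reaching R. It overshoots by at most θ₀, which is at most (θ₀/s₀)R unless
the index is 0. -/
theorem exists_index_between {s : ℕ → ℝ} {θ₀ R : ℝ} (hs0 : 0 < s 0) (hmono : Monotone s)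
    (hθ : 0 ≤ θ₀) (hstep : ∀ k, s (k + 1) - s k ≤ θ₀) (hlim : Tendsto s atTop atTop)
    (hR : 0 ≤ R) : ∃ l, R ≤ s l ∧ s l ≤ s 0 + (1 + θ₀ / s 0) * R := by
  classical
  have hex : ∃ l, R ≤ s l := (hlim.eventually_ge_atTop R).exists
  refine ⟨Nat.find hex, Nat.find_spec hex, ?_⟩
  rcases h : Nat.find hex with _ | j
  · have : 0 ≤ (1 + θ₀ / s 0) * R := by positivity
    linarith
  · have hj : s j < R := not_le.mp (Nat.find_min hex (by omega))
    have h0 := hmono (Nat.zero_le j)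
    have h1 : θ₀ ≤ θ₀ / s 0 * R := by
      rw [div_mul_eq_mul_div, le_div_iff₀ hs0]
      gcongr
      linarith
    linarith [hstep j]

/-- Raise x/ν ≤ exp(x/ν) to the power ν; the sharper factor exp(-ν) is not needed. -/
theorem rpow_mul_exp_neg_le {ν x : ℝ} (hν : 0 < ν) (hx : 0 ≤ x) :
    x ^ ν * Real.exp (-x) ≤ ν ^ ν := by
  have h1 : x / ν ≤ Real.exp (x / ν) := by linarith [Real.add_one_le_exp (x / ν)]
  have h2 : x ≤ ν * Real.exp (x / ν) := by
    rw [div_le_iff₀ hν] at h1; linarith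
  have h3 := Real.rpow_le_rpow hx h2 hν.le
  rw [Real.mul_rpow hν.le (Real.exp_pos _).le, ← Real.exp_mul, div_mul_cancel₀ _ hν.ne'] at h3
  calc _ ≤ ν ^ ν * Real.exp x * Real.exp (-x) := by gcongr
    _ = ν ^ ν := by rw [mul_assoc, ← Real.exp_add, add_neg_cancel, Real.exp_zero, mul_one]

theorem continuousOn_rpow_const {ν : ℝ} (hν : 0 ≤ ν) (S : Set ℝ) :
    ContinuousOn (fun t : ℝ => t ^ ν) S :=
  (Real.continuous_rpow_const hν).continuousOn

theorem norm_functionOf_rpow_le {A : X →L[ℝ] X} (hA : A.IsPositive) (hA1 : ‖A‖ ≤ 1) {ν : ℝ}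
    (hν : 0 ≤ ν) (ω : X) : ‖functionOf (fun t : ℝ => t ^ ν) A ω‖ ≤ ‖ω‖ := by
  have := (functionOf (fun t : ℝ => t ^ ν) A).le_of_opNorm_le
    (norm_functionOf_le hA (M := 1) (continuousOn_rpow_const hν _) fun t ht => by
      rw [abs_of_nonneg (Real.rpow_nonneg ht.1 _)]
      exact Real.rpow_le_one ht.1 (ht.2.trans hA1) hν) ω
  simpa using this

theorem norm_expOp_functionOf_le {A : X →L[ℝ] X} (hA : A.IsPositive) {f : ℝ → ℝ}
    (hf : ContinuousOn f (Icc 0 ‖A‖)) {s M : ℝ}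
    (hM : ∀ t ∈ Icc 0 ‖A‖, Real.exp (-(s * t)) * |f t| ≤ M) (ω : X) :
    ‖expOp A s (functionOf f A ω)‖ ≤ M * ‖ω‖ := by
  have h : expOp A s (functionOf f A ω)
      = functionOf (fun t => Real.exp (-(s * t)) * f t) A ω := by
    rw [functionOf_mul hA (continuousOn_exp_neg_mul _ _) hf]
    rfl
  rw [h]
  refine ContinuousLinearMap.le_of_opNorm_le _ (norm_functionOf_le hA
    ((continuousOn_exp_neg_mul _ _).mul hf) fun t ht => ?_) ω
  rw [Pi.mul_apply, abs_mul, abs_of_pos (Real.exp_pos _)]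
  exact hM t ht

theorem norm_expOp_rpow_le {A : X →L[ℝ] X} (hA : A.IsPositive) {ν s : ℝ} (hν : 0 < ν)
    (hs : 0 < s) (ω : X) :
    ‖expOp A s (functionOf (fun t : ℝ => t ^ ν) A ω)‖ ≤ ν ^ ν * s ^ (-ν) * ‖ω‖ := by
  refine norm_expOp_functionOf_le hA (continuousOn_rpow_const hν.le _) (fun t ht => ?_) ω
  rw [abs_of_nonneg (Real.rpow_nonneg ht.1 _)]
  have h1 := rpow_mul_exp_neg_le hν (mul_nonneg hs.le ht.1)
  rw [Real.mul_rpow hs.le ht.1] at h1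
  rw [Real.rpow_neg hs.le, ← div_eq_mul_inv, le_div_iff₀ (Real.rpow_pos_of_pos hs _)]
  linarith

/-- The constant of the Hölder rates. -/
noncomputable def holderConst (C D s₀ θ₀ ν : ℝ) : ℝ :=
  D ^ (-(2 * ν / (1 + 2 * ν)))
    + C * (ν ^ ν + √(s₀ * D ^ (2 / (1 + 2 * ν)) + (1 + θ₀ / s₀)))

theorem holderConst_pos {C D s₀ θ₀ ν : ℝ} (hC : 0 ≤ C) (hD : 0 < D) (hν : 0 < ν) :
    0 < holderConst C D s₀ θ₀ ν := by
  unfold holderConst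
  positivity

/-- R = (‖ω‖/δ)^{2/(1+2ν)} balances R^{-ν}‖ω‖ against δ√R. The sequence s need not contain values
near R when R is far below s₀. That happens only for large noise, where the alternative `hb`
excludes everything but stopping at the initial guess. -/
theorem holder_rate {A : X →L[ℝ] X} (hA : A.IsPositive) (hA1 : ‖A‖ ≤ 1) {s : ℕ → ℝ} {θ₀ : ℝ}
    (hs0 : 0 < s 0) (hmono : Monotone s) (hθ : 0 ≤ θ₀) (hstep : ∀ k, s (k + 1) - s k ≤ θ₀)
    (hlim : Tendsto s atTop atTop) {ν δ D C b : ℝ} (hν : 0 < ν) (hδ : 0 < δ) (hD : 0 < D)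
    (hC : 0 ≤ C) {e₀ ω : X} (he : e₀ = functionOf (fun t : ℝ => t ^ ν) A ω)
    (hb : b = ‖e₀‖ ∨ δ ≤ D * ‖e₀‖)
    (hO : ∀ l, b ≤ C * (‖expOp A (s l) e₀‖ + δ * √(s l))) :
    b ≤ holderConst C D (s 0) θ₀ ν * ‖ω‖ ^ (1 / (1 + 2 * ν)) * δ ^ (2 * ν / (1 + 2 * ν)) := by
  have heω : ‖e₀‖ ≤ ‖ω‖ := he ▸ norm_functionOf_rpow_le hA hA1 hν.le ω
  set p := 1 / (1 + 2 * ν) with hp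
  set q := 2 * ν / (1 + 2 * ν) with hq
  have hp0 : 0 < p := by positivity
  have hq0 : 0 < q := by positivity
  have hpq : p + q = 1 := by rw [hp, hq]; field_simp
  have hm : 2 / (1 + 2 * ν) = 2 * p := by rw [hp]; ring
  have hmν : 2 * p * ν = q := by rw [hp, hq]; ring
  unfold holderConst
  rw [hm, ← hq]
  set H := s 0 * D ^ (2 * p) + (1 + θ₀ / s 0) with hH
  have hH0 : 0 ≤ H := by positivity
  rcases le_or_gt δ (D * ‖ω‖) with hδω | hδω
  · have hω : 0 < ‖ω‖ := by
      by_contra h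
      have : ‖ω‖ = 0 := le_antisymm (not_lt.mp h) (norm_nonneg _)
      rw [this, mul_zero] at hδω
      linarith
    set R := (‖ω‖ / δ) ^ (2 * p) with hR
    have hR0 : 0 < R := by positivity
    obtain ⟨l, hl1, hl2⟩ := exists_index_between hs0 hmono hθ hstep hlim hR0.le
    have hl : s l ≤ H * R := by
      have h1 : 1 ≤ D ^ (2 * p) * R := by
        rw [hR, ← Real.mul_rpow hD.le (by positivity)]
        refine Real.one_le_rpow ?_ (by positivity)
        rw [mul_div_assoc', le_div_iff₀ hδ]
        linarith
      have h2 := mul_le_mul_of_nonneg_left h1 hs0.le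
      rw [hH]
      linarith
    have h1 : ‖expOp A (s l) e₀‖ ≤ ν ^ ν * (‖ω‖ ^ p * δ ^ q) := by
      rw [he]
      refine (norm_expOp_rpow_le hA hν (hR0.trans_le hl1) ω).trans ?_
      rw [mul_assoc]
      refine mul_le_mul_of_nonneg_left ?_ (by positivity)
      have h2 : s l ^ (-ν) ≤ R ^ (-ν) :=
        Real.rpow_le_rpow_of_nonpos hR0 hl1 (by linarith)
      have h3 : R ^ (-ν) * ‖ω‖ = ‖ω‖ ^ p * δ ^ q := by
        rw [hR, ← Real.rpow_mul (by positivity), mul_neg, hmν, Real.rpow_neg (by positivity),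
          Real.div_rpow hω.le hδ.le, inv_div]
        have h4 : ‖ω‖ = ‖ω‖ ^ p * ‖ω‖ ^ q := by
          rw [← Real.rpow_add hω, hpq, Real.rpow_one]
        have h5 : 0 < ‖ω‖ ^ q := by positivity
        nth_rw 2 [h4]
        field_simp
      calc _ ≤ R ^ (-ν) * ‖ω‖ := by gcongr
        _ = _ := h3
    have h2 : δ * √(s l) ≤ √H * (‖ω‖ ^ p * δ ^ q) := by
      have h3 := Real.sqrt_le_sqrt hl
      rw [Real.sqrt_mul hH0] at h3
      have h4 : δ * √R = ‖ω‖ ^ p * δ ^ q := by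
        rw [hR, Real.sqrt_eq_rpow, ← Real.rpow_mul (by positivity),
          show 2 * p * (1 / 2) = p by ring, Real.div_rpow hω.le hδ.le]
        have h4 : δ = δ ^ p * δ ^ q := by
          rw [← Real.rpow_add hδ, hpq, Real.rpow_one]
        have h5 : 0 < δ ^ p := by positivity
        nth_rw 1 [h4]
        field_simp
      calc _ ≤ δ * (√H * √R) := by gcongr
        _ = √H * (δ * √R) := by ring
        _ = _ := by rw [h4]
    calc b ≤ _ := hO l
      _ ≤ C * (ν ^ ν * (‖ω‖ ^ p * δ ^ q) + √H * (‖ω‖ ^ p * δ ^ q)) := by gcongr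
      _ = 0 + C * (ν ^ ν + √H) * (‖ω‖ ^ p * δ ^ q) := by ring
      _ ≤ D ^ (-q) * (‖ω‖ ^ p * δ ^ q) + C * (ν ^ ν + √H) * (‖ω‖ ^ p * δ ^ q) := by
        gcongr
        positivity
      _ = _ := by ring
  -- With δ > D‖ω‖ the second alternative is contradictory, so b = ‖e₀‖ ≤ ‖ω‖, and ‖ω‖ itself is
  -- below the claimed rate.
  · have hbe : b ≤ ‖ω‖ := by
      rcases hb with hb | hb
      · linarith
      · have := mul_le_mul_of_nonneg_left heω hD.le
        linarith
    have hωD : ‖ω‖ ≤ D⁻¹ * δ := by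
      rw [inv_mul_eq_div, le_div_iff₀ hD]
      linarith
    have h1 : ‖ω‖ ^ q ≤ D ^ (-q) * δ ^ q := by
      have := Real.rpow_le_rpow (norm_nonneg ω) hωD hq0.le
      rwa [Real.mul_rpow (by positivity) hδ.le, Real.inv_rpow hD.le, ← Real.rpow_neg hD.le] at this
    have h2 : ‖ω‖ = ‖ω‖ ^ p * ‖ω‖ ^ q := by
      rw [← Real.rpow_add' (norm_nonneg _) (by rw [hpq]; exact one_ne_zero), hpq, Real.rpow_one]
    have h3 : 0 ≤ C * (ν ^ ν + √H) * (‖ω‖ ^ p * δ ^ q) := by positivity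
    calc b ≤ ‖ω‖ := hbe
      _ = ‖ω‖ ^ p * ‖ω‖ ^ q := h2
      _ ≤ ‖ω‖ ^ p * (D ^ (-q) * δ ^ q) := by gcongr
      _ ≤ ‖ω‖ ^ p * (D ^ (-q) * δ ^ q) + C * (ν ^ ν + √H) * (‖ω‖ ^ p * δ ^ q) := by linarith
      _ = _ := by ring

theorem continuousOn_neg_log_rpow {μ a : ℝ} (hμ : 0 < μ) (ha : a < 1) :
    ContinuousOn (fun t : ℝ => if t = 0 then 0 else (-Real.log t) ^ (-μ)) (Icc 0 a) := by
  -- The conventions log 0 = 0 and 0^(-μ) = 0 make the case distinction redundant.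
  have heq : (fun t : ℝ => if t = 0 then 0 else (-Real.log t) ^ (-μ))
      = fun t : ℝ => (-Real.log t) ^ (-μ) := by
    funext t
    split_ifs with h
    · rw [h, Real.log_zero, neg_zero, Real.zero_rpow (by linarith)]
    · rfl
  rw [heq]
  intro t ht
  rcases ht.1.eq_or_lt with rfl | ht0
  · have h1 : Tendsto (fun t : ℝ => (-Real.log t) ^ (-μ)) (𝓝[>] 0) (𝓝 0) :=
      (tendsto_rpow_neg_atTop hμ).comp (tendsto_neg_atBot_atTop.comp Real.tendsto_log_nhdsGT_zero)
    have h2 : ContinuousWithinAt (fun t : ℝ => (-Real.log t) ^ (-μ)) (Ioi 0) 0 := by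
      rw [ContinuousWithinAt, Real.log_zero, neg_zero, Real.zero_rpow (by linarith)]
      exact h1
    have h3 := h2.insert
    rw [Ioi_insert] at h3
    exact h3.mono Icc_subset_Ici_self
  · have hlog : Real.log t < 0 := Real.log_neg ht0 (ht.2.trans_lt ha)
    have h1 : ContinuousAt (fun t : ℝ => -Real.log t) t := (Real.continuousAt_log ht0.ne').neg
    exact (h1.rpow_const (Or.inl (by linarith))).continuousWithinAt

theorem exp_neg_half_le_rpow {μ a : ℝ} (hμ : 0 < μ) (ha : 0 < a) :
    Real.exp (-(a / 2)) ≤ (2 * μ) ^ μ * a ^ (-μ) := by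
  have h := rpow_mul_exp_neg_le hμ (x := a / 2) (by positivity)
  rw [Real.div_rpow ha.le two_pos.le] at h
  rw [Real.rpow_neg ha.le, Real.mul_rpow two_pos.le hμ.le, ← div_eq_mul_inv,
    le_div_iff₀ (by positivity)]
  rw [div_mul_eq_mul_div, div_le_iff₀ (by positivity)] at h
  linarith

/-- Split at t = R^{-1/2}. Below it, -log t is comparable to 1 + log R. Above it, Rt ≥ (1 + log
R)/2, and the exponential beats every power of 1 + log R. -/
theorem exp_neg_mul_log_rpow_le {μ R t : ℝ} (hμ : 0 < μ) (hR : 1 ≤ R) (ht0 : 0 < t)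
    (ht : t ≤ 1 / 2) : Real.exp (-(R * t)) * (-Real.log t) ^ (-μ)
      ≤ (4 ^ μ + 2 ^ μ * (2 * μ) ^ μ) * (1 + Real.log R) ^ (-μ) := by
  have hR0 : 0 < R := by linarith
  have hlogR : 0 ≤ Real.log R := Real.log_nonneg hR
  have hlogt : 1 / 2 ≤ -Real.log t := by
    have h1 : Real.log t ≤ Real.log (1 / 2) := Real.log_le_log ht0 ht
    rw [one_div, Real.log_inv] at h1
    have := Real.log_two_gt_d9
    linarith
  have ha0 : 0 ≤ (1 + Real.log R) ^ (-μ) := by positivity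
  rw [add_mul]
  rcases le_or_gt (1 / 2 * Real.log R) (-Real.log t) with h | h
  · have h1 : (-Real.log t) ^ (-μ) ≤ ((1 + Real.log R) / 4) ^ (-μ) :=
      Real.rpow_le_rpow_of_nonpos (by positivity) (by linarith) (by linarith)
    have h2 : ((1 + Real.log R) / 4) ^ (-μ) = 4 ^ μ * (1 + Real.log R) ^ (-μ) := by
      rw [Real.div_rpow (by positivity) (by norm_num), Real.rpow_neg (by norm_num : (0:ℝ) ≤ 4)]
      field_simp
    have h3 : Real.exp (-(R * t)) ≤ 1 := by
      rw [Real.exp_le_one_iff]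
      have := mul_pos hR0 ht0
      linarith
    have h4 : 0 ≤ (-Real.log t) ^ (-μ) := Real.rpow_nonneg (by linarith) _
    calc _ ≤ 1 * (-Real.log t) ^ (-μ) := by gcongr
      _ ≤ 4 ^ μ * (1 + Real.log R) ^ (-μ) := by rw [one_mul, ← h2]; exact h1
      _ ≤ _ := le_add_of_nonneg_right (by positivity)
  · have h1 : (1 + Real.log R) / 2 ≤ R * t := by
      have h2 : Real.log (R * t) = Real.log R + Real.log t := Real.log_mul hR0.ne' ht0.ne'
      have h3 := Real.add_one_le_exp (Real.log (R * t))
      rw [Real.exp_log (by positivity)] at h3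
      linarith
    have h2 : Real.exp (-(R * t)) ≤ (2 * μ) ^ μ * (1 + Real.log R) ^ (-μ) :=
      (Real.exp_le_exp.mpr (by linarith)).trans (exp_neg_half_le_rpow hμ (by positivity))
    have h3 : (-Real.log t) ^ (-μ) ≤ 2 ^ μ := by
      have := Real.rpow_le_rpow_of_nonpos (by norm_num : (0:ℝ) < 1 / 2) hlogt
        (by linarith : -μ ≤ 0)
      rwa [one_div, Real.inv_rpow two_pos.le, Real.rpow_neg two_pos.le, inv_inv] at this
    calc _ ≤ ((2 * μ) ^ μ * (1 + Real.log R) ^ (-μ)) * 2 ^ μ := by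
          gcongr
      _ = 2 ^ μ * (2 * μ) ^ μ * (1 + Real.log R) ^ (-μ) := by ring
      _ ≤ _ := le_add_of_nonneg_left (by positivity)

/-- The constant of the logarithmic rates. -/
noncomputable def logConst (C s₀ θ₀ μ : ℝ) : ℝ :=
  C * ((4 ^ μ + 2 ^ μ * (2 * μ) ^ μ)
    + √(s₀ + (1 + θ₀ / s₀)) * (Real.exp (1 / 2) * (2 * μ) ^ μ))

theorem logConst_pos {C s₀ θ₀ μ : ℝ} (hC : 0 < C) (hμ : 0 < μ) : 0 < logConst C s₀ θ₀ μ := by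
  unfold logConst
  positivity

/-- No balancing is needed: with R = ‖ω‖/δ the noise term is of order √(δ‖ω‖), which is below every
logarithmic rate. -/
theorem log_rate {A : X →L[ℝ] X} (hA : A.IsPositive) (hA1 : ‖A‖ ≤ 1 / 2) {s : ℕ → ℝ} {θ₀ : ℝ}
    (hs0 : 0 < s 0) (hmono : Monotone s) (hθ : 0 ≤ θ₀) (hstep : ∀ k, s (k + 1) - s k ≤ θ₀)
    (hlim : Tendsto s atTop atTop) {μ δ C b : ℝ} (hμ : 0 < μ) (hδ : 0 < δ) (hC : 0 ≤ C)
    {e₀ ω : X}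
    (he : e₀ = functionOf (fun t : ℝ => if t = 0 then 0 else (-Real.log t) ^ (-μ)) A ω)
    (hδω : δ ≤ ‖ω‖) (hO : ∀ l, b ≤ C * (‖expOp A (s l) e₀‖ + δ * √(s l))) :
    b ≤ logConst C (s 0) θ₀ μ * ‖ω‖ * (1 + |Real.log (δ / ‖ω‖)|) ^ (-μ) := by
  have hω : 0 < ‖ω‖ := hδ.trans_le hδω
  set R := ‖ω‖ / δ with hR
  have hR1 : 1 ≤ R := by rwa [hR, le_div_iff₀ hδ, one_mul]
  have hR0 : 0 < R := by linarith
  have hlogR : 0 ≤ Real.log R := Real.log_nonneg hR1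
  have habs : |Real.log (δ / ‖ω‖)| = Real.log R := by
    rw [← inv_div, Real.log_inv, abs_neg, abs_of_nonneg hlogR]
  rw [habs]
  obtain ⟨l, hl1, hl2⟩ := exists_index_between hs0 hmono hθ hstep hlim hR0.le
  unfold logConst
  set H := s 0 + (1 + θ₀ / s 0) with hH
  have hH0 : 0 ≤ H := by positivity
  have hl : s l ≤ H * R := by
    have := mul_le_mul_of_nonneg_left hR1 hs0.le
    rw [hH]
    linarith
  set K := (4 ^ μ + 2 ^ μ * (2 * μ) ^ μ : ℝ) with hK
  set P := (1 + Real.log R) ^ (-μ) with hP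
  have hP0 : 0 < P := by positivity
  have h1 : ‖expOp A (s l) e₀‖ ≤ K * P * ‖ω‖ := by
    rw [he]
    refine norm_expOp_functionOf_le hA (continuousOn_neg_log_rpow hμ (by linarith))
      (fun t ht => ?_) ω
    rcases ht.1.eq_or_lt with rfl | ht0
    · simp only [if_true, abs_zero, mul_zero]
      positivity
    · have ht2 := ht.2.trans hA1
      have hlog : Real.log t < 0 := Real.log_neg ht0 (by linarith)
      have h2 : 0 ≤ (-Real.log t) ^ (-μ) := Real.rpow_nonneg (by linarith) _
      rw [if_neg ht0.ne', abs_of_nonneg h2]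
      refine le_trans ?_ (exp_neg_mul_log_rpow_le hμ hR1 ht0 ht2)
      gcongr
  have h2 : δ * √(s l) ≤ √H * (Real.exp (1 / 2) * (2 * μ) ^ μ) * P * ‖ω‖ := by
    have h3 := Real.sqrt_le_sqrt hl
    rw [Real.sqrt_mul hH0] at h3
    have h4 : δ * √R = ‖ω‖ * Real.exp (-(Real.log R / 2)) := by
      have h5 : √R = Real.exp (Real.log R / 2) := by
        rw [← Real.log_sqrt hR0.le, Real.exp_log (Real.sqrt_pos.mpr hR0)]
      have h6 : ‖ω‖ = δ * (√R * √R) := by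
        rw [Real.mul_self_sqrt hR0.le, hR]
        field_simp
      rw [h6, Real.exp_neg, ← h5]
      have := Real.sqrt_pos.mpr hR0
      field_simp
    have h5 : Real.exp (-(Real.log R / 2)) ≤ Real.exp (1 / 2) * ((2 * μ) ^ μ * P) := by
      have h6 := exp_neg_half_le_rpow hμ (a := 1 + Real.log R) (by positivity)
      have h7 : Real.exp (-(Real.log R / 2))
          = Real.exp (1 / 2) * Real.exp (-((1 + Real.log R) / 2)) := by
        rw [← Real.exp_add]
        ring_nf
      rw [h7]
      gcongr
    calc _ ≤ δ * (√H * √R) := by gcongr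
      _ = √H * (δ * √R) := by ring
      _ ≤ √H * (‖ω‖ * (Real.exp (1 / 2) * ((2 * μ) ^ μ * P))) := by rw [h4]; gcongr
      _ = _ := by ring
  calc b ≤ _ := hO l
    _ ≤ C * (K * P * ‖ω‖ + √H * (Real.exp (1 / 2) * (2 * μ) ^ μ) * P * ‖ω‖) := by gcongr
    _ = _ := by ring

open ContinuousLinearMap (adjoint)

/-- The orthogonal complement of the kernel is the closure of the range of T*. On that range the
semigroup decays like 1/√s, and contractivity handles the approximation. -/
theorem exists_norm_expOp_le {T : X →L[ℝ] Y} {e₀ : X} (he : e₀ ∈ T.kerᗮ) {ε : ℝ} (hε : 0 < ε) :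
    ∃ S : ℝ, 0 < S ∧ ∀ s ≥ S, ‖expOp (normalOp T) s e₀‖ ≤ ε := by
  have hA := isPositive_normalOp T
  rw [ContinuousLinearMap.orthogonal_ker, ← SetLike.mem_coe, Submodule.topologicalClosure_coe,
    Metric.mem_closure_iff] at he
  obtain ⟨_, ⟨u, rfl⟩, hu⟩ := he (ε / 2) (by positivity)
  rw [dist_eq_norm] at hu
  refine ⟨((‖u‖ + 1) / ε) ^ 2, by positivity, fun s hs => ?_⟩
  have hs0 : 0 < s := lt_of_lt_of_le (by positivity) hs
  have h1 : (‖u‖ + 1) / ε ≤ √s := Real.le_sqrt_of_sq_le hs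
  have h2 := norm_expOp_adjoint_le T hs0 u
  have h3 := norm_expOp_apply_le hA hs0.le (e₀ - adjoint T u)
  have h4 : asymptoticC3 / √s * ‖u‖ ≤ ε / 2 := by
    rw [div_mul_eq_mul_div, div_le_iff₀ (Real.sqrt_pos.mpr hs0)]
    rw [div_le_iff₀ hε] at h1
    have := asymptoticC3_le_half
    nlinarith [norm_nonneg u]
  have h5 : expOp (normalOp T) s e₀ = expOp (normalOp T) s (e₀ - adjoint T u)
      + expOp (normalOp T) s (adjoint T u) := by rw [← map_add, sub_add_cancel]
  rw [h5]
  refine (norm_add_le _ _).trans ?_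
  have h6 : ‖e₀ - adjoint T u‖ < ε / 2 := hu
  linarith

/-- The index is fixed first, to make the approximation error small, and δ₀ afterwards. One index
therefore serves all noise levels below δ₀ and all data. -/
theorem exists_noise_level {T : X →L[ℝ] Y} {e₀ : X} (he : e₀ ∈ T.kerᗮ) {s : ℕ → ℝ}
    (hlim : Tendsto s atTop atTop) {C : ℝ} (hC : 0 < C) {ε : ℝ} (hε : 0 < ε) :
    ∃ δ₀ : ℝ, 0 < δ₀ ∧ ∃ l, ∀ δ ≤ δ₀,
      C * (‖expOp (normalOp T) (s l) e₀‖ + δ * √(s l)) ≤ ε := by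
  obtain ⟨S, -, hS⟩ := exists_norm_expOp_le he (ε := ε / (2 * C)) (by positivity)
  obtain ⟨l, hl⟩ := (hlim.eventually_ge_atTop S).exists
  refine ⟨ε / (2 * C * (√(s l) + 1)), by positivity, l, fun δ hδ => ?_⟩
  have h1 := hS (s l) hl
  rw [le_div_iff₀ (by positivity)] at h1 hδ
  have h2 := Real.sqrt_nonneg (s l)
  rcases le_or_gt δ 0 with h | h
  · have : δ * √(s l) ≤ 0 := mul_nonpos_of_nonpos_of_nonneg h h2
    nlinarith
  · nlinarith [mul_pos hC h]

end Rates

/-! ### Error representation of a Newton step and the Taylor remainder. -/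

section NewtonStep

variable {X Y : Type*} [NormedAddCommGroup X] [InnerProductSpace ℝ X] [CompleteSpace X]
  [NormedAddCommGroup Y] [InnerProductSpace ℝ Y] [CompleteSpace Y]

open ContinuousLinearMap (adjoint)

/-- The error representation of a Newton step. -/
theorem newtonIterate_succ_sub (α : ℕ → ℝ) (F : X → Y) (x₀ xd : X) (z : Y) (k : ℕ) :
    newtonIterate asymptoticFilter α F x₀ z (k + 1) - xd
      = expOp (normalOp (fderiv ℝ F (newtonIterate asymptoticFilter α F x₀ z k))) (1 / α k)
          (x₀ - xd)
        - functionOf (asymptoticFilter (α k))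
          (normalOp (fderiv ℝ F (newtonIterate asymptoticFilter α F x₀ z k)))
          (adjoint (fderiv ℝ F (newtonIterate asymptoticFilter α F x₀ z k))
            ((F (newtonIterate asymptoticFilter α F x₀ z k) - F xd
              - fderiv ℝ F (newtonIterate asymptoticFilter α F x₀ z k)
                (newtonIterate asymptoticFilter α F x₀ z k - xd)) + (F xd - z))) := by
  rw [newtonIterate]
  set x := newtonIterate asymptoticFilter α F x₀ z k
  set S := fderiv ℝ F x
  have h1 : F x - z - S (x - x₀) = ((F x - F xd - S (x - xd)) + (F xd - z)) + S (x₀ - xd) := by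
    simp only [map_sub]; abel
  have h2 : functionOf (asymptoticFilter (α k)) (normalOp S) (adjoint S (S (x₀ - xd)))
      = (x₀ - xd) - expOp (normalOp S) (1 / α k) (x₀ - xd) :=
    DFunLike.congr_fun (filter_self_comp (isPositive_normalOp S) (α k)) (x₀ - xd)
  rw [h1, map_add (adjoint S), map_add (functionOf (asymptoticFilter (α k)) (normalOp S)), h2]
  abel

theorem norm_step_sub_le (S : X →L[ℝ] Y) {α : ℝ} (hα : 0 < α) {e e₀ : X} {N n : Y} {δ : ℝ}
    (he : e = expOp (normalOp S) (1 / α) e₀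
      - functionOf (asymptoticFilter α) (normalOp S) (adjoint S (N + n))) (hn : ‖n‖ ≤ δ) :
    ‖e - expOp (normalOp S) (1 / α) e₀‖ ≤ asymptoticC4 * √(1 / α) * (‖N‖ + δ) := by
  rw [he, sub_sub_cancel_left, norm_neg]
  refine (norm_filter_adjoint_le S hα _).trans ?_
  have := asymptoticC4_pos
  gcongr
  exact (norm_add_le _ _).trans (by linarith)

/-- Since S g(S*S) S* = I - r(SS*), the noise n survives only through the contraction r(SS*). Its
coefficient is exactly one, which is what allows every τ > 1 in the discrepancy principle. -/
theorem norm_apply_step_add_le (S : X →L[ℝ] Y) {α : ℝ} (hα : 0 < α) {e e₀ : X} {N n : Y} {δ : ℝ}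
    (he : e = expOp (normalOp S) (1 / α) e₀
      - functionOf (asymptoticFilter α) (normalOp S) (adjoint S (N + n))) (hn : ‖n‖ ≤ δ) :
    ‖S e + n‖ ≤ δ + ‖S (expOp (normalOp S) (1 / α) e₀)‖ + ‖N‖ := by
  have hα' : (0 : ℝ) ≤ 1 / α := by positivity
  have h1 : S e + n = S (expOp (normalOp S) (1 / α) e₀)
      - (N - expOp (normalOp (adjoint S)) (1 / α) N) + expOp (normalOp (adjoint S)) (1 / α) n := by
    rw [he, map_sub, apply_filter_adjoint, map_add]
    abel
  rw [h1]
  have h2 := norm_sub_expOp_le_norm (adjoint S) hα' N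
  have h3 := norm_expOp_apply_le (isPositive_normalOp (adjoint S)) hα' n
  refine (norm_add_le _ _).trans ?_
  have h4 := norm_sub_le (S (expOp (normalOp S) (1 / α) e₀))
    (N - expOp (normalOp (adjoint S)) (1 / α) N)
  linarith

omit [CompleteSpace X] [CompleteSpace Y] in
-- The mean value inequality along the segment. S is left free so that linearizations at both end
-- points are covered.
theorem norm_taylor_le {F : X → Y} {xd : X} {ρ : ℝ}
    (hF : ∀ x ∈ Metric.ball xd ρ, DifferentiableAt ℝ F x) {x : X} (hx : x ∈ Metric.ball xd ρ)
    (S : X →L[ℝ] Y) {C : ℝ} (hC : ∀ t ∈ Icc (0 : ℝ) 1,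
      ‖(fderiv ℝ F (xd + t • (x - xd)) - S) (x - xd)‖ ≤ C) :
    ‖F x - F xd - S (x - xd)‖ ≤ C := by
  have hmem : ∀ t ∈ Icc (0 : ℝ) 1, xd + t • (x - xd) ∈ Metric.ball xd ρ := fun t ht => by
    rw [mem_ball_iff_norm] at hx ⊢
    rw [add_sub_cancel_left, norm_smul, Real.norm_of_nonneg ht.1]
    exact (mul_le_of_le_one_left (norm_nonneg _) ht.2).trans_lt hx
  have hd : ∀ t ∈ Icc (0 : ℝ) 1, HasDerivWithinAt
      (fun t : ℝ => F (xd + t • (x - xd)) - t • S (x - xd))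
      ((fderiv ℝ F (xd + t • (x - xd)) - S) (x - xd)) (Icc 0 1) t := fun t ht => by
    have h1 : HasDerivAt (fun t : ℝ => xd + t • (x - xd)) (x - xd) t := by
      simpa using ((hasDerivAt_id t).smul_const (x - xd)).const_add xd
    have h2 := (hF _ (hmem t ht)).hasFDerivAt.comp_hasDerivAt t h1
    have h3 := h2.sub ((hasDerivAt_id t).smul_const (S (x - xd)))
    rw [one_smul] at h3
    exact h3.hasDerivWithinAt
  have := norm_image_sub_le_of_norm_deriv_le_segment_01' hd fun t ht => hC t ⟨ht.1, ht.2.le⟩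
  simp only [one_smul, zero_smul, add_zero, sub_zero, add_sub_cancel] at this
  rwa [sub_right_comm] at this

end NewtonStep

/-! ### Consequences of the standing conditions and of the parameter choice. -/

section Standing

variable {X Y : Type*} [NormedAddCommGroup X] [InnerProductSpace ℝ X]
  [NormedAddCommGroup Y] [InnerProductSpace ℝ Y]
  {D : Set X} {F : X → Y} {x₀ xd : X} {ρ β₀ α₀ θ₀ : ℝ} {α : ℕ → ℝ}

theorem StandingConditions.differentiableAt (h : StandingConditions D F xd ρ β₀ α₀) :
    ∀ x ∈ Metric.ball xd ρ, DifferentiableAt ℝ F x := fun _ hx =>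
  (h.differentiable.mono h.ball_subset).differentiableAt (Metric.isOpen_ball.mem_nhds hx)

theorem StandingConditions.center_mem (h : StandingConditions D F xd ρ β₀ α₀) :
    xd ∈ Metric.ball xd ρ := Metric.mem_ball_self h.radius_pos

theorem StandingConditions.norm_deriv_le (h : StandingConditions D F xd ρ β₀ α₀) {x : X}
    (hx : x ∈ Metric.ball xd ρ) : ‖fderiv ℝ F x‖ ≤ asymptoticC3 * √α₀ :=
  (h.deriv_le x hx).trans (min_le_left _ _)

theorem StandingConditions.norm_normalOp_le [CompleteSpace X] [CompleteSpace Y]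
    (h : StandingConditions D F xd ρ β₀ α₀) : ‖normalOp (fderiv ℝ F xd)‖ ≤ 1 / 2 := by
  rw [norm_normalOp]
  have h1 := (h.deriv_le xd h.center_mem).trans (min_le_right _ _)
  calc _ ≤ √β₀ * √β₀ := by gcongr
    _ = β₀ := Real.mul_self_sqrt h.beta_pos.le
    _ ≤ _ := h.beta_le

theorem StandingConditions.norm_residual_le (h : StandingConditions D F xd ρ β₀ α₀)
    (hx₀ : x₀ ∈ Metric.ball xd ρ) {z : Y} {δ : ℝ} (hz : ‖z - F xd‖ ≤ δ) :
    ‖F x₀ - z‖ ≤ δ + asymptoticC3 * √α₀ * ‖x₀ - xd‖ := by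
  have h1 := (convex_ball xd ρ).norm_image_sub_le_of_norm_fderiv_le h.differentiableAt
    (fun x hx => h.norm_deriv_le hx) h.center_mem hx₀
  have h2 := norm_sub_le (F x₀ - F xd) (z - F xd)
  rw [sub_sub_sub_cancel_right] at h2
  linarith

theorem IsParameterSequence.monotone (h : IsParameterSequence θ₀ α) :
    Monotone fun k => 1 / α k :=
  monotone_nat_of_le_succ fun k => by linarith [(h.step k).1]

theorem IsParameterSequence.tendsto_atTop (h : IsParameterSequence θ₀ α) :
    Tendsto (fun k => 1 / α k) atTop atTop := by
  have h1 : Tendsto α atTop (𝓝[>] 0) :=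
    tendsto_nhdsWithin_iff.mpr ⟨h.lim, Eventually.of_forall h.pos⟩
  simpa [Function.comp_def] using tendsto_inv_nhdsGT_zero.comp h1

/-- As 1/α_k ≥ 1/α_0, the additive step bound θ₀ becomes multiplicative. -/
theorem IsParameterSequence.succ_le (h : IsParameterSequence θ₀ α) (hθ : 0 ≤ θ₀) (k : ℕ) :
    1 / α (k + 1) ≤ (1 + θ₀ * α 0) * (1 / α k) := by
  have h1 := h.monotone (Nat.zero_le k)
  have h2 : 1 ≤ α 0 * (1 / α k) := by
    have := mul_le_mul_of_nonneg_left h1 (h.pos 0).le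
    simp only [mul_one_div_cancel (h.pos 0).ne'] at this
    exact this
  have h3 := mul_le_mul_of_nonneg_left h2 hθ
  linarith [(h.step k).2]

end Standing

/-! ### The discrepancy principle: from step bounds to the oracle inequality. -/

section Stopping

variable {X Y : Type*} [NormedAddCommGroup X] [InnerProductSpace ℝ X] [CompleteSpace X]
  [NormedAddCommGroup Y] [InnerProductSpace ℝ Y] [CompleteSpace Y]

/-- The oracle inequality from perturbation bounds for the Newton steps. -/
theorem oracle_of_residual {T : X →L[ℝ] Y} {S : ℕ → X →L[ℝ] Y} {s res : ℕ → ℝ} {e : ℕ → X}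
    {θ₀ δ ε τ C₃ : ℝ} {n : ℕ} (hτ : 1 < τ) (hT : ‖normalOp T‖ ≤ 1 / 2) (hs0 : 0 < s 0)
    (hmono : Monotone s) (hθ : 0 ≤ θ₀) (hstep : ∀ k, s (k + 1) - s k ≤ θ₀) (hδ : 0 ≤ δ)
    (hε : 0 ≤ ε) (hsmall : 16 * residualRatio θ₀ (s 0) * (1 + 1 / (τ - 1)) * ε ≤ 1)
    (h1 : ∀ k < n, ‖e (k + 1) - expOp (normalOp (S k)) (s k) (e 0)‖ ≤ ε * ‖e k‖ + δ * √(s k))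
    (h2 : ∀ k < n, ∀ t > 0, ‖expOp (normalOp (S k)) t (e 0) - expOp (normalOp T) t (e 0)‖
      ≤ ε * ‖e k‖)
    (h3 : ∀ k < n, res (k + 1) * √(s k) ≤ (δ + ‖S k (expOp (normalOp (S k)) (s k) (e 0))‖) * √(s k)
      + ε * (‖e k‖ + ‖e (k + 1)‖))
    (hlarge : ∀ k < n, τ * δ < res k) (hC₃ : 0 ≤ C₃) (h4 : ‖T (e n)‖ ≤ C₃ * δ) (l : ℕ) :
    ‖e n‖ ≤ oracleConst θ₀ (s 0) (1 / (τ - 1)) C₃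
      * (‖expOp (normalOp T) (s l) (e 0)‖ + δ * √(s l)) := by
  have hτ' : 0 < τ - 1 := by linarith
  have hspos : ∀ k, 0 < s k := fun k => hs0.trans_le (hmono (Nat.zero_le k))
  have hinv : 0 < 1 / (τ - 1) := by positivity
  -- One ε for both hypotheses: the recursion costs 2ε, the residual bound costs 2ε/(τ - 1).
  refine oracle_inequality (ε := 2 * (1 + 1 / (τ - 1)) * ε) hT hs0 hmono hθ hstep hδ
    (by positivity) (by linarith) (fun k hk => ?_) hinv.le hC₃ (fun k hk => ?_) h4 l
  · have h5 := norm_add_le (e (k + 1) - expOp (normalOp (S k)) (s k) (e 0))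
      (expOp (normalOp (S k)) (s k) (e 0) - expOp (normalOp T) (s k) (e 0))
    rw [sub_add_sub_cancel] at h5
    have h6 := h1 k hk
    have h7 := h2 k hk (s k) (hspos k)
    have h8 : 0 ≤ 1 / (τ - 1) * (ε * ‖e k‖) := by positivity
    linarith
  · have hk' : k < n := by omega
    have h5 := h3 k hk'
    have h6 := hlarge (k + 1) hk
    have hr : 0 < √(s k) := Real.sqrt_pos.mpr (hspos k)
    -- Half of the time is spent on smoothing S, which gives the factor 1/√s_k; the other half
    -- remains as the approximation error at s_k / 2.
    have h7 : ‖S k (expOp (normalOp (S k)) (s k) (e 0))‖ * √(s k)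
        ≤ ‖expOp (normalOp T) (s k / 2) (e 0)‖ + ε * ‖e k‖ := by
      have h8 : expOp (normalOp (S k)) (s k) (e 0)
          = expOp (normalOp (S k)) (s k / 2) (expOp (normalOp (S k)) (s k / 2) (e 0)) := by
        rw [← expOp_add_apply (isPositive_normalOp (S k)), add_halves]
      have h9 := norm_apply_expOp_le (S k) (half_pos (hspos k))
        (expOp (normalOp (S k)) (s k / 2) (e 0))
      have h10 : asymptoticC3 / √(s k / 2) ≤ 1 / √(s k) := by
        rw [Real.sqrt_div' _ two_pos.le, div_div_eq_mul_div]
        gcongr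
        have h11 : √2 ≤ 2 := by
          rw [Real.sqrt_le_left two_pos.le]; norm_num
        have := asymptoticC3_le_half
        have := asymptoticC3_pos
        nlinarith
      have h11 := norm_add_le (expOp (normalOp (S k)) (s k / 2) (e 0)
        - expOp (normalOp T) (s k / 2) (e 0)) (expOp (normalOp T) (s k / 2) (e 0))
      rw [sub_add_cancel] at h11
      have h12 := h2 k hk' (s k / 2) (half_pos (hspos k))
      rw [h8]
      calc _ ≤ 1 / √(s k) * ‖expOp (normalOp (S k)) (s k / 2) (e 0)‖ * √(s k) := by
            gcongr
            exact h9.trans (by gcongr)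
        _ = ‖expOp (normalOp (S k)) (s k / 2) (e 0)‖ := by field_simp
        _ ≤ _ := by linarith
    have h8 : (τ - 1) * (δ * √(s k)) ≤ ‖expOp (normalOp T) (s k / 2) (e 0)‖
        + 2 * ε * (‖e k‖ + ‖e (k + 1)‖) := by
      have h9 := mul_le_mul_of_nonneg_right h6.le hr.le
      have h10 : 0 ≤ ε * ‖e (k + 1)‖ := by positivity
      linarith
    have h9 : δ * √(s k) ≤ 1 / (τ - 1) * (‖expOp (normalOp T) (s k / 2) (e 0)‖
        + 2 * ε * (‖e k‖ + ‖e (k + 1)‖)) := by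
      rw [one_div_mul_eq_div, le_div_iff₀ hτ']
      linarith
    have h10 : 0 ≤ 2 * ε * (‖e k‖ + ‖e (k + 1)‖) := by positivity
    linarith

/-- The iteration stops inside the ball, and the error at the stopping index satisfies an oracle
inequality with the constant `C`. -/
def StopsWithOracle (α : ℕ → ℝ) (F : X → Y) (x₀ xd : X) (ρ τ δ D C : ℝ) (z : Y) : Prop :=
  ∃ n : ℕ, IsDiscrepancyIndex F (newtonIterate asymptoticFilter α F x₀ z) z τ δ n ∧
    (∀ j ≤ n, newtonIterate asymptoticFilter α F x₀ z j ∈ Metric.ball xd ρ) ∧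
    (‖newtonIterate asymptoticFilter α F x₀ z n - xd‖ = ‖x₀ - xd‖ ∨ δ ≤ D * ‖x₀ - xd‖) ∧
    ∀ l, ‖newtonIterate asymptoticFilter α F x₀ z n - xd‖
      ≤ C * (‖expOp (normalOp (fderiv ℝ F xd)) (1 / α l) (x₀ - xd)‖ + δ * √(1 / α l))

theorem StopsWithOracle.mono {α : ℕ → ℝ} {F : X → Y} {x₀ xd : X} {ρ τ δ D C b : ℝ} {z : Y}
    (h : StopsWithOracle α F x₀ xd ρ τ δ D C z)
    (hb : ∀ c : ℝ, (c = ‖x₀ - xd‖ ∨ δ ≤ D * ‖x₀ - xd‖) →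
      (∀ l, c ≤ C * (‖expOp (normalOp (fderiv ℝ F xd)) (1 / α l) (x₀ - xd)‖ + δ * √(1 / α l))) →
      c ≤ b) : StopsWithError asymptoticFilter α F x₀ xd ρ τ δ z b := by
  obtain ⟨n, h1, h2, h3, h4⟩ := h
  exact ⟨n, h1, h2, hb _ h3 h4⟩

/-- If the residual is small at some index up to which the iterates stay in the ball and satisfy the
perturbation bounds, then the iteration stops there at the latest and obeys the oracle
inequality. -/
theorem stopsWithOracle_of_bounds {D : Set X} {F : X → Y} {x₀ xd : X} {ρ β₀ α₀ θ₀ τ δ ε C₃ : ℝ}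
    {α : ℕ → ℝ} {z : Y} {m : ℕ} (hτ : 1 < τ) (hθ : 0 ≤ θ₀)
    (hα : IsParameterSequence θ₀ α) (hα0 : α 0 = α₀) (hstand : StandingConditions D F xd ρ β₀ α₀)
    (hδ : 0 < δ) (hz : ‖z - F xd‖ ≤ δ) (hε : 0 ≤ ε)
    (hsmall : 16 * residualRatio θ₀ (1 / α₀) * (1 + 1 / (τ - 1)) * ε ≤ 1)
    (hball : ∀ k ≤ m, newtonIterate asymptoticFilter α F x₀ z k ∈ Metric.ball xd ρ)
    (hm : ‖F (newtonIterate asymptoticFilter α F x₀ z m) - z‖ ≤ τ * δ)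
    (h1 : ∀ k < m, ‖(newtonIterate asymptoticFilter α F x₀ z (k + 1) - xd)
      - expOp (normalOp (fderiv ℝ F (newtonIterate asymptoticFilter α F x₀ z k))) (1 / α k)
        (x₀ - xd)‖ ≤ ε * ‖newtonIterate asymptoticFilter α F x₀ z k - xd‖ + δ * √(1 / α k))
    (h2 : ∀ k < m, ∀ t > 0,
      ‖expOp (normalOp (fderiv ℝ F (newtonIterate asymptoticFilter α F x₀ z k))) t (x₀ - xd)
        - expOp (normalOp (fderiv ℝ F xd)) t (x₀ - xd)‖
      ≤ ε * ‖newtonIterate asymptoticFilter α F x₀ z k - xd‖)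
    (h3 : ∀ k < m, ‖F (newtonIterate asymptoticFilter α F x₀ z (k + 1)) - z‖ * √(1 / α k)
      ≤ (δ + ‖fderiv ℝ F (newtonIterate asymptoticFilter α F x₀ z k)
        (expOp (normalOp (fderiv ℝ F (newtonIterate asymptoticFilter α F x₀ z k))) (1 / α k)
          (x₀ - xd))‖) * √(1 / α k)
      + ε * (‖newtonIterate asymptoticFilter α F x₀ z k - xd‖
        + ‖newtonIterate asymptoticFilter α F x₀ z (k + 1) - xd‖)) (hC₃ : 0 ≤ C₃)
    (h4 : ∀ n ≤ m, ‖F (newtonIterate asymptoticFilter α F x₀ z n) - z‖ ≤ τ * δ →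
      ‖fderiv ℝ F xd (newtonIterate asymptoticFilter α F x₀ z n - xd)‖ ≤ C₃ * δ) :
    StopsWithOracle α F x₀ xd ρ τ δ (√α₀ / (τ - 1))
      (oracleConst θ₀ (1 / α₀) (1 / (τ - 1)) C₃) z := by
  classical
  have hex : ∃ n, ‖F (newtonIterate asymptoticFilter α F x₀ z n) - z‖ ≤ τ * δ := ⟨m, hm⟩
  set n := Nat.find hex with hn
  have hnm : n ≤ m := Nat.find_min' hex hm
  have hlarge : ∀ j < n, τ * δ < ‖F (newtonIterate asymptoticFilter α F x₀ z j) - z‖ :=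
    fun j hj => not_le.mp (Nat.find_min hex hj)
  have hspec := Nat.find_spec hex
  refine ⟨n, ⟨hspec, hlarge⟩, fun j hj => hball j (hj.trans hnm), ?_, ?_⟩
  -- If index 0 does not stop the iteration, the initial residual exceeds τδ, yet it is at most δ +
  -- √α₀‖x₀ - xd‖; hence the bound on δ.
  · rcases Nat.eq_zero_or_pos n with h0 | h0
    · left
      rw [h0, newtonIterate]
    · right
      have h5 := hlarge 0 h0
      have h6 := hstand.norm_residual_le (hball 0 (Nat.zero_le _)) hz
      rw [newtonIterate] at h5 h6
      rw [div_mul_eq_mul_div, le_div_iff₀ (by linarith)]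
      have h7 : asymptoticC3 * (√α₀ * ‖x₀ - xd‖) ≤ 1 * (√α₀ * ‖x₀ - xd‖) := by
        gcongr
        linarith [asymptoticC3_le_half]
      linarith
  · have hα' : 1 / α 0 = 1 / α₀ := by rw [hα0]
    have hα₀ : 0 < α₀ := hα0 ▸ hα.pos 0
    have := oracle_of_residual (T := fderiv ℝ F xd)
      (S := fun k => fderiv ℝ F (newtonIterate asymptoticFilter α F x₀ z k))
      (s := fun k => 1 / α k)
      (res := fun k => ‖F (newtonIterate asymptoticFilter α F x₀ z k) - z‖)
      (e := fun k => newtonIterate asymptoticFilter α F x₀ z k - xd) (n := n) hτ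
      hstand.norm_normalOp_le (by rw [hα']; positivity) hα.monotone hθ (fun k => (hα.step k).2)
      hδ.le hε (by rw [hα']; exact hsmall) (fun k hk => h1 k (hk.trans_le hnm))
      (fun k hk => h2 k (hk.trans_le hnm)) (fun k hk => h3 k (hk.trans_le hnm)) hlarge hC₃
      (h4 n hnm hspec)
    rw [hα'] at this
    exact this

end Stopping

/-! ### One Newton step under (A5) and (A6). -/

section StructuralConditions

variable {X Y : Type*} [NormedAddCommGroup X] [InnerProductSpace ℝ X]
  [NormedAddCommGroup Y] [InnerProductSpace ℝ Y]
  {F : X → Y} {xd : X} {ρ K₀ K₁ K₂ : ℝ}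

open ContinuousLinearMap (adjoint)

/-- Along the segment both terms of (A6) reduce to the same product, so the remainder is small
relative to F'(x)(x - x†). -/
theorem DerivDifferenceBound.taylor_left (h : DerivDifferenceBound F xd ρ K₁ K₂) (hK₁ : 0 ≤ K₁)
    (hK₂ : 0 ≤ K₂) (hF : ∀ x ∈ Metric.ball xd ρ, DifferentiableAt ℝ F x)
    (hxd : xd ∈ Metric.ball xd ρ) {x : X} (hx : x ∈ Metric.ball xd ρ) :
    ‖F x - F xd - fderiv ℝ F x (x - xd)‖
      ≤ (K₁ + K₂) * ‖x - xd‖ * ‖fderiv ℝ F x (x - xd)‖ := by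
  refine norm_taylor_le hF hx _ fun t ht => ?_
  have hmem : xd + t • (x - xd) ∈ Metric.ball xd ρ :=
    (convex_ball xd ρ).add_smul_sub_mem hxd hx ht
  have h1 := h _ hmem x hx (x - xd)
  have h2 : xd + t • (x - xd) - x = (t - 1) • (x - xd) := by
    rw [sub_smul, one_smul]; abel
  have h3 : |t - 1| ≤ 1 := by rw [abs_le]; constructor <;> linarith [ht.1, ht.2]
  rw [h2, norm_smul, map_smul, norm_smul, Real.norm_eq_abs] at h1
  have h4 : 0 ≤ ‖x - xd‖ * ‖fderiv ℝ F x (x - xd)‖ := by positivity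
  have h5 := mul_le_mul_of_nonneg_right h3 (mul_nonneg (add_nonneg hK₁ hK₂) h4)
  linarith

theorem DerivDifferenceBound.taylor_right (h : DerivDifferenceBound F xd ρ K₁ K₂) (hK₁ : 0 ≤ K₁)
    (hK₂ : 0 ≤ K₂) (hF : ∀ x ∈ Metric.ball xd ρ, DifferentiableAt ℝ F x)
    (hxd : xd ∈ Metric.ball xd ρ) {x : X} (hx : x ∈ Metric.ball xd ρ) :
    ‖F x - F xd - fderiv ℝ F xd (x - xd)‖
      ≤ (K₁ + K₂) * ‖x - xd‖ * ‖fderiv ℝ F xd (x - xd)‖ := by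
  refine norm_taylor_le hF hx _ fun t ht => ?_
  have hmem : xd + t • (x - xd) ∈ Metric.ball xd ρ :=
    (convex_ball xd ρ).add_smul_sub_mem hxd hx ht
  have h1 := h _ hmem xd hxd (x - xd)
  rw [add_sub_cancel_left, norm_smul, map_smul, norm_smul, Real.norm_of_nonneg ht.1] at h1
  have h4 : 0 ≤ ‖x - xd‖ * ‖fderiv ℝ F xd (x - xd)‖ := by positivity
  have h5 := mul_le_mul_of_nonneg_right ht.2 (mul_nonneg (add_nonneg hK₁ hK₂) h4)
  linarith

variable [CompleteSpace X] [CompleteSpace Y]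

/-- With S = TR and T = SR' one has S*S - T*T = S*S(I - R') + (R - I)*T*T, the relative perturbation
required by `norm_expOp_sub_expOp_le`. -/
theorem RangeInvariance.norm_expOp_sub_le (h : RangeInvariance F xd ρ K₀)
    (hxd : xd ∈ Metric.ball xd ρ) {x : X} (hx : x ∈ Metric.ball xd ρ) {t : ℝ} (ht : 0 < t) (v : X) :
    ‖expOp (normalOp (fderiv ℝ F x)) t v - expOp (normalOp (fderiv ℝ F xd)) t v‖
      ≤ 8 * (K₀ * ‖x - xd‖) * ‖v‖ := by
  obtain ⟨R, hR, hR1⟩ := h x hx xd hxd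
  obtain ⟨R', hR', hR1'⟩ := h xd hxd x hx
  set S := fderiv ℝ F x
  set T := fderiv ℝ F xd
  rw [norm_sub_rev xd x] at hR1'
  refine (expOp (normalOp S) t - expOp (normalOp T) t).le_of_opNorm_le
    (norm_expOp_sub_expOp_le (P := ContinuousLinearMap.id ℝ X - R')
      (Q := adjoint (R - ContinuousLinearMap.id ℝ X)) (isPositive_normalOp S)
      (isPositive_normalOp T) ?_ hR1' ?_ ht) v
  · have hS : adjoint S = (adjoint R).comp (adjoint T) := by
      rw [hR, ContinuousLinearMap.adjoint_comp]
    have hid : adjoint (ContinuousLinearMap.id ℝ X) = ContinuousLinearMap.id ℝ X :=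
      ContinuousLinearMap.adjoint_id
    ext w
    have h1 : S (R' w) = T w := by rw [hR']; rfl
    have h2 : adjoint R (adjoint T (T w)) = adjoint S (T w) := by rw [hS]; rfl
    simp only [sub_apply, add_apply, ContinuousLinearMap.mul_def, ContinuousLinearMap.comp_apply,
      normalOp_apply, map_sub, hid, ContinuousLinearMap.id_apply, h1, h2]
    abel
  · rw [norm_adjoint_eq, norm_sub_rev]
    exact hR1

/-- The bounds produced by one Newton step under the structural conditions on the derivative. -/
theorem structural_step {x x' e₀ : X} {n : Y} {α δ γ η M Q s' θ : ℝ}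
    (hF : ∀ x ∈ Metric.ball xd ρ, DifferentiableAt ℝ F x) (hxd : xd ∈ Metric.ball xd ρ)
    (hK₀ : 0 ≤ K₀) (hK₁ : 0 ≤ K₁) (hK₂ : 0 ≤ K₂)
    (hRI : RangeInvariance F xd ρ K₀) (hDD : DerivDifferenceBound F xd ρ K₁ K₂)
    (hx : x ∈ Metric.ball xd ρ) (hα : 0 < α) (hη : (K₀ + K₁ + K₂) * ‖e₀‖ ≤ η)
    (hγ : 0 < γ) (hM : M = 2 * (1 + asymptoticC4 * γ)) (hMρ : M * ‖e₀‖ < ρ)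
    (hθ : 1 ≤ θ) (hQ : Q = (5 + 4 * γ) * θ) (hMη : M * η ≤ 1 / 2) (hMQη : 2 * M * Q * η ≤ 1)
    (hs : 1 / α ≤ s') (hs' : √s' ≤ θ * √(1 / α))
    (hxM : ‖x - xd‖ ≤ M * ‖e₀‖) (hxQ : ‖fderiv ℝ F xd (x - xd)‖ * √(1 / α) ≤ Q * ‖e₀‖)
    (hδ : 0 ≤ δ) (hδγ : δ * √(1 / α) ≤ γ * ‖e₀‖) (hn : ‖n‖ ≤ δ)
    (hx' : x' - xd = expOp (normalOp (fderiv ℝ F x)) (1 / α) e₀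
      - functionOf (asymptoticFilter α) (normalOp (fderiv ℝ F x)) (adjoint (fderiv ℝ F x)
        ((F x - F xd - fderiv ℝ F x (x - xd)) + n))) :
    ‖x' - xd‖ ≤ M * ‖e₀‖ ∧ ‖fderiv ℝ F xd (x' - xd)‖ * √s' ≤ Q * ‖e₀‖ ∧
    ‖(x' - xd) - expOp (normalOp (fderiv ℝ F x)) (1 / α) e₀‖
      ≤ 5 * Q * η * ‖x - xd‖ + δ * √(1 / α) ∧
    (∀ t > 0, ‖expOp (normalOp (fderiv ℝ F x)) t e₀ - expOp (normalOp (fderiv ℝ F xd)) t e₀‖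
      ≤ 5 * Q * η * ‖x - xd‖) ∧
    ‖F x' - F xd + n‖ * √(1 / α)
      ≤ (δ + ‖fderiv ℝ F x (expOp (normalOp (fderiv ℝ F x)) (1 / α) e₀)‖) * √(1 / α)
        + 5 * Q * η * (‖x - xd‖ + ‖x' - xd‖) := by
  set S := fderiv ℝ F x with hS
  set T := fderiv ℝ F xd with hT
  set E := expOp (normalOp S) (1 / α) e₀ with hE
  set N := F x - F xd - S (x - xd) with hN
  set r := √(1 / α) with hr
  have hr0 : 0 < r := Real.sqrt_pos.mpr (by positivity)
  set K := K₀ + K₁ + K₂ with hK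
  have hK0 : 0 ≤ K := by positivity
  have he0 := norm_nonneg e₀
  have hη0 : 0 ≤ η := le_trans (by positivity) hη
  have hc4 := asymptoticC4_pos
  have hc41 := asymptoticC4_le_one
  have hc3 := asymptoticC3_pos
  have hc31 := asymptoticC3_le_half
  have hM0 : 2 ≤ M := by
    have := mul_pos hc4 hγ
    linarith
  have hQ5 : 5 + 4 * γ ≤ Q := by
    rw [hQ]; exact le_mul_of_one_le_right (by positivity) hθ
  have hQ0 : 0 ≤ Q := by linarith
  have hKx : K * ‖x - xd‖ ≤ 1 / 2 := by
    have := mul_le_mul_of_nonneg_left hxM hK0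
    have := mul_le_mul_of_nonneg_left hη (by linarith : 0 ≤ M)
    linarith
  have hE0 : ‖E‖ ≤ ‖e₀‖ := norm_expOp_apply_le (isPositive_normalOp S) (by positivity) e₀
  have hSx : ‖S (x - xd)‖ ≤ 2 * ‖T (x - xd)‖ := by
    have h1 := hDD x hx xd hxd (x - xd)
    rw [← hS, ← hT] at h1
    have h2 := norm_add_le ((S - T) (x - xd)) (T (x - xd))
    rw [sub_apply, sub_add_cancel, ← sub_apply] at h2
    have h3 := mul_le_mul_of_nonneg_right hKx (norm_nonneg (T (x - xd)))
    have h4 : 0 ≤ K₀ * (‖x - xd‖ * ‖T (x - xd)‖) := by positivity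
    have h5 : K * ‖x - xd‖ * ‖T (x - xd)‖ = K₀ * (‖x - xd‖ * ‖T (x - xd)‖)
      + (K₁ * ‖x - xd‖ * ‖T (x - xd)‖ + K₂ * ‖T (x - xd)‖ * ‖x - xd‖) := by rw [hK]; ring
    linarith [norm_nonneg (T (x - xd))]
  have hSxr : ‖S (x - xd)‖ * r ≤ 2 * Q * ‖e₀‖ := by
    have := mul_le_mul_of_nonneg_right hSx hr0.le
    linarith
  have hNr : ‖N‖ * r ≤ 2 * Q * η * ‖x - xd‖ := by
    have h1 := hDD.taylor_left hK₁ hK₂ hF hxd hx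
    rw [← hS, ← hN] at h1
    calc ‖N‖ * r ≤ ((K₁ + K₂) * ‖x - xd‖ * ‖S (x - xd)‖) * r := by gcongr
      _ = (K₁ + K₂) * ‖x - xd‖ * (‖S (x - xd)‖ * r) := by ring
      _ ≤ K * ‖x - xd‖ * (2 * Q * ‖e₀‖) := by gcongr; linarith
      _ = 2 * Q * (K * ‖e₀‖) * ‖x - xd‖ := by ring
      _ ≤ _ := by gcongr
  have hNr1 : ‖N‖ * r ≤ ‖e₀‖ := by
    have h1 : 2 * Q * η * ‖x - xd‖ ≤ 2 * Q * η * (M * ‖e₀‖) := by gcongr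
    have h2 := mul_le_mul_of_nonneg_right hMQη he0
    linarith
  have hstep := norm_step_sub_le S hα hx' hn
  rw [← hr, ← hE] at hstep
  have hstep1 : ‖(x' - xd) - E‖ ≤ ‖N‖ * r + asymptoticC4 * (δ * r) := by
    have : asymptoticC4 * (‖N‖ * r) ≤ 1 * (‖N‖ * r) := by gcongr
    linarith
  -- The semigroup part and the remainder contribute at most ‖e₀‖ each and the noise c₄γ‖e₀‖. The
  -- sum is below M‖e₀‖.
  have hx'M : ‖x' - xd‖ ≤ M * ‖e₀‖ := by
    have h1 := norm_add_le ((x' - xd) - E) E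
    rw [sub_add_cancel] at h1
    have h2 := mul_le_mul_of_nonneg_left hδγ hc4.le
    have h3 : 0 ≤ asymptoticC4 * (γ * ‖e₀‖) := by positivity
    rw [hM]
    linarith
  have hx'ball : x' ∈ Metric.ball xd ρ := by
    rw [mem_ball_iff_norm]
    exact hx'M.trans_lt hMρ
  have hSE : ‖S E‖ * r ≤ 1 / 2 * ‖e₀‖ := by
    have h1 := norm_apply_expOp_le S (s := 1 / α) (by positivity) e₀
    rw [← hE, ← hr, div_mul_eq_mul_div, le_div_iff₀ hr0] at h1
    exact h1.trans (by gcongr)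
  have happ := norm_apply_step_add_le S hα hx' hn
  rw [← hE] at happ
  have hSx' : ‖S (x' - xd)‖ * r ≤ (2 + 2 * γ) * ‖e₀‖ := by
    have h1 := norm_sub_le (S (x' - xd) + n) n
    rw [add_sub_cancel_right] at h1
    have h2 : ‖S (x' - xd)‖ ≤ 2 * δ + ‖S E‖ + ‖N‖ := by linarith
    have h3 := mul_le_mul_of_nonneg_right h2 hr0.le
    linarith
  have hTS : ‖(T - S) (x' - xd)‖ * r ≤ (2 + 2 * γ) * η * ‖x - xd‖ + 2 * Q * η * ‖x' - xd‖ := by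
    have h1 := hDD xd hxd x hx (x' - xd)
    rw [← hS, ← hT, norm_sub_rev xd x, ← neg_sub x xd, map_neg, norm_neg] at h1
    calc _ ≤ (K₁ * ‖x - xd‖ * ‖S (x' - xd)‖ + K₂ * ‖S (x - xd)‖ * ‖x' - xd‖) * r := by gcongr
      _ = K₁ * ‖x - xd‖ * (‖S (x' - xd)‖ * r) + K₂ * (‖S (x - xd)‖ * r) * ‖x' - xd‖ := by ring
      _ ≤ K * ‖x - xd‖ * ((2 + 2 * γ) * ‖e₀‖) + K * (2 * Q * ‖e₀‖) * ‖x' - xd‖ := by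
        gcongr <;> linarith
      _ = (2 + 2 * γ) * (K * ‖e₀‖) * ‖x - xd‖ + 2 * Q * (K * ‖e₀‖) * ‖x' - xd‖ := by ring
      _ ≤ _ := by gcongr
  -- The smallness of η leaves the bound (5 + 4γ)‖e₀‖ at the old weight; θ pays for passing to the
  -- weight √s' of the next step, so Q reproduces itself.
  have hTx' : ‖T (x' - xd)‖ * √s' ≤ Q * ‖e₀‖ := by
    have h1 := norm_add_le ((T - S) (x' - xd)) (S (x' - xd))
    rw [sub_apply, sub_add_cancel, ← sub_apply] at h1
    have h2 := mul_le_mul_of_nonneg_right h1 hr0.le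
    have h3 : (2 + 2 * γ) * η * ‖x - xd‖ ≤ (2 + 2 * γ) * η * (M * ‖e₀‖) := by gcongr
    have h4 : 2 * Q * η * ‖x' - xd‖ ≤ 2 * Q * η * (M * ‖e₀‖) := by gcongr
    have h5 := mul_le_mul_of_nonneg_right hMη (mul_nonneg (by linarith : 0 ≤ 2 + 2 * γ) he0)
    have h6 := mul_le_mul_of_nonneg_right hMQη he0
    have h7 : ‖T (x' - xd)‖ * r ≤ (5 + 4 * γ) * ‖e₀‖ := by
      have := mul_nonneg hγ.le he0
      linarith
    calc _ ≤ ‖T (x' - xd)‖ * (θ * r) := by gcongr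
      _ = θ * (‖T (x' - xd)‖ * r) := by ring
      _ ≤ θ * ((5 + 4 * γ) * ‖e₀‖) := by gcongr
      _ = _ := by rw [hQ]; ring
  have hNT : ‖F x' - F xd - T (x' - xd)‖ * r ≤ Q * η * ‖x' - xd‖ := by
    have h1 := hDD.taylor_right hK₁ hK₂ hF hxd hx'ball
    rw [← hT] at h1
    have h2 : r ≤ √s' := Real.sqrt_le_sqrt hs
    calc _ ≤ ((K₁ + K₂) * ‖x' - xd‖ * ‖T (x' - xd)‖) * √s' := by gcongr
      _ = (K₁ + K₂) * ‖x' - xd‖ * (‖T (x' - xd)‖ * √s') := by ring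
      _ ≤ K * ‖x' - xd‖ * (Q * ‖e₀‖) := by gcongr; linarith
      _ = Q * (K * ‖e₀‖) * ‖x' - xd‖ := by ring
      _ ≤ _ := by gcongr
  have hxn := norm_nonneg (x - xd)
  have hx'n := norm_nonneg (x' - xd)
  have hηx : 0 ≤ η * ‖x - xd‖ := by positivity
  have hQηx : 5 * (η * ‖x - xd‖) ≤ Q * (η * ‖x - xd‖) := by gcongr; linarith
  refine ⟨hx'M, hTx', ?_, fun t ht => ?_, ?_⟩
  · have : asymptoticC4 * (δ * r) ≤ 1 * (δ * r) := by gcongr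
    linarith
  · refine (hRI.norm_expOp_sub_le hxd hx ht e₀).trans ?_
    calc 8 * (K₀ * ‖x - xd‖) * ‖e₀‖ ≤ 8 * (K * ‖x - xd‖) * ‖e₀‖ := by gcongr; linarith
      _ = 8 * (K * ‖e₀‖) * ‖x - xd‖ := by ring
      _ ≤ 8 * η * ‖x - xd‖ := by gcongr
      _ ≤ _ := by linarith
  -- Keeping S(x' - xd) + n together preserves the unit coefficient of δ; the remaining terms are of
  -- order η.
  · have h1 : F x' - F xd + n
        = (S (x' - xd) + n) + (T - S) (x' - xd) + (F x' - F xd - T (x' - xd)) := by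
      rw [sub_apply]; abel
    have h2 := norm_add_le ((S (x' - xd) + n) + (T - S) (x' - xd)) (F x' - F xd - T (x' - xd))
    have h3 := norm_add_le (S (x' - xd) + n) ((T - S) (x' - xd))
    rw [← h1] at h2
    have h4 : ‖F x' - F xd + n‖ ≤ (δ + ‖S E‖) + ‖N‖ + ‖(T - S) (x' - xd)‖
        + ‖F x' - F xd - T (x' - xd)‖ := by linarith
    have h5 := mul_le_mul_of_nonneg_right h4 hr0.le
    have h6 : (2 + 2 * γ) * (η * ‖x - xd‖) ≤ Q * (η * ‖x - xd‖) := by gcongr; linarith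
    have h7 : 0 ≤ Q * (η * ‖x' - xd‖) := by positivity
    linarith

end StructuralConditions

/-! ### Induction up to the noise-dominated index, structural case. -/

section StructuralStopping

variable {X Y : Type*} [NormedAddCommGroup X] [InnerProductSpace ℝ X] [CompleteSpace X]
  [NormedAddCommGroup Y] [InnerProductSpace ℝ Y] [CompleteSpace Y]

theorem IsParameterSequence.sqrt_succ_le {α : ℕ → ℝ} {θ₀ : ℝ} (h : IsParameterSequence θ₀ α)
    (hθ : 0 ≤ θ₀) (k : ℕ) : √(1 / α (k + 1)) ≤ √(1 + θ₀ * α 0) * √(1 / α k) := by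
  have h0 := h.pos 0
  rw [← Real.sqrt_mul (by positivity)]
  exact Real.sqrt_le_sqrt (h.succ_le hθ k)

/-- The discrepancy principle under the structural conditions on the derivative. -/
theorem stopsWithOracle_structural {D : Set X} {F : X → Y} {x₀ xd : X}
    {ρ β₀ α₀ θ₀ τ δ γ η M Q K₀ K₁ K₂ : ℝ} {α : ℕ → ℝ} {z : Y} (hτ : 1 < τ) (hθ : 0 ≤ θ₀)
    (hα : IsParameterSequence θ₀ α) (hα0 : α 0 = α₀) (hstand : StandingConditions D F xd ρ β₀ α₀)
    (hK₀ : 0 ≤ K₀) (hK₁ : 0 ≤ K₁) (hK₂ : 0 ≤ K₂) (hRI : RangeInvariance F xd ρ K₀)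
    (hDD : DerivDifferenceBound F xd ρ K₁ K₂) (hδ : 0 < δ) (hz : ‖z - F xd‖ ≤ δ)
    (hη0 : 0 ≤ η) (hη : (K₀ + K₁ + K₂) * ‖x₀ - xd‖ ≤ η)
    (hγ : 0 < γ) (hM : M = 2 * (1 + asymptoticC4 * γ)) (hMρ : M * ‖x₀ - xd‖ < ρ)
    (hQ : Q = (5 + 4 * γ) * √(1 + θ₀ * α₀)) (hMη : M * η ≤ 1 / 2) (hMQη : 2 * M * Q * η ≤ 1)
    (hsmall : 16 * residualRatio θ₀ (1 / α₀) * (1 + 1 / (τ - 1)) * (5 * Q * η) ≤ 1)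
    (hγτ : (asymptoticC3 + 10 * Q * M * η) * √(1 + θ₀ * α₀) ≤ (τ - 1) * γ) :
    StopsWithOracle α F x₀ xd ρ τ δ (√α₀ / (τ - 1))
      (oracleConst θ₀ (1 / α₀) (1 / (τ - 1)) (2 * (τ + 1))) z := by
  classical
  set x := newtonIterate asymptoticFilter α F x₀ z with hxdef
  have hx0 : x 0 = x₀ := rfl
  have hα₀ : 0 < α₀ := hα0 ▸ hα.pos 0
  have hc3 := asymptoticC3_pos
  have hc4 := asymptoticC4_pos
  have hϑ1 : 1 ≤ √(1 + θ₀ * α₀) := by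
    rw [Real.one_le_sqrt]
    have := mul_nonneg hθ hα₀.le
    linarith
  have hM2 : 2 ≤ M := by
    have := mul_pos hc4 hγ
    linarith
  have hQ5 : 5 + 4 * γ ≤ Q := by
    rw [hQ]; exact le_mul_of_one_le_right (by positivity) hϑ1
  have hQ0 : 0 ≤ Q := by linarith
  have he0 := norm_nonneg (x₀ - xd)
  have hx₀ball : x₀ ∈ Metric.ball xd ρ := by
    rw [mem_ball_iff_norm]
    refine lt_of_le_of_lt ?_ hMρ
    exact le_mul_of_one_le_left he0 (by linarith)
  have hn : ‖F xd - z‖ ≤ δ := by rwa [norm_sub_rev]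
  -- The first such index bounds the stopping index: before it the noise is too weak to disturb the
  -- invariants, and at it the residual is already at most τδ.
  have hex : ∃ k, γ * ‖x₀ - xd‖ ≤ δ * √(1 / α k) := by
    have h1 : Tendsto (fun k => δ * √(1 / α k)) atTop atTop :=
      (Real.tendsto_sqrt_atTop.comp hα.tendsto_atTop).const_mul_atTop hδ
    exact (h1.eventually_ge_atTop _).exists
  set m := Nat.find hex with hmdef
  have hm := Nat.find_spec hex
  have hlt : ∀ k < m, δ * √(1 / α k) ≤ γ * ‖x₀ - xd‖ := fun k hk =>
    (not_le.mp (Nat.find_min hex hk)).le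
  have hstepk : ∀ k < m, ‖x k - xd‖ ≤ M * ‖x₀ - xd‖ →
      ‖fderiv ℝ F xd (x k - xd)‖ * √(1 / α k) ≤ Q * ‖x₀ - xd‖ → _ := fun k hk hxM hxQ =>
    structural_step (x := x k) (x' := x (k + 1)) (e₀ := x₀ - xd) (n := F xd - z) (α := α k)
      (δ := δ) (s' := 1 / α (k + 1)) hstand.differentiableAt hstand.center_mem hK₀ hK₁ hK₂ hRI hDD
      (by rw [mem_ball_iff_norm]; exact hxM.trans_lt hMρ) (hα.pos k) hη hγ hM hMρ hϑ1 hQ hMη hMQη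
      (hα.monotone (Nat.le_succ k)) (by have := hα.sqrt_succ_le hθ k; rwa [hα0] at this) hxM hxQ
      hδ.le (hlt k hk) hn (newtonIterate_succ_sub α F x₀ xd z k)
  have hinv : ∀ k ≤ m, ‖x k - xd‖ ≤ M * ‖x₀ - xd‖ ∧
      ‖fderiv ℝ F xd (x k - xd)‖ * √(1 / α k) ≤ Q * ‖x₀ - xd‖ := by
    intro k
    induction k with
    | zero =>
      intro _
      rw [hx0, hα0]
      refine ⟨le_mul_of_one_le_left he0 (by linarith), ?_⟩
      have h1 := (fderiv ℝ F xd).le_of_opNorm_le (hstand.norm_deriv_le hstand.center_mem)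
        (x₀ - xd)
      have h2 : √α₀ * √(1 / α₀) = 1 := by
        rw [← Real.sqrt_mul hα₀.le, mul_one_div_cancel hα₀.ne', Real.sqrt_one]
      calc _ ≤ asymptoticC3 * √α₀ * ‖x₀ - xd‖ * √(1 / α₀) := by gcongr
        _ = asymptoticC3 * ‖x₀ - xd‖ * (√α₀ * √(1 / α₀)) := by ring
        _ = asymptoticC3 * ‖x₀ - xd‖ := by rw [h2, mul_one]
        _ ≤ _ := by
          gcongr
          linarith [asymptoticC3_le_half]
    | succ k ih =>
      intro hk
      obtain ⟨h1, h2⟩ := ih (by omega)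
      obtain ⟨h3, h4, -⟩ := hstepk k hk h1 h2
      exact ⟨h3, h4⟩
  have hball : ∀ k ≤ m, x k ∈ Metric.ball xd ρ := fun k hk => by
    rw [mem_ball_iff_norm]
    exact (hinv k hk).1.trans_lt hMρ
  have hsteps := fun k (hk : k < m) => hstepk k hk (hinv k hk.le).1 (hinv k hk.le).2
  have hres : ∀ k, F (x (k + 1)) - F xd + (F xd - z) = F (x (k + 1)) - z := fun k => by abel
  refine stopsWithOracle_of_bounds (m := m) hτ hθ hα hα0 hstand hδ hz
    (by positivity : 0 ≤ 5 * Q * η) hsmall hball ?_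
    (fun k hk => (hsteps k hk).2.2.1) (fun k hk => (hsteps k hk).2.2.2.1)
    (fun k hk => by
      have := (hsteps k hk).2.2.2.2
      rwa [hres] at this) (by linarith) ?_
  · rw [← hmdef] at hm
    rcases h0 : m with _ | k
    · have h1 := hstand.norm_residual_le hx₀ball hz
      rw [h0, hα0] at hm
      have h2 : √α₀ * √(1 / α₀) = 1 := by
        rw [← Real.sqrt_mul hα₀.le, mul_one_div_cancel hα₀.ne', Real.sqrt_one]
      have h3 : γ * (√α₀ * ‖x₀ - xd‖) ≤ δ := by
        calc _ = √α₀ * (γ * ‖x₀ - xd‖) := by ring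
          _ ≤ √α₀ * (δ * √(1 / α₀)) := by gcongr
          _ = δ * (√α₀ * √(1 / α₀)) := by ring
          _ = δ := by rw [h2, mul_one]
      have h4 : asymptoticC3 ≤ (τ - 1) * γ := by
        refine le_trans ?_ hγτ
        have h5 : 0 ≤ 10 * Q * M * η := by positivity
        exact (le_add_of_nonneg_right h5).trans (le_mul_of_one_le_right (by positivity) hϑ1)
      have h5 : asymptoticC3 * √α₀ * ‖x₀ - xd‖ ≤ (τ - 1) * δ := by
        calc _ = asymptoticC3 * (√α₀ * ‖x₀ - xd‖) := by ring
          _ ≤ (τ - 1) * γ * (√α₀ * ‖x₀ - xd‖) := by gcongr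
          _ = (τ - 1) * (γ * (√α₀ * ‖x₀ - xd‖)) := by ring
          _ ≤ _ := by
            gcongr
      change ‖F x₀ - z‖ ≤ τ * δ
      linarith
    · have hkm : k < m := by omega
      obtain ⟨hk1, -, -, -, h5⟩ := hsteps k hkm
      rw [hres] at h5
      rw [h0] at hm
      have hrpos : 0 < √(1 / α k) := Real.sqrt_pos.mpr (by have := hα.pos k; positivity)
      have h6 := norm_apply_expOp_le (fderiv ℝ F (x k)) (s := 1 / α k)
        (by have := hα.pos k; positivity) (x₀ - xd)
      rw [div_mul_eq_mul_div, le_div_iff₀ hrpos] at h6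
      have h7 : 5 * Q * η * (‖x k - xd‖ + ‖x (k + 1) - xd‖) ≤ 10 * Q * M * η * ‖x₀ - xd‖ := by
        calc _ ≤ 5 * Q * η * (M * ‖x₀ - xd‖ + M * ‖x₀ - xd‖) := by
              gcongr
              exact (hinv k hkm.le).1
          _ = _ := by ring
      have h8 : ‖F (x (k + 1)) - z‖ * √(1 / α k)
          ≤ δ * √(1 / α k) + (asymptoticC3 + 10 * Q * M * η) * ‖x₀ - xd‖ := by linarith
      -- The residual estimate uses α_k while the noise dominates at k + 1; the ratio of the weights
      -- is the factor √(1 + θ₀α₀) in `hγτ`.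
      have h9 : (asymptoticC3 + 10 * Q * M * η) * ‖x₀ - xd‖ ≤ (τ - 1) * (δ * √(1 / α k)) := by
        have h10 := hα.sqrt_succ_le hθ k
        rw [hα0] at h10
        have h11 : γ * ‖x₀ - xd‖ ≤ √(1 + θ₀ * α₀) * (δ * √(1 / α k)) := by
          calc _ ≤ _ := hm
            _ ≤ δ * (√(1 + θ₀ * α₀) * √(1 / α k)) := by gcongr
            _ = _ := by ring
        have hϑ0 : 0 < √(1 + θ₀ * α₀) := by linarith
        refine le_of_mul_le_mul_left ?_ hϑ0
        calc _ = (asymptoticC3 + 10 * Q * M * η) * √(1 + θ₀ * α₀) * ‖x₀ - xd‖ := by ring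
          _ ≤ (τ - 1) * γ * ‖x₀ - xd‖ := by gcongr
          _ = (τ - 1) * (γ * ‖x₀ - xd‖) := by ring
          _ ≤ (τ - 1) * (√(1 + θ₀ * α₀) * (δ * √(1 / α k))) := by
            gcongr
          _ = _ := by ring
      refine le_of_mul_le_mul_right ?_ hrpos
      linarith
  · intro n hnm hdisc
    have h1 := hDD.taylor_right hK₁ hK₂ hstand.differentiableAt hstand.center_mem (hball n hnm)
    change ‖F (x n) - z‖ ≤ τ * δ at hdisc
    change ‖fderiv ℝ F xd (x n - xd)‖ ≤ _
    -- The Taylor remainder is at most half of T e_n and is absorbed, so T e_n is controlled by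
    -- residual plus noise.
    have h2 : (K₁ + K₂) * ‖x n - xd‖ ≤ 1 / 2 := by
      calc _ ≤ (K₀ + K₁ + K₂) * (M * ‖x₀ - xd‖) := by
            gcongr
            · linarith
            · exact (hinv n hnm).1
        _ = M * ((K₀ + K₁ + K₂) * ‖x₀ - xd‖) := by ring
        _ ≤ M * η := by gcongr
        _ ≤ _ := hMη
    have h3 := mul_le_mul_of_nonneg_right h2 (norm_nonneg (fderiv ℝ F xd (x n - xd)))
    have h4 := norm_sub_norm_le (fderiv ℝ F xd (x n - xd)) (F (x n) - F xd)
    rw [norm_sub_rev (fderiv ℝ F xd (x n - xd)) (F (x n) - F xd)] at h4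
    have h5 := norm_add_le (F (x n) - z) (z - F xd)
    rw [sub_add_sub_cancel] at h5
    linarith

end StructuralStopping

/-! ### One Newton step for a Lipschitz derivative and an initial error in the range of T*. -/

section LipschitzDerivative

variable {X Y : Type*} [NormedAddCommGroup X] [InnerProductSpace ℝ X]
  [NormedAddCommGroup Y] [InnerProductSpace ℝ Y]
  {F : X → Y} {xd : X} {ρ L : ℝ}

open ContinuousLinearMap (adjoint)

theorem LipschitzDeriv.taylor_left (h : LipschitzDeriv F xd ρ L) (hL : 0 ≤ L)
    (hF : ∀ x ∈ Metric.ball xd ρ, DifferentiableAt ℝ F x)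
    (hxd : xd ∈ Metric.ball xd ρ) {x : X} (hx : x ∈ Metric.ball xd ρ) :
    ‖F x - F xd - fderiv ℝ F x (x - xd)‖ ≤ L * ‖x - xd‖ ^ 2 := by
  refine norm_taylor_le hF hx _ fun t ht => ?_
  have hmem : xd + t • (x - xd) ∈ Metric.ball xd ρ :=
    (convex_ball xd ρ).add_smul_sub_mem hxd hx ht
  have h2 : xd + t • (x - xd) - x = (t - 1) • (x - xd) := by
    rw [sub_smul, one_smul]; abel
  have h3 : |t - 1| ≤ 1 := by rw [abs_le]; constructor <;> linarith [ht.1, ht.2]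
  refine (ContinuousLinearMap.le_of_opNorm_le _ (h _ hmem x hx) _).trans ?_
  rw [h2, norm_smul, Real.norm_eq_abs]
  calc _ ≤ L * (1 * ‖x - xd‖) * ‖x - xd‖ := by gcongr
    _ = _ := by ring

theorem LipschitzDeriv.taylor_right (h : LipschitzDeriv F xd ρ L) (hL : 0 ≤ L)
    (hF : ∀ x ∈ Metric.ball xd ρ, DifferentiableAt ℝ F x)
    (hxd : xd ∈ Metric.ball xd ρ) {x : X} (hx : x ∈ Metric.ball xd ρ) :
    ‖F x - F xd - fderiv ℝ F xd (x - xd)‖ ≤ L * ‖x - xd‖ ^ 2 := by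
  refine norm_taylor_le hF hx _ fun t ht => ?_
  have hmem : xd + t • (x - xd) ∈ Metric.ball xd ρ :=
    (convex_ball xd ρ).add_smul_sub_mem hxd hx ht
  refine (ContinuousLinearMap.le_of_opNorm_le _ (h _ hmem xd hxd) _).trans ?_
  rw [add_sub_cancel_left, norm_smul, Real.norm_of_nonneg ht.1]
  calc _ ≤ L * (1 * ‖x - xd‖) * ‖x - xd‖ := by gcongr; exact ht.2
    _ = _ := by ring

variable [CompleteSpace X] [CompleteSpace Y]

/-- The error of a Newton step, tested against itself, when the initial error lies in the range of
the adjoint of a nearby operator. -/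
theorem norm_sq_step_le (S T : X →L[ℝ] Y) {α : ℝ} (hα : 0 < α) {e e₀ : X} {u p : Y} {a b : ℝ}
    (he₀ : e₀ = adjoint T u)
    (he : e = expOp (normalOp S) (1 / α) e₀
      - functionOf (asymptoticFilter α) (normalOp S) (adjoint S p))
    (ha : ‖u‖ + 1 / α * ‖p‖ ≤ a) (hb : ‖S - T‖ * ‖u‖ ≤ b) :
    ‖e‖ ^ 2 ≤ a * (‖T e‖ + ‖S - T‖ * ‖e‖) + b * ‖e‖ := by
  set s := 1 / α
  have hs : 0 ≤ s := by positivity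
  -- Up to a small v the new error is S*u' with bounded u', so ‖e‖² = ⟨Se, u'⟩ + ⟨e, v⟩.
  set u' := expOp (normalOp (adjoint S)) s u
    - functionOf (asymptoticFilter α) (normalOp (adjoint S)) p with hu'
  set v := expOp (normalOp S) s (adjoint T u - adjoint S u) with hv
  have he' : e = adjoint S u' + v := by
    rw [he, he₀, hu', hv, map_sub, map_sub, ← expOp_adjoint_apply, ← filter_adjoint_apply]
    abel
  have hu : ‖u'‖ ≤ a := by
    have h1 := norm_sub_le (expOp (normalOp (adjoint S)) s u)
      (functionOf (asymptoticFilter α) (normalOp (adjoint S)) p)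
    have h2 := norm_expOp_apply_le (isPositive_normalOp (adjoint S)) hs u
    have h3 := norm_filter_apply_le (isPositive_normalOp (adjoint S)) hα p
    linarith
  have hvb : ‖v‖ ≤ b := by
    have h1 := norm_expOp_apply_le (isPositive_normalOp S) hs (adjoint T u - adjoint S u)
    have h2 := norm_sub_adjoint S T u
    rw [norm_sub_rev] at h2
    linarith
  have hSe : ‖S e‖ ≤ ‖T e‖ + ‖S - T‖ * ‖e‖ := by
    have h1 := norm_add_le ((S - T) e) (T e)
    rw [sub_apply, sub_add_cancel, ← sub_apply] at h1
    have h2 := (S - T).le_opNorm e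
    linarith
  have h1 : ‖e‖ ^ 2 = inner ℝ (S e) u' + inner ℝ e v := by
    rw [← real_inner_self_eq_norm_sq, ← ContinuousLinearMap.adjoint_inner_right, ← inner_add_right,
      ← he']
  have h2 := real_inner_le_norm (S e) u'
  have h3 := real_inner_le_norm e v
  have h4 : ‖S e‖ * ‖u'‖ ≤ (‖T e‖ + ‖S - T‖ * ‖e‖) * a := by gcongr
  have h5 : ‖e‖ * ‖v‖ ≤ ‖e‖ * b := by gcongr
  linarith

/-- The bounds produced by one Newton step for a Lipschitz continuous derivative. -/
theorem lipschitz_step {x x' e₀ : X} {u n : Y} {α δ γ η Q s' θ : ℝ} (hL : 0 ≤ L)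
    (hF : ∀ x ∈ Metric.ball xd ρ, DifferentiableAt ℝ F x) (hxd : xd ∈ Metric.ball xd ρ)
    (hLip : LipschitzDeriv F xd ρ L) (hρ : 0 < ρ) (hα : 0 < α) (he₀ : e₀ = adjoint (fderiv ℝ F xd) u)
    (he₀ρ : 4 * ‖e₀‖ < ρ) (hη : L * ‖u‖ ≤ η) (hγ : 0 < γ) (hθ : 1 ≤ θ) (hQ : Q = (3 + γ) * θ)
    (hQη : 16 * Q ^ 2 * η ≤ 1) (hs : 1 / α ≤ s') (hs' : √s' ≤ θ * √(1 / α))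
    (hxρ : ‖x - xd‖ ≤ ρ / 2) (hxQ : ‖x - xd‖ * √(1 / α) ≤ Q * ‖u‖)
    (hδ : 0 ≤ δ) (hδγ : δ * (1 / α) ≤ γ * ‖u‖) (hδρ : ‖u‖ * δ ≤ η * ρ ^ 2) (hn : ‖n‖ ≤ δ)
    (hx' : x' - xd = expOp (normalOp (fderiv ℝ F x)) (1 / α) e₀
      - functionOf (asymptoticFilter α) (normalOp (fderiv ℝ F x)) (adjoint (fderiv ℝ F x)
        ((F x - F xd - fderiv ℝ F x (x - xd)) + n))) :
    ‖x' - xd‖ ≤ ρ / 2 ∧ ‖x' - xd‖ * √s' ≤ Q * ‖u‖ ∧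
    ‖(x' - xd) - expOp (normalOp (fderiv ℝ F x)) (1 / α) e₀‖
      ≤ 8 * Q * η * ‖x - xd‖ + δ * √(1 / α) ∧
    (∀ t > 0, ‖expOp (normalOp (fderiv ℝ F x)) t e₀ - expOp (normalOp (fderiv ℝ F xd)) t e₀‖
      ≤ 8 * Q * η * ‖x - xd‖) ∧
    ‖F x' - F xd + n‖ * √(1 / α)
      ≤ (δ + ‖fderiv ℝ F x (expOp (normalOp (fderiv ℝ F x)) (1 / α) e₀)‖) * √(1 / α)
        + 8 * Q * η * (‖x - xd‖ + ‖x' - xd‖) ∧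
    ‖F x' - F xd + n‖ * (1 / α) ≤ δ * (1 / α) + 3 * ‖u‖ ∧
    ‖x' - xd‖ ^ 2 ≤ Q * ‖u‖ * ‖fderiv ℝ F xd (x' - xd)‖
      + Q * η * ‖x - xd‖ * ‖x' - xd‖ := by
  have hx : x ∈ Metric.ball xd ρ := by
    rw [mem_ball_iff_norm]; linarith
  set S := fderiv ℝ F x with hS
  set T := fderiv ℝ F xd with hT
  set E := expOp (normalOp S) (1 / α) e₀ with hE
  set N := F x - F xd - S (x - xd) with hN
  set r := √(1 / α) with hr
  have hr0 : 0 < r := Real.sqrt_pos.mpr (by positivity)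
  have hr2 : 1 / α = r * r := (Real.mul_self_sqrt (by positivity)).symm
  have hrs : r ≤ √s' := Real.sqrt_le_sqrt hs
  have hu0 := norm_nonneg u
  have he := norm_nonneg (x - xd)
  have he' := norm_nonneg (x' - xd)
  have hη0 : 0 ≤ η := le_trans (by positivity) hη
  have hc4 := asymptoticC4_pos
  have hc41 := asymptoticC4_le_one
  have hc3 := asymptoticC3_pos
  have hc31 := asymptoticC3_le_half
  have hQ3 : 3 + γ ≤ Q := by
    rw [hQ]; exact le_mul_of_one_le_right (by positivity) hθ
  have hQ0 : 0 ≤ Q := by linarith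
  have hQη1 : 48 * (Q * η) ≤ 1 := by
    have h1 : 0 ≤ Q * η := by positivity
    have h2 : 0 ≤ γ * (Q * η) := by positivity
    have h3 := mul_le_mul_of_nonneg_right hQ3 h1
    linarith
  have hγη : 64 * (γ * η) ≤ 1 := by
    have h1 : (3 + γ) * (3 + γ) * η ≤ Q * Q * η := by gcongr
    have h2 : 0 ≤ γ * γ * η := by positivity
    have h3 : 0 ≤ γ * η := by positivity
    linarith
  have hηQ : η ≤ Q * η := le_mul_of_one_le_left hη0 (by linarith)
  have hST : ‖S - T‖ ≤ L * ‖x - xd‖ := hLip x hx xd hxd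
  have hSTu : ‖S - T‖ * ‖u‖ ≤ η * ‖x - xd‖ := by
    calc _ ≤ L * ‖x - xd‖ * ‖u‖ := by gcongr
      _ = L * ‖u‖ * ‖x - xd‖ := by ring
      _ ≤ _ := by gcongr
  have hSTr : ‖S - T‖ * r ≤ Q * η := by
    calc _ ≤ L * ‖x - xd‖ * r := by gcongr
      _ = L * (‖x - xd‖ * r) := by ring
      _ ≤ L * (Q * ‖u‖) := by gcongr
      _ = Q * (L * ‖u‖) := by ring
      _ ≤ _ := by gcongr
  have hNr : ‖N‖ * r ≤ Q * η * ‖x - xd‖ := by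
    have h1 := hLip.taylor_left hL hF hxd hx
    rw [← hS, ← hN] at h1
    calc ‖N‖ * r ≤ L * ‖x - xd‖ ^ 2 * r := by gcongr
      _ = L * (‖x - xd‖ * r) * ‖x - xd‖ := by ring
      _ ≤ L * (Q * ‖u‖) * ‖x - xd‖ := by gcongr
      _ = Q * (L * ‖u‖) * ‖x - xd‖ := by ring
      _ ≤ _ := by gcongr
  -- The remainder is quadratic in the invariant bound Q‖u‖; this is where smallness of Q²η is
  -- needed.
  have hQQη : Q * η * (Q * ‖u‖) ≤ 1 / 16 * ‖u‖ := by
    have := mul_le_mul_of_nonneg_right hQη hu0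
    linarith
  have hNs : ‖N‖ * (1 / α) ≤ 1 / 16 * ‖u‖ := by
    calc _ = ‖N‖ * r * r := by rw [hr2]; ring
      _ ≤ Q * η * ‖x - xd‖ * r := by gcongr
      _ = Q * η * (‖x - xd‖ * r) := by ring
      _ ≤ Q * η * (Q * ‖u‖) := by gcongr
      _ ≤ _ := hQQη
  -- Passing from T*u to S*u makes the smoothing of S available; the difference is at most η‖x -
  -- x†‖.
  have hErep : E = expOp (normalOp S) (1 / α) (adjoint S u)
      + expOp (normalOp S) (1 / α) (adjoint T u - adjoint S u) := by
    rw [hE, he₀, ← map_add, add_sub_cancel]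
  have hTSu : ‖adjoint T u - adjoint S u‖ ≤ η * ‖x - xd‖ := by
    rw [norm_sub_rev]
    exact (norm_sub_adjoint S T u).trans hSTu
  have hηxr : η * ‖x - xd‖ * r ≤ 1 / 48 * ‖u‖ := by
    have h1 := mul_le_mul_of_nonneg_left hxQ hη0
    have h2 := mul_le_mul_of_nonneg_right hQη1 hu0
    linarith
  have hEr : ‖E‖ * r ≤ ‖u‖ := by
    have h1 := norm_expOp_adjoint_le S (s := 1 / α) (by positivity) u
    rw [← hr, div_mul_eq_mul_div, le_div_iff₀ hr0] at h1
    have h2 := norm_expOp_apply_le (isPositive_normalOp S) (s := 1 / α) (by positivity)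
      (adjoint T u - adjoint S u)
    have h3 := norm_add_le (expOp (normalOp S) (1 / α) (adjoint S u))
      (expOp (normalOp S) (1 / α) (adjoint T u - adjoint S u))
    rw [← hErep] at h3
    have h4 := mul_le_mul_of_nonneg_right (h3.trans (add_le_add_right (h2.trans hTSu) _)) hr0.le
    have h5 : asymptoticC3 * ‖u‖ ≤ 1 / 2 * ‖u‖ := by gcongr
    linarith
  have hstep := norm_step_sub_le S hα hx' hn
  rw [← hr, ← hE] at hstep
  have hstep1 : ‖(x' - xd) - E‖ ≤ ‖N‖ * r + δ * r := by
    refine hstep.trans ?_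
    calc _ ≤ 1 * r * (‖N‖ + δ) := by gcongr
      _ = _ := by ring
  have hx'E : ‖x' - xd‖ ≤ ‖E‖ + (‖N‖ * r + δ * r) := by
    have h1 := norm_add_le ((x' - xd) - E) E
    rw [sub_add_cancel] at h1
    linarith
  have hx'r : ‖x' - xd‖ * r ≤ (3 + γ) * ‖u‖ := by
    have h1 := mul_le_mul_of_nonneg_right hx'E hr0.le
    have h2 : ‖N‖ * r * r = ‖N‖ * (1 / α) := by rw [hr2]; ring
    have h3 : δ * r * r = δ * (1 / α) := by rw [hr2]; ring
    linarith
  have hx'Q : ‖x' - xd‖ * √s' ≤ Q * ‖u‖ := by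
    calc _ ≤ ‖x' - xd‖ * (θ * r) := by gcongr
      _ = θ * (‖x' - xd‖ * r) := by ring
      _ ≤ θ * ((3 + γ) * ‖u‖) := by gcongr
      _ = _ := by rw [hQ]; ring
  have hx'rQ : ‖x' - xd‖ * r ≤ Q * ‖u‖ := hx'r.trans (by gcongr)
  have hx'ρ : ‖x' - xd‖ ≤ ρ / 2 := by
    have h1 : ‖E‖ ≤ ‖e₀‖ := norm_expOp_apply_le (isPositive_normalOp S) (by positivity) e₀
    have h2 : Q * η * ‖x - xd‖ ≤ 1 / 48 * (ρ / 2) := by gcongr; linarith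
    -- Here (δr)² = δ·δ/α ≤ γ‖u‖δ ≤ γηρ² ≤ ρ²/64: smallness of ‖u‖δ relative to ρ² keeps the iterate
    -- in the ball.
    have h3 : δ * r ≤ ρ / 8 := by
      refine le_of_sq_le_sq ?_ (by positivity)
      have h4 := mul_le_mul_of_nonneg_left hδγ hδ
      have h5 := mul_le_mul_of_nonneg_left hδρ hγ.le
      have h6 := mul_le_mul_of_nonneg_right hγη (sq_nonneg ρ)
      rw [hr2] at h4
      linarith
    linarith
  have hx'ball : x' ∈ Metric.ball xd ρ := by
    rw [mem_ball_iff_norm]; linarith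
  -- On the range of S* the operator S is smoothed twice, so the linear residual decays like α
  -- instead of √α.
  have hSEs : ‖S E‖ * (1 / α) ≤ 2 * ‖u‖ := by
    have h1 := norm_apply_expOp_adjoint_le S (s := 1 / α) (by positivity) u
    have h2 := norm_apply_expOp_le S (s := 1 / α) (by positivity) (adjoint T u - adjoint S u)
    rw [one_div_one_div] at h1
    rw [← hr, div_mul_eq_mul_div, le_div_iff₀ hr0] at h2
    have h3 := norm_add_le (S (expOp (normalOp S) (1 / α) (adjoint S u)))
      (S (expOp (normalOp S) (1 / α) (adjoint T u - adjoint S u)))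
    rw [← map_add, ← hErep] at h3
    have h4 : asymptoticC3 * ‖adjoint T u - adjoint S u‖ ≤ 1 * (η * ‖x - xd‖) := by
      gcongr; linarith
    have h5 := mul_le_mul_of_nonneg_right h3 (show 0 ≤ 1 / α by positivity)
    have h6 := mul_le_mul_of_nonneg_right h1 (show 0 ≤ 1 / α by positivity)
    have h7 : α * ‖u‖ * (1 / α) = ‖u‖ := by field_simp
    have h8 : ‖S (expOp (normalOp S) (1 / α) (adjoint T u - adjoint S u))‖ * (1 / α)
        ≤ η * ‖x - xd‖ * r := by
      set W := S (expOp (normalOp S) (1 / α) (adjoint T u - adjoint S u))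
      calc _ = ‖W‖ * r * r := by rw [hr2]; ring
        _ ≤ η * ‖x - xd‖ * r := mul_le_mul_of_nonneg_right (by linarith) hr0.le
    linarith
  have happ := norm_apply_step_add_le S hα hx' hn
  rw [← hE] at happ
  have hres : ‖F x' - F xd + n‖
      ≤ L * ‖x' - xd‖ ^ 2 + ‖S - T‖ * ‖x' - xd‖ + (δ + ‖S E‖ + ‖N‖) := by
    have h1 := hLip.taylor_right hL hF hxd hx'ball
    rw [← hT] at h1
    have h2 := (S - T).le_opNorm (x' - xd)
    have h3 : F x' - F xd + n = (F x' - F xd - T (x' - xd)) - (S - T) (x' - xd)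
        + (S (x' - xd) + n) := by rw [sub_apply]; abel
    have h4 := norm_add_le ((F x' - F xd - T (x' - xd)) - (S - T) (x' - xd)) (S (x' - xd) + n)
    have h5 := norm_sub_le (F x' - F xd - T (x' - xd)) ((S - T) (x' - xd))
    rw [h3]
    linarith
  have hLx' : L * ‖x' - xd‖ ^ 2 * r ≤ Q * η * ‖x' - xd‖ := by
    calc _ = L * (‖x' - xd‖ * r) * ‖x' - xd‖ := by ring
      _ ≤ L * (Q * ‖u‖) * ‖x' - xd‖ := by gcongr
      _ = Q * (L * ‖u‖) * ‖x' - xd‖ := by ring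
      _ ≤ _ := by gcongr
  have hSTx' : ‖S - T‖ * ‖x' - xd‖ * r ≤ Q * η * ‖x' - xd‖ := by
    have := mul_le_mul_of_nonneg_right hSTr he'
    linarith
  have hresr := mul_le_mul_of_nonneg_right hres hr0.le
  have hQe : 0 ≤ Q * η * ‖x - xd‖ := by positivity
  have hQe' : 0 ≤ Q * η * ‖x' - xd‖ := by positivity
  refine ⟨hx'ρ, hx'Q, by linarith, fun t ht => ?_, by linarith, ?_, ?_⟩
  · rw [he₀]
    have h1 := norm_expOp_adjoint_sub_le S T u ht
    have h2 := mul_le_mul_of_nonneg_right hηQ he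
    linarith
  · have h1 := mul_le_mul_of_nonneg_right hres (show 0 ≤ 1 / α by positivity)
    have h2 : Q * η * (‖x' - xd‖ * r) ≤ Q * η * (Q * ‖u‖) := by gcongr
    have h3 : L * ‖x' - xd‖ ^ 2 * (1 / α) ≤ 1 / 16 * ‖u‖ := by
      have := mul_le_mul_of_nonneg_right hLx' hr0.le
      rw [hr2]
      linarith
    have h4 : ‖S - T‖ * ‖x' - xd‖ * (1 / α) ≤ 1 / 16 * ‖u‖ := by
      have := mul_le_mul_of_nonneg_right hSTx' hr0.le
      rw [hr2]
      linarith
    linarith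
  · have h1 : ‖u‖ + 1 / α * ‖N + n‖ ≤ (2 + γ) * ‖u‖ := by
      have h2 : 1 / α * ‖N + n‖ ≤ 1 / α * (‖N‖ + δ) := by
        gcongr
        exact (norm_add_le _ _).trans (by linarith)
      linarith
    have h2 := norm_sq_step_le S T hα he₀ hx' h1 hSTu
    have h3 : (2 + γ) * ‖u‖ * (‖S - T‖ * ‖x' - xd‖)
        ≤ (2 + γ) * (η * ‖x - xd‖) * ‖x' - xd‖ := by
      calc _ = (2 + γ) * (‖S - T‖ * ‖u‖) * ‖x' - xd‖ := by ring
        _ ≤ _ := by gcongr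
    have h4 : (2 + γ) * ‖u‖ * ‖T (x' - xd)‖ ≤ Q * ‖u‖ * ‖T (x' - xd)‖ := by
      gcongr; linarith
    have h5 : (3 + γ) * (η * ‖x - xd‖ * ‖x' - xd‖) ≤ Q * (η * ‖x - xd‖ * ‖x' - xd‖) := by
      gcongr
    linarith

end LipschitzDerivative

/-! ### Induction up to the noise-dominated index, Lipschitz case. -/

section LipschitzStopping

variable {X Y : Type*} [NormedAddCommGroup X] [InnerProductSpace ℝ X] [CompleteSpace X]
  [NormedAddCommGroup Y] [InnerProductSpace ℝ Y] [CompleteSpace Y]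

open ContinuousLinearMap (adjoint)

/-- An exact initial guess meets the discrepancy at index 0. It is treated apart because the sign of
L is read off from the Lipschitz bound at two distinct points. -/
theorem stopsWithOracle_self {D : Set X} {F : X → Y} {xd : X} {ρ β₀ α₀ θ₀ τ δ C₃ : ℝ}
    {α : ℕ → ℝ} {z : Y} (hτ : 1 < τ) (hθ : 0 ≤ θ₀)
    (hα : IsParameterSequence θ₀ α) (hα0 : α 0 = α₀) (hstand : StandingConditions D F xd ρ β₀ α₀)
    (hδ : 0 < δ) (hz : ‖z - F xd‖ ≤ δ) (hC₃ : 0 ≤ C₃) :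
    StopsWithOracle α F xd xd ρ τ δ (√α₀ / (τ - 1))
      (oracleConst θ₀ (1 / α₀) (1 / (τ - 1)) C₃) z := by
  refine stopsWithOracle_of_bounds (m := 0) (ε := 0) hτ hθ hα hα0 hstand hδ hz le_rfl
    (by simp) (fun k hk => ?_) ?_ (fun k hk => absurd hk (Nat.not_lt_zero k))
    (fun k hk => absurd hk (Nat.not_lt_zero k)) (fun k hk => absurd hk (Nat.not_lt_zero k)) hC₃
    (fun n hn _ => ?_)
  · rw [Nat.le_zero.mp hk, newtonIterate]
    exact hstand.center_mem
  · rw [newtonIterate, norm_sub_rev]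
    exact hz.trans (le_mul_of_one_le_left hδ.le hτ.le)
  · rw [Nat.le_zero.mp hn, newtonIterate, sub_self, map_zero, norm_zero]
    positivity

/-- The discrepancy principle for a Lipschitz continuous derivative and an initial error in the
range of the adjoint. -/
theorem stopsWithOracle_lipschitz {D : Set X} {F : X → Y} {x₀ xd : X} {u : Y}
    {ρ β₀ α₀ θ₀ τ δ γ η Q L : ℝ} {α : ℕ → ℝ} {z : Y} (hτ : 1 < τ) (hθ : 0 ≤ θ₀)
    (hα : IsParameterSequence θ₀ α) (hα0 : α 0 = α₀) (hstand : StandingConditions D F xd ρ β₀ α₀)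
    (hLip : LipschitzDeriv F xd ρ L) (he₀ρ : 4 * ‖x₀ - xd‖ < ρ)
    (hu : x₀ - xd = adjoint (fderiv ℝ F xd) u) (hη : L * ‖u‖ ≤ η)
    (hδ : 0 < δ) (hδρ : ‖u‖ * δ ≤ η * ρ ^ 2) (hz : ‖z - F xd‖ ≤ δ)
    (hγ : (τ - 1) * γ = 3 * (1 + θ₀ * α₀)) (hQ : Q = (3 + γ) * √(1 + θ₀ * α₀))
    (hη0 : 0 ≤ η) (hQη : 16 * Q ^ 2 * η ≤ 1)
    (hsmall : 16 * residualRatio θ₀ (1 / α₀) * (1 + 1 / (τ - 1)) * (8 * Q * η) ≤ 1) :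
    StopsWithOracle α F x₀ xd ρ τ δ (√α₀ / (τ - 1))
      (oracleConst θ₀ (1 / α₀) (1 / (τ - 1)) (2 * τ + 3)) z := by
  classical
  rcases eq_or_ne x₀ xd with rfl | hne
  · exact stopsWithOracle_self hτ hθ hα hα0 hstand hδ hz (by linarith)
  set x := newtonIterate asymptoticFilter α F x₀ z with hxdef
  set T := fderiv ℝ F xd with hT
  have hx0 : x 0 = x₀ := rfl
  have hα₀ : 0 < α₀ := hα0 ▸ hα.pos 0
  have hρ := hstand.radius_pos
  have hc3 := asymptoticC3_pos
  have hc31 := asymptoticC3_le_half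
  have he0 := norm_nonneg (x₀ - xd)
  have hu0 := norm_nonneg u
  have hx₀ball : x₀ ∈ Metric.ball xd ρ := by
    rw [mem_ball_iff_norm]; linarith
  have hL : 0 ≤ L := by
    have h1 := (norm_nonneg _).trans (hLip x₀ hx₀ball xd hstand.center_mem)
    exact nonneg_of_mul_nonneg_left h1 (norm_pos_iff.mpr (sub_ne_zero.mpr hne))
  have hτ1 : 0 < τ - 1 := by linarith
  have hϑ1 : 1 ≤ √(1 + θ₀ * α₀) := by
    rw [Real.one_le_sqrt]
    have := mul_nonneg hθ hα₀.le
    linarith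
  have hγ3 : 3 ≤ (τ - 1) * γ := by
    have := mul_nonneg hθ hα₀.le
    linarith
  have hγ0 : 0 < γ := pos_of_mul_pos_right (by linarith : 0 < (τ - 1) * γ) hτ1.le
  have hQ3 : 3 + γ ≤ Q := by
    rw [hQ]; exact le_mul_of_one_le_right (by positivity) hϑ1
  have hQ0 : 0 ≤ Q := by linarith
  have hQη0 : 0 ≤ Q * η := by positivity
  have hQη1 : 48 * (Q * η) ≤ 1 := by
    have h2 : 0 ≤ γ * (Q * η) := by positivity
    have h3 := mul_le_mul_of_nonneg_right hQ3 hQη0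
    linarith
  have hγη : γ * η ≤ Q * η := by gcongr; linarith
  have hηQ : η ≤ Q * η := le_mul_of_one_le_left hη0 (by linarith)
  have hα₀r : √α₀ * √(1 / α₀) = 1 := by
    rw [← Real.sqrt_mul hα₀.le, mul_one_div_cancel hα₀.ne', Real.sqrt_one]
  have he₀u : ‖x₀ - xd‖ ≤ asymptoticC3 * √α₀ * ‖u‖ := by
    rw [hu]
    refine (adjoint T).le_of_opNorm_le ?_ u
    rw [norm_adjoint_eq]
    exact hstand.norm_deriv_le hstand.center_mem
  have hn : ‖F xd - z‖ ≤ δ := by rwa [norm_sub_rev]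
  -- Noise is now measured against u with the weight 1/α, matching the faster residual decay on the
  -- range of T*.
  have hex : ∃ k, γ * ‖u‖ ≤ δ * (1 / α k) :=
    ((hα.tendsto_atTop.const_mul_atTop hδ).eventually_ge_atTop _).exists
  set m := Nat.find hex with hmdef
  have hm := Nat.find_spec hex
  have hlt : ∀ k < m, δ * (1 / α k) ≤ γ * ‖u‖ := fun k hk =>
    (not_le.mp (Nat.find_min hex hk)).le
  have hstepk : ∀ k < m, ‖x k - xd‖ ≤ ρ / 2 → ‖x k - xd‖ * √(1 / α k) ≤ Q * ‖u‖ → _ :=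
    fun k hk hxρ hxQ => lipschitz_step (x := x k) (x' := x (k + 1)) (e₀ := x₀ - xd)
      (n := F xd - z) (α := α k) (δ := δ) (s' := 1 / α (k + 1)) hL hstand.differentiableAt
      hstand.center_mem hLip hρ (hα.pos k) hu he₀ρ hη hγ0 hϑ1 hQ hQη
      (hα.monotone (Nat.le_succ k)) (by have := hα.sqrt_succ_le hθ k; rwa [hα0] at this) hxρ hxQ
      hδ.le (hlt k hk) hδρ hn (newtonIterate_succ_sub α F x₀ xd z k)
  have hinv : ∀ k ≤ m, ‖x k - xd‖ ≤ ρ / 2 ∧ ‖x k - xd‖ * √(1 / α k) ≤ Q * ‖u‖ := by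
    intro k
    induction k with
    | zero =>
      intro _
      rw [hx0, hα0]
      refine ⟨by linarith, ?_⟩
      calc _ ≤ asymptoticC3 * √α₀ * ‖u‖ * √(1 / α₀) := by gcongr
        _ = asymptoticC3 * ‖u‖ * (√α₀ * √(1 / α₀)) := by ring
        _ = asymptoticC3 * ‖u‖ := by rw [hα₀r, mul_one]
        _ ≤ _ := by
          gcongr
          linarith
    | succ k ih =>
      intro hk
      obtain ⟨h1, h2⟩ := ih (by omega)
      obtain ⟨h3, h4, -⟩ := hstepk k hk h1 h2
      exact ⟨h3, h4⟩
  have hball : ∀ k ≤ m, x k ∈ Metric.ball xd ρ := fun k hk => by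
    rw [mem_ball_iff_norm]
    exact (hinv k hk).1.trans_lt (by linarith)
  have hsteps := fun k (hk : k < m) => hstepk k hk (hinv k hk.le).1 (hinv k hk.le).2
  have hres : ∀ k, F (x (k + 1)) - F xd + (F xd - z) = F (x (k + 1)) - z := fun k => by abel
  have h1 := fun k (hk : k < m) => (hsteps k hk).2.2.1
  have h2 := fun k (hk : k < m) => (hsteps k hk).2.2.2.1
  refine stopsWithOracle_of_bounds (m := m) hτ hθ hα hα0 hstand hδ hz
    (by positivity : 0 ≤ 8 * Q * η) hsmall hball ?_ h1 h2
    (fun k hk => by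
      have := (hsteps k hk).2.2.2.2.1
      rwa [hres] at this) (by linarith) ?_
  · rw [← hmdef] at hm
    rcases h0 : m with _ | k
    · have h1 := hstand.norm_residual_le hx₀ball hz
      rw [h0, hα0, mul_one_div, le_div_iff₀ hα₀] at hm
      have h2 : asymptoticC3 * √α₀ * ‖x₀ - xd‖ ≤ (τ - 1) * δ := by
        calc _ ≤ asymptoticC3 * √α₀ * (asymptoticC3 * √α₀ * ‖u‖) := by gcongr
          _ = asymptoticC3 * asymptoticC3 * (√α₀ * √α₀) * ‖u‖ := by ring
          _ = asymptoticC3 * asymptoticC3 * α₀ * ‖u‖ := by rw [Real.mul_self_sqrt hα₀.le]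
          _ ≤ 1 * 1 * α₀ * ‖u‖ := by gcongr <;> linarith
          _ ≤ 3 * (α₀ * ‖u‖) := by
            have : 0 ≤ α₀ * ‖u‖ := by positivity
            linarith
          _ ≤ (τ - 1) * γ * (α₀ * ‖u‖) := by gcongr
          _ = (τ - 1) * (γ * ‖u‖ * α₀) := by ring
          _ ≤ (τ - 1) * δ := by gcongr
      change ‖F x₀ - z‖ ≤ τ * δ
      linarith
    · have hkm : k < m := by omega
      obtain ⟨-, -, -, -, -, h5, -⟩ := hsteps k hkm
      rw [hres] at h5
      rw [h0] at hm
      have hspos : 0 < 1 / α k := by have := hα.pos k; positivity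
      have h6 : 3 * ‖u‖ ≤ (τ - 1) * (δ * (1 / α k)) := by
        have h7 := hα.succ_le hθ k
        rw [hα0] at h7
        have hϑ0 : 0 < 1 + θ₀ * α₀ := by positivity
        refine le_of_mul_le_mul_left ?_ hϑ0
        calc _ = (τ - 1) * (γ * ‖u‖) := by rw [← mul_assoc, ← mul_assoc, hγ]; ring
          _ ≤ (τ - 1) * (δ * (1 / α (k + 1))) := by gcongr
          _ ≤ (τ - 1) * (δ * ((1 + θ₀ * α₀) * (1 / α k))) := by gcongr
          _ = _ := by ring
      refine le_of_mul_le_mul_right ?_ hspos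
      linarith
  · intro n hnm hdisc
    have hTa := hLip.taylor_right hL hstand.differentiableAt hstand.center_mem (hball n hnm)
    rw [← hT] at hTa
    change ‖F (x n) - z‖ ≤ τ * δ at hdisc
    change ‖T (x n - xd)‖ ≤ _
    have h4 := norm_sub_norm_le (T (x n - xd)) (F (x n) - F xd)
    rw [norm_sub_rev (T (x n - xd)) (F (x n) - F xd)] at h4
    have h5 := norm_add_le (F (x n) - z) (z - F xd)
    rw [sub_add_sub_cancel] at h5
    have h6 : ‖T (x n - xd)‖ ≤ (τ + 1) * δ + L * ‖x n - xd‖ ^ 2 := by linarith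
    have hX := norm_nonneg (T (x n - xd))
    have hQηX := mul_le_mul_of_nonneg_right hQη1 hX
    -- The quadratic remainder is not relative to T e_n, so ‖e_n‖² itself is interpolated between u
    -- and T e_n: directly for n = 0, through the last bound of the Newton step for n = k + 1.
    suffices h7 : L * ‖x n - xd‖ ^ 2 ≤ 2 * (Q * η) * ‖T (x n - xd)‖ + 1 / 8 * δ by linarith
    rcases n with _ | k
    · have h7 : ‖x₀ - xd‖ ^ 2 ≤ ‖T (x₀ - xd)‖ * ‖u‖ := by
        rw [← real_inner_self_eq_norm_sq]
        nth_rw 2 [hu]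
        rw [ContinuousLinearMap.adjoint_inner_right]
        exact real_inner_le_norm _ _
      rw [hx0] at hX ⊢
      calc _ ≤ L * (‖T (x₀ - xd)‖ * ‖u‖) := by gcongr
        _ = L * ‖u‖ * ‖T (x₀ - xd)‖ := by ring
        _ ≤ Q * η * ‖T (x₀ - xd)‖ := mul_le_mul_of_nonneg_right (hη.trans hηQ) hX
        _ ≤ _ := by
          have := mul_nonneg hQη0 hX
          linarith
    · have hkm : k < m := hnm
      obtain ⟨-, -, -, -, -, -, h7⟩ := hsteps k hkm
      rw [← hT] at h7
      set κ := residualRatio θ₀ (1 / α₀) with hκ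
      have hκ1 : 1 ≤ κ := one_le_residualRatio hθ (by positivity)
      have hκs : 128 * κ * (Q * η) ≤ 1 := by
        have h8 : 0 ≤ 128 * κ * (Q * η) * (1 / (τ - 1)) := by positivity
        linarith
      -- The value 16Qη adds the linearization error and the exchange of S_k for T, 8Qη each.
      have h8 := iterate_norm_le_next (T := T) (s := fun k => 1 / α k) (e := fun k => x k - xd)
        (θ₀ := θ₀) (δ := δ) (ε := 16 * Q * η) (n := m) hstand.norm_normalOp_le
        (by have := hα.pos 0; positivity) hα.monotone hθ (fun k => (hα.step k).2) hδ.le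
        (by positivity) (by rw [hα0]; linarith) (fun k hk => by
          have h9 := norm_add_le (x (k + 1) - xd
              - expOp (normalOp (fderiv ℝ F (x k))) (1 / α k) (x₀ - xd))
            (expOp (normalOp (fderiv ℝ F (x k))) (1 / α k) (x₀ - xd)
              - expOp (normalOp T) (1 / α k) (x₀ - xd))
          rw [sub_add_sub_cancel] at h9
          have h10 := h1 k hk
          have h11 := h2 k hk (1 / α k) (by have := hα.pos k; positivity)
          change ‖x (k + 1) - xd - expOp (normalOp T) (1 / α k) (x₀ - xd)‖ ≤ _
          linarith) k hkm
      simp only [hα0, ← hκ] at h8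
      set e' := ‖x (k + 1) - xd‖
      set r := √(1 / α k) with hr
      have hr2 : r ^ 2 = 1 / α k := Real.sq_sqrt (by have := hα.pos k; positivity)
      have h9 : Q * η * ‖x k - xd‖ * e' ≤ 1 / 16 * ((e' + δ * r) * e') := by
        calc _ ≤ Q * η * (8 * κ * (e' + δ * r)) * e' := by gcongr
          _ = 8 * κ * (Q * η) * ((e' + δ * r) * e') := by ring
          _ ≤ _ := by
            gcongr
            linarith
      have h10 : (e' + δ * r) * e' ≤ 2 * e' ^ 2 + δ * (γ * ‖u‖) := by
        have h11 := mul_le_mul_of_nonneg_left (hlt k hkm) hδ.le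
        have h12 := two_mul_le_add_sq e' (δ * r)
        have h13 : (δ * r) ^ 2 = δ * (δ * (1 / α k)) := by rw [mul_pow, hr2]; ring
        have h14 : 0 ≤ δ * (γ * ‖u‖) := by positivity
        have h15 := sq_nonneg e'
        linarith
      have h11 : e' ^ 2 ≤ 2 * (Q * ‖u‖ * ‖T (x (k + 1) - xd)‖) + δ * (γ * ‖u‖) := by
        have h12 : 0 ≤ Q * ‖u‖ * ‖T (x (k + 1) - xd)‖ := by positivity
        have h13 : 0 ≤ δ * (γ * ‖u‖) := by positivity
        linarith
      calc _ ≤ L * (2 * (Q * ‖u‖ * ‖T (x (k + 1) - xd)‖) + δ * (γ * ‖u‖)) := by gcongr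
        _ = L * ‖u‖ * (2 * Q * ‖T (x (k + 1) - xd)‖ + δ * γ) := by ring
        _ ≤ η * (2 * Q * ‖T (x (k + 1) - xd)‖ + δ * γ) := by gcongr
        _ = 2 * (Q * η) * ‖T (x (k + 1) - xd)‖ + γ * η * δ := by ring
        _ ≤ _ := by
          gcongr
          linarith

end LipschitzStopping

/-! ### Source conditions and their consequences for the stopped error. -/

section SourceConditions

variable {X Y : Type*} [NormedAddCommGroup X] [InnerProductSpace ℝ X] [CompleteSpace X]
  [NormedAddCommGroup Y] [InnerProductSpace ℝ Y] [CompleteSpace Y]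

open ContinuousLinearMap (adjoint)

/-- A vector `e` with `|⟨e, x⟩| ≤ c ‖T x‖` for all `x` lies in the range of the adjoint. -/
theorem exists_adjoint_eq_of_inner_le (T : X →L[ℝ] Y) {e : X} {c : ℝ}
    (h : ∀ x, |inner ℝ e x| ≤ c * ‖T x‖) : ∃ u, adjoint T u = e := by
  -- The functional Tx ↦ ⟨e, x⟩ is well defined and bounded on the range of T; Hahn-Banach extends
  -- it to Y and Riesz represents it by u.
  have hb : ∃ C, ∀ x, ‖(innerSL ℝ e : X →ₗ[ℝ] ℝ) x‖ ≤ C * ‖(T : X →ₗ[ℝ] Y) x‖ := ⟨c, h⟩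
  obtain ⟨g, hg, -⟩ := exists_extension_norm_eq _
    ((innerSL ℝ e : X →ₗ[ℝ] ℝ).compLeftInverse (T : X →ₗ[ℝ] Y))
  refine ⟨(InnerProductSpace.toDual ℝ Y).symm g, ext_inner_right ℝ fun x => ?_⟩
  rw [ContinuousLinearMap.adjoint_inner_left, InnerProductSpace.toDual_symm_apply]
  exact (hg ⟨T x, x, rfl⟩).trans (LinearMap.compLeftInverse_apply_of_bdd _ _ hb x _ rfl)

/-- An element of the range of the adjoint has exactly one preimage of minimal norm. -/
theorem existsUnique_adjoint_eq (T : X →L[ℝ] Y) {e : X} (h : ∃ u, adjoint T u = e) :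
    ∃! u : Y, u ∈ (adjoint T).kerᗮ ∧ e = adjoint T u := by
  obtain ⟨u, rfl⟩ := h
  have : CompleteSpace (adjoint T).ker := (adjoint T).isClosed_ker.completeSpace_coe
  obtain ⟨p, hp, q, hq, rfl⟩ := (adjoint T).ker.exists_add_mem_mem_orthogonal u
  have hp0 : adjoint T p = 0 := hp
  refine ⟨q, ⟨hq, by rw [map_add, hp0, zero_add]⟩, fun v hv => ?_⟩
  have h1 : v - q ∈ (adjoint T).ker := by
    rw [LinearMap.mem_ker]
    change adjoint T (v - q) = 0
    rw [map_sub, ← hv.2, map_add, hp0, zero_add, sub_self]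
  have h2 : v - q ∈ (adjoint T).kerᗮ := Submodule.sub_mem _ hv.1 hq
  have h3 := Submodule.inner_right_of_mem_orthogonal h1 h2
  exact sub_eq_zero.mp (inner_self_eq_zero.mp h3)

/-- Write e = (T*T)^{1/2} w with w = (T*T)^{ν-1/2} ω. Since ‖(T*T)^{1/2} x‖ ≤ ‖Tx‖, one gets |⟨e,
x⟩| ≤ ‖w‖‖Tx‖, and no polar decomposition is needed. -/
theorem HolderSource.exists_adjoint_eq {T : X →L[ℝ] Y} {e ω : X} {ν : ℝ} (hν : 1 / 2 ≤ ν)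
    (h : HolderSource T e ν ω) : ∃ u, adjoint T u = e := by
  have hA := isPositive_normalOp T
  have h1 := continuousOn_rpow_const (ν := 1 / 2) (by norm_num) (Icc 0 ‖normalOp T‖)
  have h2 := continuousOn_rpow_const (ν := ν - 1 / 2) (by linarith) (Icc 0 ‖normalOp T‖)
  have h3 : functionOf (fun t : ℝ => t ^ ν) (normalOp T)
      = functionOf (fun t : ℝ => t ^ (1 / 2 : ℝ)) (normalOp T)
        * functionOf (fun t : ℝ => t ^ (ν - 1 / 2)) (normalOp T) := by
    rw [← functionOf_mul hA h1 h2]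
    refine functionOf_congr hA (continuousOn_rpow_const (by linarith) _) fun t ht => ?_
    rw [← Real.rpow_add_of_nonneg ht.1 (by norm_num) (by linarith), add_sub_cancel]
  set w := functionOf (fun t : ℝ => t ^ (ν - 1 / 2)) (normalOp T) ω with hw
  have he : e = functionOf (fun t : ℝ => t ^ (1 / 2 : ℝ)) (normalOp T) w := by
    rw [h, h3]; rfl
  refine exists_adjoint_eq_of_inner_le T (c := ‖w‖) fun x => ?_
  rw [he, inner_functionOf_comm hA h1]
  refine (abs_real_inner_le_norm _ _).trans ?_
  gcongr
  have := norm_functionOf_le_norm_apply T h1 zero_le_one (fun t ht => by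
    rw [one_mul, Real.sqrt_eq_rpow, abs_of_nonneg (Real.rpow_nonneg ht.1 _)]) x
  linarith

variable {D : Set X} {F : X → Y} {x₀ xd : X} {ρ β₀ α₀ θ₀ τ δ B C : ℝ} {α : ℕ → ℝ} {z : Y}

theorem StopsWithOracle.holder (h : StopsWithOracle α F x₀ xd ρ τ δ B C z)
    (hα : IsParameterSequence θ₀ α) (hθ : 0 ≤ θ₀) (hα0 : α 0 = α₀)
    (hstand : StandingConditions D F xd ρ β₀ α₀) (hδ : 0 < δ) (hB : 0 < B) (hC : 0 ≤ C) {ν : ℝ}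
    (hν : 0 < ν) {ω : X} (he : HolderSource (fderiv ℝ F xd) (x₀ - xd) ν ω) :
    StopsWithError asymptoticFilter α F x₀ xd ρ τ δ z
      (holderConst C B (1 / α₀) θ₀ ν * ‖ω‖ ^ (1 / (1 + 2 * ν)) * δ ^ (2 * ν / (1 + 2 * ν))) := by
  refine h.mono fun c hc hO => ?_
  have h1 := hα.pos 0
  rw [← hα0]
  exact holder_rate (s := fun k => 1 / α k) (isPositive_normalOp _)
    (hstand.norm_normalOp_le.trans (by norm_num)) (by positivity) hα.monotone hθ
    (fun k => (hα.step k).2) hα.tendsto_atTop hν hδ hB hC he hc hO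

theorem StopsWithOracle.log (h : StopsWithOracle α F x₀ xd ρ τ δ B C z)
    (hα : IsParameterSequence θ₀ α) (hθ : 0 ≤ θ₀) (hα0 : α 0 = α₀)
    (hstand : StandingConditions D F xd ρ β₀ α₀) (hδ : 0 < δ) (hC : 0 ≤ C) {μ : ℝ}
    (hμ : 0 < μ) {ω : X} (hδω : δ ≤ ‖ω‖) (he : LogSource (fderiv ℝ F xd) (x₀ - xd) μ ω) :
    StopsWithError asymptoticFilter α F x₀ xd ρ τ δ z
      (logConst C (1 / α₀) θ₀ μ * ‖ω‖ * (1 + |Real.log (δ / ‖ω‖)|) ^ (-μ)) := by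
  refine h.mono fun c hc hO => ?_
  have h1 := hα.pos 0
  rw [← hα0]
  exact log_rate (s := fun k => 1 / α k) (isPositive_normalOp _)
    hstand.norm_normalOp_le (by positivity) hα.monotone hθ
    (fun k => (hα.step k).2) hα.tendsto_atTop hμ hδ hC he hδω hO

theorem oracleConst_pos {θ₀ s₀ C₂ C₃ : ℝ} (hθ : 0 ≤ θ₀) (hs₀ : 0 ≤ s₀) (hC₂ : 0 ≤ C₂)
    (hC₃ : 0 ≤ C₃) : 0 < oracleConst θ₀ s₀ C₂ C₃ := by
  unfold oracleConst
  positivity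

end SourceConditions

theorem corollary6p3 (τ θ₀ α₀ : ℝ) (hτ : 1 < τ) (hθ₀ : 0 < θ₀) (hα₀ : 0 < α₀) :
    -- (i) Lipschitz continuous derivative
    (∃ η₀ : ℝ, 0 < η₀ ∧ ∃ C : ℝ → ℝ, (∀ ν : ℝ, 1 / 2 ≤ ν → 0 < C ν) ∧
      ∀ (X : Type u) [NormedAddCommGroup X] [InnerProductSpace ℝ X] [CompleteSpace X]
        (Y : Type v) [NormedAddCommGroup Y] [InnerProductSpace ℝ Y] [CompleteSpace Y]
        (D : Set X) (F : X → Y) (x₀ xd : X) (ρ β₀ L : ℝ) (α : ℕ → ℝ),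
        IsParameterSequence θ₀ α → α 0 = α₀ →
        StandingConditions D F xd ρ β₀ α₀ →
        LipschitzDeriv F xd ρ L →
        4 * ‖x₀ - xd‖ < ρ →
        ∀ (ν : ℝ) (ω : X), 1 / 2 ≤ ν → HolderSource (fderiv ℝ F xd) (x₀ - xd) ν ω →
          (∃! u : Y, u ∈ (ContinuousLinearMap.adjoint (fderiv ℝ F xd)).kerᗮ ∧
            x₀ - xd = ContinuousLinearMap.adjoint (fderiv ℝ F xd) u) ∧
          ∀ u : Y, u ∈ (ContinuousLinearMap.adjoint (fderiv ℝ F xd)).kerᗮ →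
            x₀ - xd = ContinuousLinearMap.adjoint (fderiv ℝ F xd) u →
            L * ‖u‖ ≤ η₀ →
            ∀ (δ : ℝ) (yδ : Y), 0 < δ → ‖u‖ * δ ≤ η₀ * ρ ^ 2 → ‖yδ - F xd‖ ≤ δ →
              StopsWithError asymptoticFilter α F x₀ xd ρ τ δ yδ
                (C ν * ‖ω‖ ^ (1 / (1 + 2 * ν)) * δ ^ (2 * ν / (1 + 2 * ν)))) ∧
    -- (ii) the two structural conditions on the derivative
    (∀ γ₁ : ℝ, asymptoticC3 * Real.sqrt (1 + θ₀ * α₀) / (τ - 1) < γ₁ →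
      ∃ η₁ : ℝ, 0 < η₁ ∧ ∃ C C' : ℝ → ℝ, (∀ ν : ℝ, 0 < ν → 0 < C ν) ∧
        (∀ μ : ℝ, 0 < μ → 0 < C' μ) ∧
      ∀ (X : Type u) [NormedAddCommGroup X] [InnerProductSpace ℝ X] [CompleteSpace X]
        (Y : Type v) [NormedAddCommGroup Y] [InnerProductSpace ℝ Y] [CompleteSpace Y]
        (D : Set X) (F : X → Y) (x₀ xd : X) (ρ β₀ K₀ K₁ K₂ : ℝ) (α : ℕ → ℝ),
        IsParameterSequence θ₀ α → α 0 = α₀ →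
        StandingConditions D F xd ρ β₀ α₀ →
        0 < K₀ → 0 < K₁ → 0 < K₂ →
        RangeInvariance F xd ρ K₀ →
        DerivDifferenceBound F xd ρ K₁ K₂ →
        2 * (1 + asymptoticC4 * γ₁) * ‖x₀ - xd‖ < ρ →
        x₀ - xd ∈ (fderiv ℝ F xd).kerᗮ →
        (K₀ + K₁ + K₂) * ‖x₀ - xd‖ ≤ η₁ →
        -- the stopping index is well defined for every noise level
        (∀ (δ : ℝ) (yδ : Y), 0 < δ → ‖yδ - F xd‖ ≤ δ →
          ∃ b : ℝ, StopsWithError asymptoticFilter α F x₀ xd ρ τ δ yδ b) ∧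
        -- convergence
        (∀ ε : ℝ, 0 < ε → ∃ δ₀ : ℝ, 0 < δ₀ ∧
          ∀ (δ : ℝ) (yδ : Y), 0 < δ → δ ≤ δ₀ → ‖yδ - F xd‖ ≤ δ →
            StopsWithError asymptoticFilter α F x₀ xd ρ τ δ yδ ε) ∧
        -- Hölder rates
        (∀ (ν : ℝ) (ω : X), 0 < ν → HolderSource (fderiv ℝ F xd) (x₀ - xd) ν ω →
          ∀ (δ : ℝ) (yδ : Y), 0 < δ → ‖yδ - F xd‖ ≤ δ →
            StopsWithError asymptoticFilter α F x₀ xd ρ τ δ yδ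
              (C ν * ‖ω‖ ^ (1 / (1 + 2 * ν)) * δ ^ (2 * ν / (1 + 2 * ν)))) ∧
        -- logarithmic rates
        (∀ (μ : ℝ) (ω : X), 0 < μ → LogSource (fderiv ℝ F xd) (x₀ - xd) μ ω →
          ∀ (δ : ℝ) (yδ : Y), 0 < δ → δ ≤ ‖ω‖ → ‖yδ - F xd‖ ≤ δ →
            StopsWithError asymptoticFilter α F x₀ xd ρ τ δ yδ
              (C' μ * ‖ω‖ * (1 + |Real.log (δ / ‖ω‖)|) ^ (-μ)))) := by
  have hτ1 : 0 < τ - 1 := by linarith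
  have hB : 0 < √α₀ / (τ - 1) := by positivity
  have hϑ0 : 0 < √(1 + θ₀ * α₀) := by positivity
  have hκ := one_le_residualRatio hθ₀.le (one_div_pos.mpr hα₀).le
  set κ := residualRatio θ₀ (1 / α₀)
  constructor
  · have hC : 0 < oracleConst θ₀ (1 / α₀) (1 / (τ - 1)) (2 * τ + 3) :=
      oracleConst_pos hθ₀.le (by positivity) (by positivity) (by linarith)
    -- The 3 is the constant in the residual bound of `lipschitz_step`, and 1 + θ₀α₀ the ratio of
    -- consecutive parameters.
    obtain ⟨γ, hγ⟩ : ∃ γ, γ = 3 * (1 + θ₀ * α₀) / (τ - 1) := ⟨_, rfl⟩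
    have hγ0 : 0 < γ := by rw [hγ]; positivity
    obtain ⟨Q, hQ⟩ : ∃ Q, Q = (3 + γ) * √(1 + θ₀ * α₀) := ⟨_, rfl⟩
    have hQ0 : 0 < Q := by rw [hQ]; positivity
    -- The reciprocal of a sum satisfies both smallness requirements, each summand times η being at
    -- most 1.
    obtain ⟨η, hη⟩ : ∃ η, η = 1 / (16 * Q ^ 2 + 16 * κ * (1 + 1 / (τ - 1)) * (8 * Q)) := ⟨_, rfl⟩
    have hη0 : 0 < η := by rw [hη]; positivity
    have hη1 : (16 * Q ^ 2 + 16 * κ * (1 + 1 / (τ - 1)) * (8 * Q)) * η = 1 := by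
      rw [hη]; exact mul_one_div_cancel (by positivity)
    have h1 : 0 ≤ 16 * Q ^ 2 * η := by positivity
    have h2 : 0 ≤ 16 * κ * (1 + 1 / (τ - 1)) * (8 * Q * η) := by positivity
    refine ⟨η, hη0, holderConst (oracleConst θ₀ (1 / α₀) (1 / (τ - 1)) (2 * τ + 3))
      (√α₀ / (τ - 1)) (1 / α₀) θ₀, fun ν hν => holderConst_pos hC.le hB (by linarith), ?_⟩
    intro X _ _ _ Y _ _ _ D F x₀ xd ρ β₀ L α hα hα0 hstand hLip hρ ν ω hν hsource
    refine ⟨existsUnique_adjoint_eq _ (hsource.exists_adjoint_eq hν),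
      fun u _ hu hLu δ yδ hδ hδρ hy => ?_⟩
    exact (stopsWithOracle_lipschitz hτ hθ₀.le hα hα0 hstand hLip hρ hu hLu hδ hδρ hy
      (by rw [hγ]; field_simp) hQ hη0.le (by linarith) (by linarith)).holder hα hθ₀.le hα0 hstand
      hδ hB hC.le (by linarith) hsource
  · intro γ hγ
    have hc3 := asymptoticC3_pos
    have hc4 := asymptoticC4_pos
    have hγ0 : 0 < γ := lt_trans (by positivity) hγ
    rw [div_lt_iff₀ hτ1] at hγ
    have hC : 0 < oracleConst θ₀ (1 / α₀) (1 / (τ - 1)) (2 * (τ + 1)) :=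
      oracleConst_pos hθ₀.le (by positivity) (by positivity) (by linarith)
    obtain ⟨M, hM⟩ : ∃ M, M = 2 * (1 + asymptoticC4 * γ) := ⟨_, rfl⟩
    have hM0 : 0 < M := by rw [hM]; positivity
    obtain ⟨Q, hQ⟩ : ∃ Q, Q = (5 + 4 * γ) * √(1 + θ₀ * α₀) := ⟨_, rfl⟩
    have hQ0 : 0 < Q := by rw [hQ]; positivity
    obtain ⟨Z, hZ⟩ : ∃ Z, Z = 2 * M + 2 * M * Q + 16 * κ * (1 + 1 / (τ - 1)) * (5 * Q) := ⟨_, rfl⟩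
    have hZ0 : 0 < Z := by rw [hZ]; positivity
    -- The second entry spends the gap left by the strict lower bound on γ₁; the nonlinear part of
    -- the residual at the last index must fit into it.
    obtain ⟨η, hη⟩ : ∃ η, η = min (1 / Z)
      (((τ - 1) * γ - asymptoticC3 * √(1 + θ₀ * α₀)) / (10 * Q * M * √(1 + θ₀ * α₀))) := ⟨_, rfl⟩
    have hη0 : 0 < η := by
      rw [hη]
      refine lt_min (by positivity) (div_pos (by linarith) (by positivity))
    have hη1 : η * Z ≤ 1 := by
      rw [← le_div_iff₀ hZ0, hη]; exact min_le_left _ _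
    have hη2 : η * (10 * Q * M * √(1 + θ₀ * α₀))
        ≤ (τ - 1) * γ - asymptoticC3 * √(1 + θ₀ * α₀) := by
      rw [← le_div_iff₀ (by positivity), hη]; exact min_le_right _ _
    rw [hZ] at hη1
    have h1 : 0 ≤ 2 * M * η := by positivity
    have h2 : 0 ≤ 2 * M * Q * η := by positivity
    have h3 : 0 ≤ 16 * κ * (1 + 1 / (τ - 1)) * (5 * Q * η) := by positivity
    refine ⟨η, hη0, holderConst (oracleConst θ₀ (1 / α₀) (1 / (τ - 1)) (2 * (τ + 1)))
      (√α₀ / (τ - 1)) (1 / α₀) θ₀,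
      logConst (oracleConst θ₀ (1 / α₀) (1 / (τ - 1)) (2 * (τ + 1))) (1 / α₀) θ₀,
      fun ν hν => holderConst_pos hC.le hB hν, fun μ hμ => logConst_pos hC hμ, ?_⟩
    intro X _ _ _ Y _ _ _ D F x₀ xd ρ β₀ K₀ K₁ K₂ α hα hα0 hstand hK₀ hK₁ hK₂ hRI hDD hρ hker hKη
    have horacle : ∀ (δ : ℝ) (yδ : Y), 0 < δ → ‖yδ - F xd‖ ≤ δ →
        StopsWithOracle α F x₀ xd ρ τ δ (√α₀ / (τ - 1))
          (oracleConst θ₀ (1 / α₀) (1 / (τ - 1)) (2 * (τ + 1))) yδ := fun δ yδ hδ hy =>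
      stopsWithOracle_structural hτ hθ₀.le hα hα0 hstand hK₀.le hK₁.le hK₂.le hRI hDD hδ hy hη0.le
        hKη hγ0 hM (by rwa [hM]) hQ (by linarith) (by linarith) (by linarith) (by linarith)
    refine ⟨fun δ yδ hδ hy => ?_, fun ε hε => ?_, fun ν ω hν hsource δ yδ hδ hy => ?_,
      fun μ ω hμ hsource δ yδ hδ hδω hy => ?_⟩
    · exact ⟨_, (horacle δ yδ hδ hy).mono fun c _ hO => hO 0⟩
    · obtain ⟨δ₀, hδ₀, l, hl⟩ := exists_noise_level hker hα.tendsto_atTop hC hε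
      exact ⟨δ₀, hδ₀, fun δ yδ hδ hδδ₀ hy =>
        (horacle δ yδ hδ hy).mono fun c _ hO => (hO l).trans (hl δ hδδ₀)⟩
    · exact (horacle δ yδ hδ hy).holder hα hθ₀.le hα0 hstand hδ hB hC.le hν hsource
    · exact (horacle δ yδ hδ hy).log hα hθ₀.le hα0 hstand hδ hC.le hμ hδω hsource
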